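/- **Setting.** An instance of the transportation problem consists of finite sets $A$ of demand nodes and $B$ of supply nodes, $n=|A|+|B|$, real demands $d_a\ge 0$, supplies $s_b\ge 0$ with $U:=\sum_b s_b\le\sum_a d_a$, and edge costs $c(a,b)\ge 0$, $(a,b)\in A\times B$, whose largest value is $C$. A transport plan is $\sigma:A\times B\to\mathbb R_{\ge 0}$ with $\sum_b\sigma(a,b)\le d_a$ and $\sum_a\sigma(a,b)\le s_b$; it is maximum if $\sum_a\sigma(a,b)=s_b$ for all $b$. Its cost is $w(\sigma)=\sum_{a,b}\sigma(a,b)c(a,b)$. A maximum transport plan $\sigma$ is $\delta$-close if $w(\sigma)\le w(\sigma^*)+U\delta$, where $\sigma^*$ is a maximum transport plan of minimum cost. **Algorithm.** The input is an instance together with $0<\varepsilon<1$ and $\delta>0$. Put $\delta'=(1-\varepsilon)\delta$ and $\alpha=\frac{2nC}{\varepsilon U\delta}$ (with the convention $x/0=0$), and form the integer demands $\overline d_a=\lceil\alpha d_a\rceil$, supplies $\overline s_b=\lfloor\alpha s_b\rfloor$ and costs $\overline c(a,b)=\lfloor 2c(a,b)/\delta'\rfloor$. Start with the zero integral plan $\sigma$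 and zero dual weights $y$ on $A\cup B$. The residual graph has a forward edge $b\to a$ of capacity $\min\{\overline d_a,\overline s_b\}-\sigma(a,b)$ and slack $\overline c(a,b)+1-y(a)-y(b)$, and a backward edge $a\to b$ of capacity $\sigma(a,b)$ and slack $y(a)+y(b)-\overline c(a,b)$, whenever these capacities are positive; an edge is admissible if its slack is $0$. A node is free if its scaled demand or supply is not exhausted by $\sigma$. While some supply node is free, the algorithm executes a phase, which consists of two steps: 1. *Hungarian search.* Dijkstra's algorithm, with the slacks as edge lengths, computes the distance $\ell_v$ from the set of free supply nodes to every vertex $v$; let $\ell_t$ be the least distance of a free demand node. For every $v$ with $\ell_v<\ell_t$, replace $y(v)$ by $y(v)-\ell_t+\ell_v$ if $v\in A$ and by $y(v)+\ell_t-\ell_v$ if $v\in B$. 2. *Partial depth-first search.* Starting with the admissible graph, and as long as it contains a free supply node, run a depth-first search from such a node, which stops when it visits a free demand node. If it does, delete all visited edges that are not on the augmenting path found, and augment $\sigma$ along this path by its bottleneck capacity (including the remaining supply and the remaining demand at its ends); otherwise delete all visited vertices and edges. Finally, divide $\sigma$ by $\alpha$, reduce the result at every demand node where it exceeds the demand,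 and send the remaining supplies to unused demands in an arbitrary order. **Theorem.** This algorithm can be implemented as a deterministic program for a real random-access machine in which every memory access, integer addition, subtraction and minimum, real field operation and minimum, rounding, comparison, logical connective and jump takes one step, such that, on every instance with at least one edge and for all $0<\varepsilon<1$ and $\delta>0$, the program has exactly one run and halts, and * the plan it returns is a $\delta$-close (in particular maximum) transport plan; * it executes at most $\left\lfloor\frac{2C}{(1-\varepsilon)\delta}\right\rfloor+1$ phases, each consisting of a Hungarian search followed by a partial depth-first search; * if $\delta\le C$, it takes at most $K\left(\frac{n^2C}{(1-\varepsilon)\delta}+\frac{nC^2}{\varepsilon(1-\varepsilon)\delta^2}\right)$ steps, where $K$ is an absolute constant; in particular, $O\!\left(\frac{n^2C}{\delta}+\frac{nC^2}{\delta^2}\right)$ steps for every fixed $\varepsilon$. -/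

import Mathlib

/-! ## The transportation problem -/

/-- An instance of the transportation problem with demand nodes `Fin p` and supply nodes `Fin q`;
the total supply is at most the total demand. -/
structure TransportInstance (p q : ℕ) where
  demand : Fin p → ℝ
  supply : Fin q → ℝ
  cost : Fin p → Fin q → ℝ
  demand_nonneg : ∀ a, 0 ≤ demand a
  supply_nonneg : ∀ b, 0 ≤ supply b
  cost_nonneg : ∀ a b, 0 ≤ cost a b
  supply_le_demand : ∑ b, supply b ≤ ∑ a, demand a

namespace TransportInstance

variable {p q : ℕ} (I : TransportInstance p q)

/-- The total supply `U`. -/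
def totalSupply : ℝ := ∑ b, I.supply b

/-- `C` is the largest cost of an edge. -/
def IsMaxCost (C : ℝ) : Prop := IsGreatest {x | ∃ a b, x = I.cost a b} C

/-- `σ` is a transport plan. -/
def IsPlan (σ : Fin p → Fin q → ℝ) : Prop :=
  (∀ a b, 0 ≤ σ a b) ∧ (∀ a, ∑ b, σ a b ≤ I.demand a) ∧ (∀ b, ∑ a, σ a b ≤ I.supply b)

/-- `σ` is a maximum transport plan: it transports all the supplies. -/
def IsMaxPlan (σ : Fin p → Fin q → ℝ) : Prop :=
  I.IsPlan σ ∧ ∀ b, ∑ a, σ a b = I.supply b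

/-- The cost `w(σ)` of a plan. -/
def planCost (σ : Fin p → Fin q → ℝ) : ℝ := ∑ a, ∑ b, σ a b * I.cost a b

/-- `σ` is a minimum-cost maximum transport plan. -/
def IsOptimalPlan (σ : Fin p → Fin q → ℝ) : Prop :=
  I.IsMaxPlan σ ∧ ∀ τ, I.IsMaxPlan τ → I.planCost σ ≤ I.planCost τ

/-- `σ` is a `δ`-close transport plan: a maximum transport plan whose cost exceeds the optimal cost
by at most `U δ`. -/
def IsClosePlan (δ : ℝ) (σ : Fin p → Fin q → ℝ) : Prop :=
  I.IsMaxPlan σ ∧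
    ∃ σopt, I.IsOptimalPlan σopt ∧ I.planCost σ ≤ I.planCost σopt + I.totalSupply * δ

end TransportInstance

/-! ## The machine model: programs of a real random-access machine with unit costs

A store consists of integer and real registers, one-dimensional arrays and two-dimensional arrays.
Every read, every arithmetic operation, every comparison, every logical connective, every write and
every jump costs one step. The integer operations are addition, subtraction and minimum; the real
ones are the field operations, the minimum, and rounding down. -/

namespace RealRAM

/-- Integer registers. -/
inductive IReg
  | nA | nB | phases | left | a | b | v | u | w | k | top | found | ellT | r | start | tmp
  deriving DecidableEq

/-- Real registers. -/
inductive RReg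
  | eps | delta | deltaP | totalS | maxC | alpha | acc | m
  deriving DecidableEq

/-- One-dimensional integer arrays. -/
inductive IVec
  | dbar | sbar | recv | used | y | ell | done | ptr | mark | path
  deriving DecidableEq

/-- Two-dimensional integer arrays. -/
inductive IMat
  | cbar | flow
  deriving DecidableEq

/-- One-dimensional real arrays. -/
inductive RVec
  | demand | supply | room | rest
  deriving DecidableEq

/-- Two-dimensional real arrays. -/
inductive RMat
  | cost | plan
  deriving DecidableEq

/-- The contents of the memory. -/
structure Store where
  ireg : IReg → ℤ
  rreg : RReg → ℝ
  ivec : IVec → ℤ → ℤ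
  imat : IMat → ℤ → ℤ → ℤ
  rvec : RVec → ℤ → ℝ
  rmat : RMat → ℤ → ℤ → ℝ

/-- Integer expressions. -/
inductive IExp
  | const (z : ℤ)
  | reg (x : IReg)
  | vec (A : IVec) (i : IExp)
  | mat (A : IMat) (i j : IExp)
  | add (e f : IExp)
  | sub (e f : IExp)
  | min (e f : IExp)

/-- Real expressions. -/
inductive RExp
  | ofInt (e : IExp)
  | reg (x : RReg)
  | vec (A : RVec) (i : IExp)
  | mat (A : RMat) (i j : IExp)
  | add (e f : RExp)
  | sub (e f : RExp)
  | mul (e f : RExp)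
  | div (e f : RExp)
  | min (e f : RExp)

/-- Tests. -/
inductive BExp
  | ieq (e f : IExp)
  | ilt (e f : IExp)
  | rlt (e f : RExp)
  | and (B B' : BExp)
  | or (B B' : BExp)

/-- Commands. -/
inductive Cmd
  | iset (x : IReg) (e : IExp)
  | ifloor (x : IReg) (e : RExp)
  | rset (x : RReg) (e : RExp)
  | ivset (A : IVec) (i e : IExp)
  | imset (A : IMat) (i j e : IExp)
  | rvset (A : RVec) (i : IExp) (e : RExp)
  | rmset (A : RMat) (i j : IExp) (e : RExp)
  | skip
  | seq (c d : Cmd)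
  | ite (B : BExp) (c d : Cmd)
  | loop (B : BExp) (c : Cmd)

/-- The value of an integer expression. -/
def IExp.eval (s : Store) : IExp → ℤ
  | const z => z
  | reg x => s.ireg x
  | vec A i => s.ivec A (i.eval s)
  | mat A i j => s.imat A (i.eval s) (j.eval s)
  | add e f => e.eval s + f.eval s
  | sub e f => e.eval s - f.eval s
  | min e f => Min.min (e.eval s) (f.eval s)

/-- The number of steps that the evaluation of an integer expression takes. -/
def IExp.steps : IExp → ℕ
  | const _ => 1
  | reg _ => 1
  | vec _ i => i.steps + 1
  | mat _ i j => i.steps + j.steps + 1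
  | add e f => e.steps + f.steps + 1
  | sub e f => e.steps + f.steps + 1
  | min e f => e.steps + f.steps + 1

/-- The value of a real expression. -/
noncomputable def RExp.eval (s : Store) : RExp → ℝ
  | ofInt e => (e.eval s : ℝ)
  | reg x => s.rreg x
  | vec A i => s.rvec A (i.eval s)
  | mat A i j => s.rmat A (i.eval s) (j.eval s)
  | add e f => e.eval s + f.eval s
  | sub e f => e.eval s - f.eval s
  | mul e f => e.eval s * f.eval s
  | div e f => e.eval s / f.eval s
  | min e f => Min.min (e.eval s) (f.eval s)

/-- The number of steps that the evaluation of a real expression takes. -/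
def RExp.steps : RExp → ℕ
  | ofInt e => e.steps + 1
  | reg _ => 1
  | vec _ i => i.steps + 1
  | mat _ i j => i.steps + j.steps + 1
  | add e f => e.steps + f.steps + 1
  | sub e f => e.steps + f.steps + 1
  | mul e f => e.steps + f.steps + 1
  | div e f => e.steps + f.steps + 1
  | min e f => e.steps + f.steps + 1

/-- The truth of a test. -/
def BExp.Holds (s : Store) : BExp → Prop
  | ieq e f => e.eval s = f.eval s
  | ilt e f => e.eval s < f.eval s
  | rlt e f => e.eval s < f.eval s
  | and B B' => B.Holds s ∧ B'.Holds s
  | or B B' => B.Holds s ∨ B'.Holds s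

/-- The number of steps that a test takes. -/
def BExp.steps : BExp → ℕ
  | ieq e f => e.steps + f.steps + 1
  | ilt e f => e.steps + f.steps + 1
  | rlt e f => e.steps + f.steps + 1
  | and B B' => B.steps + B'.steps + 1
  | or B B' => B.steps + B'.steps + 1

namespace Store

def setIReg (s : Store) (x : IReg) (z : ℤ) : Store :=
  { s with ireg := Function.update s.ireg x z }

def setRReg (s : Store) (x : RReg) (z : ℝ) : Store :=
  { s with rreg := Function.update s.rreg x z }

def setIVec (s : Store) (A : IVec) (i z : ℤ) : Store :=
  { s with ivec := Function.update s.ivec A (Function.update (s.ivec A) i z) }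

def setIMat (s : Store) (A : IMat) (i j z : ℤ) : Store :=
  { s with
    imat := Function.update s.imat A
        (Function.update (s.imat A) i (Function.update (s.imat A i) j z)) }

def setRVec (s : Store) (A : RVec) (i : ℤ) (z : ℝ) : Store :=
  { s with rvec := Function.update s.rvec A (Function.update (s.rvec A) i z) }

def setRMat (s : Store) (A : RMat) (i j : ℤ) (z : ℝ) : Store :=
  { s with
    rmat := Function.update s.rmat A
        (Function.update (s.rmat A) i (Function.update (s.rmat A i) j z)) }

end Store

/-- `Exec c s s' t`: the command `c`, started on the store `s`, stops after exactly `t` steps with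
the store `s'`. -/
inductive Exec : Cmd → Store → Store → ℕ → Prop
  | iset (s : Store) (x : IReg) (e : IExp) :
      Exec (.iset x e) s (s.setIReg x (e.eval s)) (e.steps + 1)
  | ifloor (s : Store) (x : IReg) (e : RExp) :
      Exec (.ifloor x e) s (s.setIReg x ⌊e.eval s⌋) (e.steps + 2)
  | rset (s : Store) (x : RReg) (e : RExp) :
      Exec (.rset x e) s (s.setRReg x (e.eval s)) (e.steps + 1)
  | ivset (s : Store) (A : IVec) (i e : IExp) :
      Exec (.ivset A i e) s (s.setIVec A (i.eval s) (e.eval s)) (i.steps + e.steps + 1)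
  | imset (s : Store) (A : IMat) (i j e : IExp) :
      Exec (.imset A i j e) s (s.setIMat A (i.eval s) (j.eval s) (e.eval s))
        (i.steps + j.steps + e.steps + 1)
  | rvset (s : Store) (A : RVec) (i : IExp) (e : RExp) :
      Exec (.rvset A i e) s (s.setRVec A (i.eval s) (e.eval s)) (i.steps + e.steps + 1)
  | rmset (s : Store) (A : RMat) (i j : IExp) (e : RExp) :
      Exec (.rmset A i j e) s (s.setRMat A (i.eval s) (j.eval s) (e.eval s))
        (i.steps + j.steps + e.steps + 1)
  | skip (s : Store) : Exec .skip s s 1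
  | seq {c d : Cmd} {s s' s'' : Store} {t t' : ℕ} :
      Exec c s s' t → Exec d s' s'' t' → Exec (.seq c d) s s'' (t + t')
  | iteTrue {B : BExp} {c d : Cmd} {s s' : Store} {t : ℕ} :
      B.Holds s → Exec c s s' t → Exec (.ite B c d) s s' (B.steps + 1 + t)
  | iteFalse {B : BExp} {c d : Cmd} {s s' : Store} {t : ℕ} :
      ¬ B.Holds s → Exec d s s' t → Exec (.ite B c d) s s' (B.steps + 1 + t)
  | loopFalse {B : BExp} {c : Cmd} {s : Store} :
      ¬ B.Holds s → Exec (.loop B c) s s (B.steps + 1)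
  | loopTrue {B : BExp} {c : Cmd} {s s' s'' : Store} {t t' : ℕ} :
      B.Holds s → Exec c s s' t → Exec (.loop B c) s' s'' t' →
        Exec (.loop B c) s s'' (B.steps + 1 + t + t')

/-! Abbreviations for writing programs: a register stands for its contents, `A i` and `A i j` for
entries of arrays, and `x.set e`, `A.set i e`, `A.set i j e` for assignments. -/

instance : Coe IReg IExp := ⟨.reg⟩
instance : Coe RReg RExp := ⟨.reg⟩
instance : Coe IExp RExp := ⟨.ofInt⟩
instance (k : ℕ) : OfNat IExp k := ⟨.const k⟩
instance (k : ℕ) : OfNat RExp k := ⟨.ofInt (.const k)⟩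
instance : Add IExp := ⟨.add⟩
instance : Sub IExp := ⟨.sub⟩
instance : Min IExp := ⟨.min⟩
instance : Add RExp := ⟨.add⟩
instance : Sub RExp := ⟨.sub⟩
instance : Mul RExp := ⟨.mul⟩
instance : Div RExp := ⟨.div⟩
instance : Min RExp := ⟨.min⟩
instance : CoeFun IVec (fun _ => IExp → IExp) := ⟨.vec⟩
instance : CoeFun IMat (fun _ => IExp → IExp → IExp) := ⟨.mat⟩
instance : CoeFun RVec (fun _ => IExp → RExp) := ⟨.vec⟩
instance : CoeFun RMat (fun _ => IExp → IExp → RExp) := ⟨.mat⟩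

abbrev IReg.set (x : IReg) (e : IExp) : Cmd := .iset x e
abbrev IReg.setFloor (x : IReg) (e : RExp) : Cmd := .ifloor x e
abbrev RReg.set (x : RReg) (e : RExp) : Cmd := .rset x e
abbrev IVec.set (A : IVec) (i e : IExp) : Cmd := .ivset A i e
abbrev IMat.set (A : IMat) (i j e : IExp) : Cmd := .imset A i j e
abbrev RVec.set (A : RVec) (i : IExp) (e : RExp) : Cmd := .rvset A i e
abbrev RMat.set (A : RMat) (i j : IExp) (e : RExp) : Cmd := .rmset A i j e

local infixr:20 ";;" => Cmd.seq
local infix:50 "≐" => BExp.ieq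
local infix:50 "≺" => BExp.ilt
local infix:50 "≺ᵣ" => BExp.rlt
local infixr:35 "⩓" => BExp.and
local infixr:30 "⩔" => BExp.or

/-- `for x = 0, …, e - 1 do c`. -/
def forTo (x : IReg) (e : IExp) (c : Cmd) : Cmd :=
  x.set 0 ;; .loop (x ≺ e) (c ;; x.set (x + 1))

/-- `if B then c`. -/
def when (B : BExp) (c : Cmd) : Cmd := .ite B c .skip

/-! ## The adapted single-scale Gabow–Tarjan algorithm

The vertices are numbered: the demand node `a` is the vertex `a`, and the supply node `b` is the
vertex `nA + b`. The array `flow` is the integral plan of the scaled instance, `y` are the dual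
weights, and `recv a`, `used b` are the amounts that `flow` delivers to `a` and takes from `b`. -/

open IReg RReg IVec IMat RVec RMat

/-- Scaling: `α = 2nC/(εUδ)`, `δ' = (1-ε)δ`, demands `⌈d α⌉`, supplies `⌊s α⌋`,
costs `⌊2c/δ'⌋`. -/
def scaleInstance : Cmd :=
  totalS.set 0 ;;
  forTo b nB (totalS.set (totalS + supply b)) ;;
  maxC.set 0 ;;
  forTo a nA (forTo b nB (when (maxC ≺ᵣ cost a b) (maxC.set (cost a b)))) ;;
  alpha.set ((2 * (nA + nB : IExp) * maxC) / (eps * totalS * delta)) ;;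
  deltaP.set ((1 - eps) * delta) ;;
  forTo a nA (tmp.setFloor (0 - demand a * alpha) ;; dbar.set a (0 - tmp)) ;;
  forTo b nB (tmp.setFloor (supply b * alpha) ;; sbar.set b tmp) ;;
  forTo a nA (forTo b nB (tmp.setFloor (2 * cost a b / deltaP) ;; cbar.set a b tmp))

/-- The zero plan with zero dual weights; `left` is the amount of supply not yet transported. -/
def initPlan : Cmd :=
  forTo a nA (recv.set a 0 ;; forTo b nB (flow.set a b 0)) ;;
  left.set 0 ;;
  forTo b nB (used.set b 0 ;; left.set (left + sbar b)) ;;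
  forTo v (nA + nB) (y.set v 0) ;;
  phases.set 0

/-- `b` is a free supply node. -/
def freeSupply (b : IExp) : BExp := used b ≺ sbar b

/-- `a` is a free demand node. -/
def freeDemand (a : IExp) : BExp := recv a ≺ dbar a

/-- The residual capacity of the forward edge from `b` to `a`; the edge is present in the residual
graph if it is positive. -/
def capFwd (a b : IExp) : IExp := min (dbar a) (sbar b) - flow a b

/-- The residual capacity of the backward edge from `a` to `b`; the edge is present in the residual
graph if it is positive. -/
def capBwd (a b : IExp) : IExp := flow a b

/-- The slack of the forward edge from `b` to `a`. -/
def slackFwd (a b : IExp) : IExp := cbar a b + 1 - y a - y (nA + b)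

/-- The slack of the backward edge from `a` to `b`. -/
def slackBwd (a b : IExp) : IExp := y a + y (nA + b) - cbar a b

/-- Relax an edge into the vertex `v` along which `v` is reached at distance `e`.
The value `-1` of `ell v` stands for an infinite distance. -/
def relax (v e : IExp) : Cmd := when ((ell v ≺ 0) ⩔ (e ≺ ell v)) (ell.set v e)

/-- Dijkstra's algorithm from the source `s` in the augmented residual network with the slacks as
weights: `ell v` becomes the distance of the vertex `v`, and `ellT` the distance of the sink `t`. -/
def dijkstra : Cmd :=
  forTo v (nA + nB) (ell.set v (0 - 1) ;; done.set v 0) ;;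
  forTo b nB (when (freeSupply b) (ell.set (nA + b) 0)) ;;
  u.set 0 ;;
  .loop ((0 - 1) ≺ u)
    (u.set (0 - 1) ;;
     forTo v (nA + nB)
       (when ((done v ≐ 0) ⩓ ((0 - 1) ≺ ell v) ⩓ ((u ≺ 0) ⩔ (ell v ≺ ell u))) (u.set v)) ;;
     when ((0 - 1) ≺ u)
       (done.set u 1 ;;
        .ite (u ≺ nA)
          (forTo b nB (when (0 ≺ capBwd u b) (relax (nA + b) (ell u + slackBwd u b))))
          (forTo a nA
            (when (0 ≺ capFwd a (u - nA)) (relax a (ell u + slackFwd a (u - nA))))))) ;;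
  ellT.set (0 - 1) ;;
  forTo a nA
    (when (freeDemand a ⩓ ((0 - 1) ≺ ell a) ⩓ ((ellT ≺ 0) ⩔ (ell a ≺ ellT))) (ellT.set (ell a)))

/-- The adjustment of the dual weights of the vertices with `ell v < ellT`. -/
def adjustDuals : Cmd :=
  forTo v (nA + nB)
    (when (((0 - 1) ≺ ell v) ⩓ (ell v ≺ ellT))
      (.ite (v ≺ nA)
        (y.set v (y v - ellT + ell v))
        (y.set v (y v + ellT - ell v))))

/-- First step of a phase. -/
def hungarianSearch : Cmd := dijkstra ;; adjustDuals

/-- Put the vertex `v` on top of the current path. -/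
def push (v : IExp) : Cmd := mark.set v 1 ;; top.set (top + 1) ;; path.set top v

/-- Depth-first search in what is left of the admissible graph, from the supply node `start`, up to
the first visit of a free demand node. The current path is `path 0, …, path top`. The edges out of
`v` to the nodes before `ptr v` are deleted; the marked vertices are those of the current path and
those from which the search has backtracked, which are deleted. -/
def search : Cmd :=
  top.set (0 - 1) ;;
  found.set 0 ;;
  push (nA + start) ;;
  .loop ((found ≐ 0) ⩓ ((0 - 1) ≺ top))
    (u.set (path top) ;;
     .ite (u ≺ nA)
       (.ite (freeDemand u)
         (found.set 1)
         (.ite (ptr u ≺ nB)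
           (w.set (ptr u) ;;
            .ite ((0 ≺ capBwd u w) ⩓ (slackBwd u w ≐ 0) ⩓ (mark (nA + w) ≐ 0))
              (push (nA + w))
              (ptr.set u (w + 1)))
           (top.set (top - 1))))
       (.ite (ptr u ≺ nA)
         (w.set (ptr u) ;;
          .ite ((0 ≺ capFwd w (u - nA)) ⩓ (slackFwd w (u - nA) ≐ 0) ⩓ (mark w ≐ 0))
            (push w)
            (ptr.set u (w + 1)))
         (top.set (top - 1))))

/-- Augment the plan along the current path, which leads from the supply node `start` to the free
demand node `path top`, by its bottleneck capacity `r`. The vertices of the path are unmarked. -/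
def augment : Cmd :=
  r.set (min (sbar start - used start) (dbar (path top) - recv (path top))) ;;
  forTo k top
    (.ite (path k ≺ nA)
      (r.set (min r (capBwd (path k) (path (k + 1) - nA))))
      (r.set (min r (capFwd (path (k + 1)) (path k - nA))))) ;;
  forTo k top
    (.ite (path k ≺ nA)
      (flow.set (path k) (path (k + 1) - nA) (flow (path k) (path (k + 1) - nA) - r))
      (flow.set (path (k + 1)) (path k - nA) (flow (path (k + 1)) (path k - nA) + r))) ;;
  used.set start (used start + r) ;;
  recv.set (path top) (recv (path top) + r) ;;
  left.set (left - r) ;;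
  forTo k (top + 1) (mark.set (path k) 0)

/-- Second step of a phase: searches from the free supply nodes that are left in the admissible
graph, each followed by an augmentation if it has found an augmenting path. -/
def partialDFS : Cmd :=
  forTo v (nA + nB) (ptr.set v 0 ;; mark.set v 0) ;;
  forTo start nB
    (.loop (freeSupply start ⩓ (mark (nA + start) ≐ 0))
      (search ;; when (found ≐ 1) augment))

/-- A phase; the register `phases` counts the phases. -/
def phase : Cmd :=
  phases.set (phases + 1) ;;
  hungarianSearch ;;
  partialDFS

/-- Turn the plan of the scaled instance into a maximum plan of the given instance: divide by `α`,
remove the excess at every demand node, then send the remaining supplies greedily to remaining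
demands. -/
def recoverPlan : Cmd :=
  forTo a nA (forTo b nB (plan.set a b ((flow a b : IExp) / alpha))) ;;
  forTo a nA
    (acc.set 0 ;;
     forTo b nB (acc.set (acc + plan a b)) ;;
     room.set a (demand a - min (demand a) acc) ;;
     acc.set (acc - min (demand a) acc) ;;
     forTo b nB
       (m.set (min (plan a b) acc) ;;
        plan.set a b (plan a b - m) ;;
        acc.set (acc - m))) ;;
  forTo b nB
    (acc.set (supply b) ;;
     forTo a nA (acc.set (acc - plan a b)) ;;
     forTo a nA
       (m.set (min (room a) acc) ;;
        plan.set a b (plan a b + m) ;;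
        room.set a (room a - m) ;;
        acc.set (acc - m)))

/-- The whole algorithm: it executes phases until all the scaled supplies are transported. -/
def gabowTarjan : Cmd :=
  scaleInstance ;;
  initPlan ;;
  .loop (0 ≺ left) phase ;;
  recoverPlan

/-- The store `s` holds the input: the instance `I` and the parameters `ε` and `δ`. The rest of the
memory is arbitrary. -/
structure Store.HoldsInput {p q : ℕ} (s : Store) (I : TransportInstance p q) (ε δ : ℝ) :
    Prop where
  nA_eq : s.ireg nA = p
  nB_eq : s.ireg nB = q
  eps_eq : s.rreg eps = ε
  delta_eq : s.rreg delta = δ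
  demand_eq : ∀ a : Fin p, s.rvec demand (a : ℕ) = I.demand a
  supply_eq : ∀ b : Fin q, s.rvec supply (b : ℕ) = I.supply b
  cost_eq : ∀ (a : Fin p) (b : Fin q), s.rmat cost (a : ℕ) (b : ℕ) = I.cost a b

/-- The plan in the output array of the store. -/
def Store.outputPlan (s : Store) (p q : ℕ) (a : Fin p) (b : Fin q) : ℝ :=
  s.rmat plan (a : ℕ) (b : ℕ)

/-- The number of phases recorded in the store. -/
def Store.phaseCount (s : Store) : ℤ := s.ireg phases

end RealRAM

/-! Everything rests on one invariant of the scaled integral instance, `Feasible`: y(a) + y(b) is at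
most c̄ + 1 on forward residual edges and at least c̄ on backward ones, weights are nonnegative at
supply nodes, nonpositive at demand nodes and zero at free demand nodes, and the admissible graph is
acyclic.

Accuracy. This is complementary slackness up to one unit. Hence a feasible integral plan that
exhausts the scaled supplies costs at most one unit per unit of supply more than any competitor
(`Feasible.flowCost_le`). With cost unit δ'/2, this loss and the rounding of the costs contribute
Uδ'/2 each, together (1-ε)Uδ (`Feasible.unscaled_cost_le`). Rounding demands and supplies leaves at
most n/α of supply to be sent again at a unit cost of at most C, which is εUδ/2 by the choice of α
(`Feasible.remaining_supply_le`).

Phases. A partial depth-first search ends with no admissible path from a free supply node to a free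
demand node (`Blocked`). Slacks are integers, so the next Hungarian search finds ℓ_t ≥ 1
(`DijkstraSpec.pos`) and raises the weight of every free supply node by at least one. Such a node
always has a residual edge to any free demand node, whose weight is zero, so its weight never
exceeds N + 1, where N = ⌊2C/δ'⌋. This bounds the number of phases by N + 1.

Time. Each phase costs O(n²) for Dijkstra's algorithm, and O(n²) for the pointers and dead vertices
of the depth-first search, plus the lengths of the augmenting paths. Sending ρ units along an
admissible path of length k that starts at b changes the cost by ρ(y(b) - (k+1)/2), because its
edges are tight. As y(b) ≤ N + 1, the potential 2(N+1)·left + 2·cost (`augWork`) falls by at least k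
+ 1. It is never negative and starts at 2(N+1) times the total scaled supply, so this bounds the
total length of all augmenting paths.

Acyclicity makes the paths of the search simple and lets the search skip marked vertices. It is
certified by a rank that decreases along admissible edges. Augmentations create only residual edges
of slack one (`PartialAug.res`), and an adjustment of the weights is absorbed by combining the rank
with the distances (`Feasible.adjust`).

The program is verified in a total-correctness calculus (`WP`) whose loop invariants carry a credit
of steps, so that termination, correctness and running time are proved together. Frame conditions
come from `Exec.keeps`, uniqueness of the run from `Exec.deterministic`. -/

namespace RealRAM

open IReg RReg IVec IMat RVec RMat

local infixr:20 ";;" => Cmd.seq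
local infix:50 "≐" => BExp.ieq
local infix:50 "≺" => BExp.ilt
local infix:50 "≺ᵣ" => BExp.rlt
local infixr:35 "⩓" => BExp.and
local infixr:30 "⩔" => BExp.or

/-! ### Evaluation of expressions and stores after assignments -/

section Eval

variable (s : Store)

@[simp] theorem IExp.eval_zero : IExp.eval s 0 = 0 := rfl
@[simp] theorem IExp.eval_one : IExp.eval s 1 = 1 := rfl
@[simp] theorem IExp.eval_two : IExp.eval s 2 = 2 := rfl
@[simp] theorem IExp.eval_reg (x : IReg) : IExp.eval s (.reg x) = s.ireg x := rfl
@[simp] theorem IExp.eval_vec (A : IVec) (i : IExp) :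
    IExp.eval s (.vec A i) = s.ivec A (i.eval s) := rfl
@[simp] theorem IExp.eval_mat (A : IMat) (i j : IExp) :
    IExp.eval s (.mat A i j) = s.imat A (i.eval s) (j.eval s) := rfl
@[simp] theorem IExp.eval_add' (e f : IExp) : IExp.eval s (e + f) = e.eval s + f.eval s := rfl
@[simp] theorem IExp.eval_sub' (e f : IExp) : IExp.eval s (e - f) = e.eval s - f.eval s := rfl
@[simp] theorem IExp.eval_min' (e f : IExp) :
    IExp.eval s (Min.min e f) = Min.min (e.eval s) (f.eval s) := rfl

@[simp] theorem IExp.steps_zero : IExp.steps 0 = 1 := rfl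
@[simp] theorem IExp.steps_one : IExp.steps 1 = 1 := rfl
@[simp] theorem IExp.steps_two : IExp.steps 2 = 1 := rfl
@[simp] theorem IExp.steps_reg (x : IReg) : IExp.steps (.reg x) = 1 := rfl
@[simp] theorem IExp.steps_vec (A : IVec) (i : IExp) : IExp.steps (.vec A i) = i.steps + 1 := rfl
@[simp] theorem IExp.steps_mat (A : IMat) (i j : IExp) :
    IExp.steps (.mat A i j) = i.steps + j.steps + 1 := rfl
@[simp] theorem IExp.steps_add' (e f : IExp) : IExp.steps (e + f) = e.steps + f.steps + 1 := rfl
@[simp] theorem IExp.steps_sub' (e f : IExp) : IExp.steps (e - f) = e.steps + f.steps + 1 := rfl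
@[simp] theorem IExp.steps_min' (e f : IExp) :
    IExp.steps (Min.min e f) = e.steps + f.steps + 1 := rfl

@[simp] theorem RExp.eval_zero : RExp.eval s 0 = 0 := by
  change ((0 : ℤ) : ℝ) = 0; simp
@[simp] theorem RExp.eval_one : RExp.eval s 1 = 1 := by
  change ((1 : ℤ) : ℝ) = 1; simp
@[simp] theorem RExp.eval_two : RExp.eval s 2 = 2 := by
  change ((2 : ℤ) : ℝ) = 2; simp
@[simp] theorem RExp.eval_ofInt (e : IExp) : RExp.eval s (.ofInt e) = e.eval s := rfl
@[simp] theorem RExp.eval_reg (x : RReg) : RExp.eval s (.reg x) = s.rreg x := rfl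
@[simp] theorem RExp.eval_vec (A : RVec) (i : IExp) :
    RExp.eval s (.vec A i) = s.rvec A (i.eval s) := rfl
@[simp] theorem RExp.eval_mat (A : RMat) (i j : IExp) :
    RExp.eval s (.mat A i j) = s.rmat A (i.eval s) (j.eval s) := rfl
@[simp] theorem RExp.eval_add' (e f : RExp) : RExp.eval s (e + f) = e.eval s + f.eval s := rfl
@[simp] theorem RExp.eval_sub' (e f : RExp) : RExp.eval s (e - f) = e.eval s - f.eval s := rfl
@[simp] theorem RExp.eval_mul' (e f : RExp) : RExp.eval s (e * f) = e.eval s * f.eval s := rfl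
@[simp] theorem RExp.eval_div' (e f : RExp) : RExp.eval s (e / f) = e.eval s / f.eval s := rfl
@[simp] theorem RExp.eval_min' (e f : RExp) :
    RExp.eval s (Min.min e f) = Min.min (e.eval s) (f.eval s) := rfl

@[simp] theorem RExp.steps_zero : RExp.steps 0 = 2 := rfl
@[simp] theorem RExp.steps_one : RExp.steps 1 = 2 := rfl
@[simp] theorem RExp.steps_two : RExp.steps 2 = 2 := rfl
@[simp] theorem RExp.steps_ofInt (e : IExp) : RExp.steps (.ofInt e) = e.steps + 1 := rfl
@[simp] theorem RExp.steps_reg (x : RReg) : RExp.steps (.reg x) = 1 := rfl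
@[simp] theorem RExp.steps_vec (A : RVec) (i : IExp) : RExp.steps (.vec A i) = i.steps + 1 := rfl
@[simp] theorem RExp.steps_mat (A : RMat) (i j : IExp) :
    RExp.steps (.mat A i j) = i.steps + j.steps + 1 := rfl
@[simp] theorem RExp.steps_add' (e f : RExp) : RExp.steps (e + f) = e.steps + f.steps + 1 := rfl
@[simp] theorem RExp.steps_sub' (e f : RExp) : RExp.steps (e - f) = e.steps + f.steps + 1 := rfl
@[simp] theorem RExp.steps_mul' (e f : RExp) : RExp.steps (e * f) = e.steps + f.steps + 1 := rfl
@[simp] theorem RExp.steps_div' (e f : RExp) : RExp.steps (e / f) = e.steps + f.steps + 1 := rfl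
@[simp] theorem RExp.steps_min' (e f : RExp) :
    RExp.steps (Min.min e f) = e.steps + f.steps + 1 := rfl

@[simp] theorem BExp.holds_ieq (e f : IExp) : (BExp.ieq e f).Holds s ↔ e.eval s = f.eval s := Iff.rfl
@[simp] theorem BExp.holds_ilt (e f : IExp) : (BExp.ilt e f).Holds s ↔ e.eval s < f.eval s := Iff.rfl
@[simp] theorem BExp.holds_rlt (e f : RExp) : (BExp.rlt e f).Holds s ↔ e.eval s < f.eval s := Iff.rfl
@[simp] theorem BExp.holds_and (B B' : BExp) :
    (BExp.and B B').Holds s ↔ B.Holds s ∧ B'.Holds s := Iff.rfl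
@[simp] theorem BExp.holds_or (B B' : BExp) :
    (BExp.or B B').Holds s ↔ B.Holds s ∨ B'.Holds s := Iff.rfl
@[simp] theorem BExp.steps_ieq (e f : IExp) : (BExp.ieq e f).steps = e.steps + f.steps + 1 := rfl
@[simp] theorem BExp.steps_ilt (e f : IExp) : (BExp.ilt e f).steps = e.steps + f.steps + 1 := rfl
@[simp] theorem BExp.steps_rlt (e f : RExp) : (BExp.rlt e f).steps = e.steps + f.steps + 1 := rfl
@[simp] theorem BExp.steps_and (B B' : BExp) :
    (BExp.and B B').steps = B.steps + B'.steps + 1 := rfl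
@[simp] theorem BExp.steps_or (B B' : BExp) :
    (BExp.or B B').steps = B.steps + B'.steps + 1 := rfl

end Eval

/-! ### Reading a store after an assignment. -/

namespace Store

variable (s : Store) (x : IReg) (X : RReg) (A : IVec) (M : IMat) (W : RVec) (R : RMat)
  (i j z : ℤ) (c : ℝ)

@[simp] theorem setIReg_ireg (x' : IReg) :
    (s.setIReg x z).ireg x' = if x' = x then z else s.ireg x' := by
  simp [setIReg, Function.update_apply]
@[simp] theorem setIReg_rreg : (s.setIReg x z).rreg = s.rreg := rfl
@[simp] theorem setIReg_ivec : (s.setIReg x z).ivec = s.ivec := rfl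
@[simp] theorem setIReg_imat : (s.setIReg x z).imat = s.imat := rfl
@[simp] theorem setIReg_rvec : (s.setIReg x z).rvec = s.rvec := rfl
@[simp] theorem setIReg_rmat : (s.setIReg x z).rmat = s.rmat := rfl

@[simp] theorem setRReg_ireg : (s.setRReg X c).ireg = s.ireg := rfl
@[simp] theorem setRReg_rreg (X' : RReg) :
    (s.setRReg X c).rreg X' = if X' = X then c else s.rreg X' := by
  simp [setRReg, Function.update_apply]
@[simp] theorem setRReg_ivec : (s.setRReg X c).ivec = s.ivec := rfl
@[simp] theorem setRReg_imat : (s.setRReg X c).imat = s.imat := rfl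
@[simp] theorem setRReg_rvec : (s.setRReg X c).rvec = s.rvec := rfl
@[simp] theorem setRReg_rmat : (s.setRReg X c).rmat = s.rmat := rfl

@[simp] theorem setIVec_ireg : (s.setIVec A i z).ireg = s.ireg := rfl
@[simp] theorem setIVec_rreg : (s.setIVec A i z).rreg = s.rreg := rfl
@[simp] theorem setIVec_ivec (A' : IVec) :
    (s.setIVec A i z).ivec A' = if A' = A then Function.update (s.ivec A) i z else s.ivec A' := by
  simp [setIVec, Function.update_apply]
@[simp] theorem setIVec_imat : (s.setIVec A i z).imat = s.imat := rfl
@[simp] theorem setIVec_rvec : (s.setIVec A i z).rvec = s.rvec := rfl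
@[simp] theorem setIVec_rmat : (s.setIVec A i z).rmat = s.rmat := rfl

@[simp] theorem setIMat_ireg : (s.setIMat M i j z).ireg = s.ireg := rfl
@[simp] theorem setIMat_rreg : (s.setIMat M i j z).rreg = s.rreg := rfl
@[simp] theorem setIMat_ivec : (s.setIMat M i j z).ivec = s.ivec := rfl
@[simp] theorem setIMat_imat (M' : IMat) : (s.setIMat M i j z).imat M' =
    if M' = M then Function.update (s.imat M) i (Function.update (s.imat M i) j z)
    else s.imat M' := by
  simp [setIMat, Function.update_apply]
@[simp] theorem setIMat_rvec : (s.setIMat M i j z).rvec = s.rvec := rfl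
@[simp] theorem setIMat_rmat : (s.setIMat M i j z).rmat = s.rmat := rfl

@[simp] theorem setRVec_ireg : (s.setRVec W i c).ireg = s.ireg := rfl
@[simp] theorem setRVec_rreg : (s.setRVec W i c).rreg = s.rreg := rfl
@[simp] theorem setRVec_ivec : (s.setRVec W i c).ivec = s.ivec := rfl
@[simp] theorem setRVec_imat : (s.setRVec W i c).imat = s.imat := rfl
@[simp] theorem setRVec_rvec (W' : RVec) :
    (s.setRVec W i c).rvec W' = if W' = W then Function.update (s.rvec W) i c else s.rvec W' := by
  simp [setRVec, Function.update_apply]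
@[simp] theorem setRVec_rmat : (s.setRVec W i c).rmat = s.rmat := rfl

@[simp] theorem setRMat_ireg : (s.setRMat R i j c).ireg = s.ireg := rfl
@[simp] theorem setRMat_rreg : (s.setRMat R i j c).rreg = s.rreg := rfl
@[simp] theorem setRMat_ivec : (s.setRMat R i j c).ivec = s.ivec := rfl
@[simp] theorem setRMat_imat : (s.setRMat R i j c).imat = s.imat := rfl
@[simp] theorem setRMat_rvec : (s.setRMat R i j c).rvec = s.rvec := rfl
@[simp] theorem setRMat_rmat (R' : RMat) : (s.setRMat R i j c).rmat R' =
    if R' = R then Function.update (s.rmat R) i (Function.update (s.rmat R i) j c)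
    else s.rmat R' := by
  simp [setRMat, Function.update_apply]

end Store

/-! ### Determinism -/

theorem Exec.deterministic {c : Cmd} {s s₁ s₂ : Store} {t₁ t₂ : ℕ} (h₁ : Exec c s s₁ t₁)
    (h₂ : Exec c s s₂ t₂) : s₂ = s₁ ∧ t₂ = t₁ := by
  induction h₁ generalizing s₂ t₂ with
  | seq _ _ ih ih' =>
    cases h₂ with
    | seq h h' =>
      obtain ⟨rfl, rfl⟩ := ih h
      obtain ⟨rfl, rfl⟩ := ih' h'
      exact ⟨rfl, rfl⟩
  | iteTrue hB _ ih =>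
    cases h₂ with
    | iteTrue _ h =>
      obtain ⟨rfl, rfl⟩ := ih h
      exact ⟨rfl, rfl⟩
    | iteFalse hB' _ => exact absurd hB hB'
  | iteFalse hB _ ih =>
    cases h₂ with
    | iteTrue hB' _ => exact absurd hB' hB
    | iteFalse _ h =>
      obtain ⟨rfl, rfl⟩ := ih h
      exact ⟨rfl, rfl⟩
  | loopFalse hB =>
    cases h₂ with
    | loopFalse _ => exact ⟨rfl, rfl⟩
    | loopTrue hB' _ _ => exact absurd hB' hB
  | loopTrue hB _ _ ih ih' =>
    cases h₂ with
    | loopFalse hB' => exact absurd hB hB'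
    | loopTrue _ h h' =>
      obtain ⟨rfl, rfl⟩ := ih h
      obtain ⟨rfl, rfl⟩ := ih' h'
      exact ⟨rfl, rfl⟩
  | _ => cases h₂; exact ⟨rfl, rfl⟩

/-! ### Frames -/

/-- The parts of the memory. -/
inductive Loc
  | i (x : IReg)
  | r (x : RReg)
  | iv (A : IVec)
  | im (A : IMat)
  | rv (A : RVec)
  | rm (A : RMat)
  deriving DecidableEq

/-- The command contains an assignment to the given part of the memory. -/
def Cmd.Writes (l : Loc) : Cmd → Bool
  | .iset x _ => l = .i x
  | .ifloor x _ => l = .i x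
  | .rset x _ => l = .r x
  | .ivset A _ _ => l = .iv A
  | .imset A _ _ _ => l = .im A
  | .rvset A _ _ => l = .rv A
  | .rmset A _ _ _ => l = .rm A
  | .skip => false
  | .seq c d => c.Writes l || d.Writes l
  | .ite _ c d => c.Writes l || d.Writes l
  | .loop _ c => c.Writes l

/-- The stores agree on everything that the command does not assign to. -/
structure Keeps (c : Cmd) (s s' : Store) : Prop where
  ireg : ∀ x, c.Writes (.i x) = false → s'.ireg x = s.ireg x
  rreg : ∀ x, c.Writes (.r x) = false → s'.rreg x = s.rreg x
  ivec : ∀ A, c.Writes (.iv A) = false → s'.ivec A = s.ivec A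
  imat : ∀ A, c.Writes (.im A) = false → s'.imat A = s.imat A
  rvec : ∀ A, c.Writes (.rv A) = false → s'.rvec A = s.rvec A
  rmat : ∀ A, c.Writes (.rm A) = false → s'.rmat A = s.rmat A

theorem Keeps.refl (c : Cmd) (s : Store) : Keeps c s s :=
  ⟨fun _ _ => rfl, fun _ _ => rfl, fun _ _ => rfl, fun _ _ => rfl, fun _ _ => rfl, fun _ _ => rfl⟩

theorem Keeps.trans {c : Cmd} {s s' s'' : Store} (h : Keeps c s s') (h' : Keeps c s' s'') :
    Keeps c s s'' :=
  ⟨fun x hx => (h'.ireg x hx).trans (h.ireg x hx), fun x hx => (h'.rreg x hx).trans (h.rreg x hx),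
    fun x hx => (h'.ivec x hx).trans (h.ivec x hx), fun x hx => (h'.imat x hx).trans (h.imat x hx),
    fun x hx => (h'.rvec x hx).trans (h.rvec x hx), fun x hx => (h'.rmat x hx).trans (h.rmat x hx)⟩

theorem Keeps.mono {c d : Cmd} {s s' : Store} (h : Keeps c s s')
    (hcd : ∀ l, d.Writes l = false → c.Writes l = false) : Keeps d s s' :=
  ⟨fun x hx => h.ireg x (hcd _ hx), fun x hx => h.rreg x (hcd _ hx),
    fun x hx => h.ivec x (hcd _ hx), fun x hx => h.imat x (hcd _ hx),
    fun x hx => h.rvec x (hcd _ hx), fun x hx => h.rmat x (hcd _ hx)⟩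

/-- The frame rule. As `Cmd.Writes` is computable, its side conditions for concrete commands hold by
`rfl`; this is how unchanged registers and arrays are carried along below. -/
theorem Exec.keeps {c : Cmd} {s s' : Store} {t : ℕ} (h : Exec c s s' t) : Keeps c s s' := by
  induction h with
  | skip s => exact Keeps.refl _ _
  | loopFalse _ => exact Keeps.refl _ _
  | seq _ _ ih ih' =>
    refine (ih.mono fun l hl => ?_).trans (ih'.mono fun l hl => ?_) <;>
      simp only [Cmd.Writes, Bool.or_eq_false_iff] at hl
    exacts [hl.1, hl.2]
  | iteTrue _ _ ih =>
    refine ih.mono fun l hl => ?_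
    simp only [Cmd.Writes, Bool.or_eq_false_iff] at hl
    exact hl.1
  | iteFalse _ _ ih =>
    refine ih.mono fun l hl => ?_
    simp only [Cmd.Writes, Bool.or_eq_false_iff] at hl
    exact hl.2
  | loopTrue _ _ _ ih ih' => exact (ih.mono (d := .loop _ _) fun l hl => hl).trans ih'
  | _ => constructor <;> simp +contextual [Cmd.Writes]

/-! ### Total correctness with running times -/

/-- The command, started on `s`, stops with a store and a number of steps that satisfy `Q`. -/
def WP (c : Cmd) (s : Store) (Q : Store → ℕ → Prop) : Prop := ∃ s' t, Exec c s s' t ∧ Q s' t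

section WP

variable {s : Store} {Q : Store → ℕ → Prop} {c d : Cmd} {B : BExp}

theorem WP.mono {Q' : Store → ℕ → Prop} (h : WP c s Q)
    (hQ : ∀ s' t, Keeps c s s' → Q s' t → Q' s' t) : WP c s Q' := by
  obtain ⟨s', t, h, h'⟩ := h
  exact ⟨s', t, h, hQ _ _ h.keeps h'⟩

@[simp] theorem WP_iset {x : IReg} {e : IExp} :
    WP (.iset x e) s Q ↔ Q (s.setIReg x (e.eval s)) (e.steps + 1) :=
  ⟨by rintro ⟨_, _, ⟨⟩, h⟩; exact h, fun h => ⟨_, _, .iset .., h⟩⟩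

@[simp] theorem WP_ifloor {x : IReg} {e : RExp} :
    WP (.ifloor x e) s Q ↔ Q (s.setIReg x ⌊e.eval s⌋) (e.steps + 2) :=
  ⟨by rintro ⟨_, _, ⟨⟩, h⟩; exact h, fun h => ⟨_, _, .ifloor .., h⟩⟩

@[simp] theorem WP_rset {x : RReg} {e : RExp} :
    WP (.rset x e) s Q ↔ Q (s.setRReg x (e.eval s)) (e.steps + 1) :=
  ⟨by rintro ⟨_, _, ⟨⟩, h⟩; exact h, fun h => ⟨_, _, .rset .., h⟩⟩

@[simp] theorem WP_ivset {A : IVec} {i e : IExp} :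
    WP (.ivset A i e) s Q ↔ Q (s.setIVec A (i.eval s) (e.eval s)) (i.steps + e.steps + 1) :=
  ⟨by rintro ⟨_, _, ⟨⟩, h⟩; exact h, fun h => ⟨_, _, .ivset .., h⟩⟩

@[simp] theorem WP_imset {A : IMat} {i j e : IExp} :
    WP (.imset A i j e) s Q ↔
      Q (s.setIMat A (i.eval s) (j.eval s) (e.eval s)) (i.steps + j.steps + e.steps + 1) :=
  ⟨by rintro ⟨_, _, ⟨⟩, h⟩; exact h, fun h => ⟨_, _, .imset .., h⟩⟩

@[simp] theorem WP_rvset {A : RVec} {i : IExp} {e : RExp} :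
    WP (.rvset A i e) s Q ↔ Q (s.setRVec A (i.eval s) (e.eval s)) (i.steps + e.steps + 1) :=
  ⟨by rintro ⟨_, _, ⟨⟩, h⟩; exact h, fun h => ⟨_, _, .rvset .., h⟩⟩

@[simp] theorem WP_rmset {A : RMat} {i j : IExp} {e : RExp} :
    WP (.rmset A i j e) s Q ↔
      Q (s.setRMat A (i.eval s) (j.eval s) (e.eval s)) (i.steps + j.steps + e.steps + 1) :=
  ⟨by rintro ⟨_, _, ⟨⟩, h⟩; exact h, fun h => ⟨_, _, .rmset .., h⟩⟩

@[simp] theorem WP_skip : WP .skip s Q ↔ Q s 1 :=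
  ⟨by rintro ⟨_, _, ⟨⟩, h⟩; exact h, fun h => ⟨_, _, .skip .., h⟩⟩

@[simp] theorem WP_seq :
    WP (.seq c d) s Q ↔ WP c s fun s' t => WP d s' fun s'' t' => Q s'' (t + t') := by
  constructor
  · rintro ⟨_, _, h, hQ⟩
    cases h with
    | seq h h' => exact ⟨_, _, h, _, _, h', hQ⟩
  · rintro ⟨_, _, h, _, _, h', hQ⟩
    exact ⟨_, _, h.seq h', hQ⟩

@[simp] theorem WP_ite :
    WP (.ite B c d) s Q ↔ (B.Holds s → WP c s fun s' t => Q s' (B.steps + 1 + t)) ∧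
      (¬ B.Holds s → WP d s fun s' t => Q s' (B.steps + 1 + t)) := by
  constructor
  · rintro ⟨_, _, h, hQ⟩
    cases h with
    | iteTrue hB h => exact ⟨fun _ => ⟨_, _, h, hQ⟩, fun hB' => absurd hB hB'⟩
    | iteFalse hB h => exact ⟨fun hB' => absurd hB' hB, fun _ => ⟨_, _, h, hQ⟩⟩
  · rintro ⟨h, h'⟩
    by_cases hB : B.Holds s
    · obtain ⟨_, _, h, hQ⟩ := h hB
      exact ⟨_, _, .iteTrue hB h, hQ⟩
    · obtain ⟨_, _, h, hQ⟩ := h' hB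
      exact ⟨_, _, .iteFalse hB h, hQ⟩

@[simp] theorem WP_when :
    WP (when B c) s Q ↔ (B.Holds s → WP c s fun s' t => Q s' (B.steps + 1 + t)) ∧
      (¬ B.Holds s → Q s (B.steps + 2)) := by
  simp [when]

theorem WP.seq {P : Store → ℕ → Prop} (h : WP c s P)
    (h' : ∀ s' t, Keeps c s s' → P s' t → WP d s' fun s'' t' => Q s'' (t + t')) :
    WP (.seq c d) s Q :=
  WP_seq.2 (h.mono h')

theorem WP_seq_assoc {e : Cmd} :
    WP (.seq c (.seq d e)) s Q ↔ WP (.seq (.seq c d) e) s Q := by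
  simp only [WP_seq, add_assoc]

/-- A loop whose invariant `Inv n` says that there is a credit of `n` steps. -/
theorem WP_loop (Inv : ℕ → Store → Prop) (n : ℕ) (h0 : Inv n s)
    (hstep : ∀ n s', Keeps (.loop B c) s s' → Inv n s' → B.Holds s' →
      WP c s' fun s'' t => ∃ n', t + n' + (B.steps + 1) ≤ n ∧ Inv n' s'') :
    WP (.loop B c) s fun s' t =>
      ∃ n', t + n' ≤ n + (B.steps + 1) ∧ Inv n' s' ∧ ¬ B.Holds s' := by
  suffices H : ∀ n s', Keeps (.loop B c) s s' → Inv n s' → WP (.loop B c) s' fun s'' t =>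
      ∃ n', t + n' ≤ n + (B.steps + 1) ∧ Inv n' s'' ∧ ¬ B.Holds s'' from
    H n s (Keeps.refl _ _) h0
  intro n
  induction n using Nat.strong_induction_on with
  | _ n ih =>
    intro s' hk hI
    by_cases hB : B.Holds s'
    · obtain ⟨s₁, t₁, he, n', hn', hI'⟩ := hstep n s' hk hI hB
      -- The remaining credit is strictly smaller because a test and its jump cost at least one
      -- step. The credit thus also proves termination.
      obtain ⟨s₂, t₂, he', n'', hn'', hI'', hB''⟩ :=
        ih n' (by omega) s₁ (hk.trans (he.keeps.mono fun l hl => hl)) hI'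
      exact ⟨s₂, _, .loopTrue hB he he', n'', by omega, hI'', hB''⟩
    · exact ⟨s', _, .loopFalse hB, n, by omega, hI, hB⟩

/-- A `for` loop whose invariant `Inv i n` says that there is a credit of `n` steps at the beginning
of round `i`. -/
theorem WP_forTo_credit {x : IReg} {e : IExp} (N : ℕ) (Inv : ℤ → ℕ → Store → Prop) (n : ℕ)
    (hx : c.Writes (.i x) = false)
    (he : ∀ s', Keeps (forTo x e c) s s' → e.eval s' = N)
    (h0 : Inv 0 n (s.setIReg x 0))
    (hstep : ∀ (i : ℤ) n s', Keeps (forTo x e c) s s' → 0 ≤ i → i < N → s'.ireg x = i → Inv i n s' →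
      WP c s' fun s'' t => ∃ n', t + n' + (e.steps + 7) ≤ n ∧
        Inv (i + 1) n' (s''.setIReg x (i + 1))) :
    WP (forTo x e c) s fun s' t => ∃ n', t + n' ≤ n + e.steps + 5 ∧ Inv N n' s' := by
  have hk0 : Keeps (forTo x e c) s (s.setIReg x 0) :=
    (Exec.iset s x 0).keeps.mono fun l hl => by
      simp only [forTo, Cmd.Writes, Bool.or_eq_false_iff] at hl ⊢
      exact hl.1
  refine WP_seq.2 (WP_iset.2 ?_)
  refine (WP_loop (fun n s' => ∃ i : ℤ, 0 ≤ i ∧ i ≤ N ∧ s'.ireg x = i ∧ Inv i n s') n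
    ⟨0, le_rfl, by positivity, by simp, h0⟩ ?_).mono ?_
  · rintro n s' hk ⟨i, hi0, hiN, hxi, hI⟩ hB
    have hk' : Keeps (forTo x e c) s s' := hk0.trans (hk.mono fun l hl => by
      simp only [forTo, Cmd.Writes, Bool.or_eq_false_iff] at hl ⊢
      exact hl.2)
    have hiN' : i < N := by
      have := he s' hk'
      simp only [BExp.holds_ilt, IExp.eval_reg] at hB
      omega
    refine WP_seq.2 ((hstep i n s' hk' hi0 hiN' hxi hI).mono ?_)
    rintro s'' t hk'' ⟨n', hn', hI'⟩
    have hx'' : s''.ireg x = i := (hk''.ireg x hx).trans hxi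
    refine WP_iset.2 ⟨n', ?_, i + 1, by omega, by omega, ?_, ?_⟩
    -- The overhead of a round is `e.steps + 7`: `e.steps + 3` for the test and its jump, 4 for the
    -- increment.
    · simp; omega
    · simp [hx'']
    · simpa [hx''] using hI'
  · rintro s' t hk ⟨n', hn', ⟨i, hi0, hiN, hxi, hI⟩, hB⟩
    have hk' : Keeps (forTo x e c) s s' := hk0.trans (hk.mono fun l hl => by
      simp only [forTo, Cmd.Writes, Bool.or_eq_false_iff] at hl ⊢
      exact hl.2)
    have hiN' : i = N := by
      have := he s' hk'
      simp only [BExp.holds_ilt, IExp.eval_reg] at hB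
      omega
    refine ⟨n', ?_, hiN' ▸ hI⟩
    simp at hn' ⊢
    omega

/-- A `for` loop each round of which takes at most `T` steps. -/
theorem WP_forTo {x : IReg} {e : IExp} (N T : ℕ) (Inv : ℤ → Store → Prop)
    (hx : c.Writes (.i x) = false)
    (he : ∀ s', Keeps (forTo x e c) s s' → e.eval s' = N)
    (h0 : Inv 0 (s.setIReg x 0))
    (hstep : ∀ (i : ℤ) s', Keeps (forTo x e c) s s' → 0 ≤ i → i < N → s'.ireg x = i → Inv i s' →
      WP c s' fun s'' t => t ≤ T ∧ Inv (i + 1) (s''.setIReg x (i + 1))) :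
    WP (forTo x e c) s fun s' t => t ≤ N * (T + e.steps + 7) + e.steps + 5 ∧ Inv N s' := by
  -- The credit is the cost of the `N - i` rounds still to come.
  refine (WP_forTo_credit N (fun i n s' => Inv i s' ∧ (N - i) * (T + e.steps + 7) ≤ (n : ℤ))
    (N * (T + e.steps + 7)) hx he ⟨h0, by push_cast; simp⟩ ?_).mono ?_
  · rintro i n s' hk hi0 hiN hxi ⟨hI, hn⟩
    refine (hstep i s' hk hi0 hiN hxi hI).mono ?_
    rintro s'' t - ⟨ht, hI'⟩
    refine ⟨n - (T + e.steps + 7), ?_, hI', ?_⟩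
    · have : (T + e.steps + 7 : ℤ) ≤ n := by nlinarith
      omega
    · have : (T + e.steps + 7 : ℤ) ≤ n := by nlinarith
      rw [Nat.cast_sub (by omega)]
      push_cast
      linarith
  · rintro s' t - ⟨n', hn', hI, -⟩
    exact ⟨by omega, hI⟩

end WP

/-! ### The residual graph -/

/-- The edge from `u` to `v` is present in the residual graph. -/
def Res (p : ℕ) (db sb : ℤ → ℤ) (fl : ℤ → ℤ → ℤ) (u v : ℤ) : Prop :=
  (u < p ∧ p ≤ v ∧ 0 < fl u (v - p)) ∨
    (p ≤ u ∧ v < p ∧ 0 < min (db v) (sb (u - p)) - fl v (u - p))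

instance (p : ℕ) (db sb : ℤ → ℤ) (fl : ℤ → ℤ → ℤ) (u v : ℤ) : Decidable (Res p db sb fl u v) := by
  unfold Res; infer_instance

/-- The slack of the edge from `u` to `v`. -/
def Slk (p : ℕ) (cb : ℤ → ℤ → ℤ) (y : ℤ → ℤ) (u v : ℤ) : ℤ :=
  if u < p then y u + y v - cb u (v - p) else cb v (u - p) + 1 - y v - y u

/-! ### Dijkstra's algorithm -/

/-- The invariant of Dijkstra's algorithm with the vertices `0, …, n - 1`, the sources `src`, the
edges `E` and the lengths `S`. -/
structure DijkstraInv (n : ℤ) (src : ℤ → Prop) (E : ℤ → ℤ → Prop) (S : ℤ → ℤ → ℤ)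
    (l d : ℤ → ℤ) : Prop where
  neg_one_le : ∀ v : ℤ, 0 ≤ v → v < n → -1 ≤ l v
  src_eq : ∀ v : ℤ, 0 ≤ v → v < n → src v → l v = 0
  done_or : ∀ v : ℤ, 0 ≤ v → v < n → d v = 0 ∨ d v = 1
  closed : ∀ u v : ℤ, 0 ≤ u → u < n → 0 ≤ v → v < n → d u = 1 → E u v → 0 ≤ l v ∧ l v ≤ l u + S u v
  -- Shortest distances in dual form: a label is at least every potential that is nonpositive on the
  -- sources and grows along an edge by at most its length. No paths have to be mentioned, and later
  -- uses only supply a suitable potential.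
  lower : ∀ f : ℤ → ℤ, (∀ v : ℤ, 0 ≤ v → v < n → src v → f v ≤ 0) →
    (∀ u v : ℤ, 0 ≤ u → u < n → 0 ≤ v → v < n → E u v → f v ≤ f u + S u v) →
    ∀ v : ℤ, 0 ≤ v → v < n → 0 ≤ l v → f v ≤ l v
  done_nonneg : ∀ v : ℤ, 0 ≤ v → v < n → d v = 1 → 0 ≤ l v
  done_le : ∀ u v : ℤ, 0 ≤ u → u < n → 0 ≤ v → v < n → d u = 1 → d v = 0 → 0 ≤ l v → l u ≤ l v

/-- Lengths are nonnegative and `w` has the least label among the open vertices, so a relaxation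
from `w` produces only values that are at least `l w`. These cannot improve a finished label, which
is at most `l w`, nor the label zero of a source. A new label `l w + S w v` respects every potential
because `l w` does. -/
theorem DijkstraInv.step {n : ℤ} {src : ℤ → Prop} {E : ℤ → ℤ → Prop} {S : ℤ → ℤ → ℤ}
    {l d l' d' : ℤ → ℤ} (h : DijkstraInv n src E S l d)
    (hS : ∀ u v : ℤ, 0 ≤ u → u < n → 0 ≤ v → v < n → E u v → 0 ≤ S u v)
    (w : ℤ) (hw0 : 0 ≤ w) (hwn : w < n) (hwd : d w = 0) (hwl : 0 ≤ l w)
    (hmin : ∀ v : ℤ, 0 ≤ v → v < n → d v = 0 → 0 ≤ l v → l w ≤ l v)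
    (hd : d' = Function.update d w 1)
    (hE : ∀ v : ℤ, 0 ≤ v → v < n → E w v →
      l' v = if l v < 0 ∨ l w + S w v < l v then l w + S w v else l v)
    (hnE : ∀ v : ℤ, 0 ≤ v → v < n → ¬ E w v → l' v = l v) :
    DijkstraInv n src E S l' d' := by
  have hdw : d' w = 1 := by simp [hd]
  have hdv : ∀ v, v ≠ w → d' v = d v := fun v hv => by simp [hd, hv]
  -- the labels of the finished vertices do not change
  have hold : ∀ v : ℤ, 0 ≤ v → v < n → (d v = 1 ∨ v = w ∨ src v) → l' v = l v := by
    intro v h0 hn hv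
    by_cases hEv : E w v
    · have h1 := hE v h0 hn hEv
      have h2 := hS w v hw0 hwn h0 hn hEv
      rw [h1, if_neg]
      rcases hv with hv | rfl | hv
      · have h3 := h.done_nonneg v h0 hn hv
        have h4 := h.done_le v w h0 hn hw0 hwn hv hwd hwl
        omega
      · omega
      · have := h.src_eq v h0 hn hv
        omega
    · exact hnE v h0 hn hEv
  have hle : ∀ v : ℤ, 0 ≤ v → v < n → 0 ≤ l v → 0 ≤ l' v ∧ l' v ≤ l v := by
    intro v h0 hn hv
    by_cases hEv : E w v
    · have h1 := hE v h0 hn hEv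
      have h2 := hS w v hw0 hwn h0 hn hEv
      rw [h1]
      split_ifs <;> omega
    · rw [hnE v h0 hn hEv]
      exact ⟨hv, le_rfl⟩
  have hnew : ∀ v : ℤ, 0 ≤ v → v < n → 0 ≤ l' v → d v = 0 → l w ≤ l' v := by
    intro v h0 hn hv hdv
    by_cases hEv : E w v
    · have h1 := hE v h0 hn hEv
      have h2 := hS w v hw0 hwn h0 hn hEv
      have h3 := hmin v h0 hn hdv
      rw [h1] at hv ⊢
      split_ifs at hv ⊢ <;> omega
    · rw [hnE v h0 hn hEv] at hv ⊢
      exact hmin v h0 hn hdv hv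
  have hlw : l' w = l w := hold w hw0 hwn (by simp)
  refine ⟨?_, ?_, ?_, ?_, ?_, ?_, ?_⟩
  · intro v h0 hn
    by_cases hEv : E w v
    · have h1 := hE v h0 hn hEv
      have h2 := hS w v hw0 hwn h0 hn hEv
      rw [h1]
      split_ifs <;> omega
    · rw [hnE v h0 hn hEv]
      exact h.neg_one_le v h0 hn
  · intro v h0 hn hs
    rw [hold v h0 hn (by simp [hs])]
    exact h.src_eq v h0 hn hs
  · intro v h0 hn
    by_cases hv : v = w
    · simp [hv, hdw]
    · rw [hdv v hv]
      exact h.done_or v h0 hn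
  · intro u v hu0 hun hv0 hvn hdu hEuv
    by_cases hu : u = w
    · subst hu
      have h1 := hE v hv0 hvn hEuv
      have h2 := hS u v hw0 hwn hv0 hvn hEuv
      rw [hlw, h1]
      split_ifs <;> omega
    · rw [hdv u hu] at hdu
      have h1 := h.closed u v hu0 hun hv0 hvn hdu hEuv
      have h2 := hle v hv0 hvn h1.1
      rw [hold u hu0 hun (by simp [hdu])]
      omega
  · intro f hf hfE v hv0 hvn hv
    have hfl := h.lower f hf hfE
    by_cases hEv : E w v
    · have h1 := hE v hv0 hvn hEv
      have h2 := hfE w v hw0 hwn hv0 hvn hEv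
      have h3 := hfl w hw0 hwn hwl
      have h4 := hfl v hv0 hvn
      rw [h1] at hv ⊢
      split_ifs at hv ⊢ <;> omega
    · rw [hnE v hv0 hvn hEv] at hv ⊢
      exact hfl v hv0 hvn hv
  · intro v hv0 hvn hv
    by_cases hvw : v = w
    · rw [hvw, hlw]; exact hwl
    · rw [hdv v hvw] at hv
      rw [hold v hv0 hvn (by simp [hv])]
      exact h.done_nonneg v hv0 hvn hv
  · intro u v hu0 hun hv0 hvn hdu hdv' hv
    have hvw : v ≠ w := by rintro rfl; omega
    rw [hdv v hvw] at hdv'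
    have h1 := hnew v hv0 hvn hv hdv'
    by_cases hu : u = w
    · rw [hu, hlw]; exact h1
    · rw [hdv u hu] at hdu
      rw [hold u hu0 hun (by simp [hdu])]
      exact (h.done_le u w hu0 hun hw0 hwn hdu hwd hwl).trans h1

/-- What Dijkstra's algorithm computes: `l` is `-1` or the distance from the sources, and `lT` is
the least distance of a target. -/
structure DijkstraSpec (p q : ℕ) (src tgt : ℤ → Prop) (E : ℤ → ℤ → Prop) (S : ℤ → ℤ → ℤ)
    (l : ℤ → ℤ) (lT : ℤ) : Prop where
  neg_one_le : ∀ v : ℤ, 0 ≤ v → v < p + q → -1 ≤ l v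
  src_eq : ∀ v : ℤ, 0 ≤ v → v < p + q → src v → l v = 0
  closed : ∀ u v : ℤ, 0 ≤ u → u < p + q → 0 ≤ v → v < p + q → 0 ≤ l u → E u v →
    0 ≤ l v ∧ l v ≤ l u + S u v
  lower : ∀ f : ℤ → ℤ, (∀ v : ℤ, 0 ≤ v → v < p + q → src v → f v ≤ 0) →
    (∀ u v : ℤ, 0 ≤ u → u < p + q → 0 ≤ v → v < p + q → E u v → f v ≤ f u + S u v) →
    ∀ v : ℤ, 0 ≤ v → v < p + q → 0 ≤ l v → f v ≤ l v
  tgt_le : ∀ a : ℤ, 0 ≤ a → a < p → tgt a → 0 ≤ l a → 0 ≤ lT ∧ lT ≤ l a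
  tgt_eq : 0 ≤ lT → ∃ a : ℤ, 0 ≤ a ∧ a < p ∧ tgt a ∧ l a = lT

/-- If the test fails, nothing is written; but overwriting an entry with its own value does not
change the store, so one postcondition covers both branches. -/
theorem relax_spec {s : Store} {v e : IExp} {Q : Store → ℕ → Prop}
    (h : ∀ t, t ≤ 2 * v.steps + 2 * e.steps + v.steps + 12 →
      Q (s.setIVec ell (v.eval s)
        (if s.ivec ell (v.eval s) < 0 ∨ e.eval s < s.ivec ell (v.eval s) then e.eval s
          else s.ivec ell (v.eval s))) t) :
    WP (relax v e) s Q := by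
  unfold relax
  simp only [WP_when, WP_ivset, BExp.holds_or, BExp.holds_ilt, IExp.eval_vec, IExp.eval_zero,
    BExp.steps_or, BExp.steps_ilt, IExp.steps_vec, IExp.steps_zero]
  refine ⟨fun hc => ?_, fun hc => ?_⟩
  · have := h (v.steps + 1 + 1 + 1 + (e.steps + (v.steps + 1) + 1) + 1 + 1 +
      (v.steps + e.steps + 1)) (by omega)
    rwa [if_pos hc] at this
  · have := h (v.steps + 1 + 1 + 1 + (e.steps + (v.steps + 1) + 1) + 1 + 2) (by omega)
    rw [if_neg hc] at this
    convert this
    cases s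
    simp [Store.setIVec]

theorem dijkstra_select {s : Store} {p q : ℕ} (hp : s.ireg nA = p) (hq : s.ireg nB = q)
    (hu : s.ireg u = -1) :
    WP (forTo v (nA + nB)
       (when ((done v ≐ 0) ⩓ ((0 - 1) ≺ ell v) ⩓ ((u ≺ 0) ⩔ (ell v ≺ ell u))) (u.set v))) s
      fun s' t => t ≤ 40 * (p + q) + 10 ∧
        ((s'.ireg u = -1 ∧ ∀ v : ℤ, 0 ≤ v → v < p + q → s.ivec done v = 0 → s.ivec ell v < 0) ∨
          (0 ≤ s'.ireg u ∧ s'.ireg u < p + q ∧ s.ivec done (s'.ireg u) = 0 ∧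
            0 ≤ s.ivec ell (s'.ireg u) ∧ ∀ v : ℤ, 0 ≤ v → v < p + q → s.ivec done v = 0 →
              0 ≤ s.ivec ell v → s.ivec ell (s'.ireg u) ≤ s.ivec ell v)) := by
  refine (WP_forTo (p + q) 30 (fun i s' =>
      ((s'.ireg u = -1 ∧ ∀ v : ℤ, 0 ≤ v → v < i → s.ivec done v = 0 → s.ivec ell v < 0) ∨
          (0 ≤ s'.ireg u ∧ s'.ireg u < i ∧ s.ivec done (s'.ireg u) = 0 ∧
            0 ≤ s.ivec ell (s'.ireg u) ∧ ∀ v : ℤ, 0 ≤ v → v < i → s.ivec done v = 0 →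
              0 ≤ s.ivec ell v → s.ivec ell (s'.ireg u) ≤ s.ivec ell v))) rfl ?_ ?_ ?_).mono ?_
  · intro s' hk
    simp [hk.ireg nA rfl, hk.ireg nB rfl, hp, hq]
  · left
    refine ⟨by simpa using hu, fun v h0 h1 => by omega⟩
  · intro i s' hk hi0 hiN hi hI
    have h1 := hk.ivec done rfl
    have h2 := hk.ivec ell rfl
    simp only [WP_when, WP_iset, BExp.holds_and, BExp.holds_or, BExp.holds_ieq, BExp.holds_ilt,
      IExp.eval_vec, IExp.eval_reg, IExp.eval_zero, IExp.eval_sub', IExp.eval_one, hi, h1, h2,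
      Store.setIReg_ireg, reduceCtorEq, if_true, if_false]
    refine ⟨fun hc => ⟨by simp, ?_⟩, fun hc => ⟨by simp, ?_⟩⟩
    · right
      refine ⟨hi0, by omega, hc.1, by omega, fun v hv0 hvi hdv hlv => ?_⟩
      rcases hI with ⟨hI, hI'⟩ | ⟨hI0, hI1, hI2, hI3, hI4⟩
      · rcases eq_or_ne v i with rfl | hv
        · exact le_rfl
        · have := hI' v hv0 (by omega) hdv
          omega
      · rcases eq_or_ne v i with rfl | hv
        · exact le_rfl
        · have := hI4 v hv0 (by omega) hdv hlv
          omega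
    · rcases hI with ⟨hI, hI'⟩ | ⟨hI0, hI1, hI2, hI3, hI4⟩
      · left
        refine ⟨hI, fun v hv0 hvi hdv => ?_⟩
        rcases eq_or_ne v i with rfl | hv
        · by_contra hlv
          exact hc ⟨hdv, by omega, by omega⟩
        · exact hI' v hv0 (by omega) hdv
      · right
        refine ⟨hI0, by omega, hI2, hI3, fun v hv0 hvi hdv hlv => ?_⟩
        rcases eq_or_ne v i with rfl | hv
        · by_contra hlv
          exact hc ⟨hdv, by omega, by omega⟩
        · exact hI4 v hv0 (by omega) hdv hlv
  · rintro s' t - ⟨ht, hI⟩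
    refine ⟨by simp at ht; omega, by simpa using hI⟩

/-- The edges out of a demand node end at supply nodes. Hence the label of `u` and the labels not
yet treated keep their initial values, and the result can be expressed through the initial store
alone. The forward case is symmetric. -/
theorem dijkstra_relaxBwd {s : Store} {p q : ℕ} (hp : s.ireg nA = p) (hq : s.ireg nB = q)
    (hu : s.ireg u < p) :
    WP (forTo b nB (when (0 ≺ capBwd u b) (relax (nA + b) (ell u + slackBwd u b)))) s
      fun s' t => t ≤ 80 * q + 6 ∧ (∀ v : ℤ, s'.ivec ell v =
        if Res p (s.ivec dbar) (s.ivec sbar) (s.imat flow) (s.ireg u) v ∧ v < p + q then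
          if s.ivec ell v < 0 ∨ s.ivec ell (s.ireg u) + Slk p (s.imat cbar) (s.ivec y) (s.ireg u) v
            < s.ivec ell v
          then s.ivec ell (s.ireg u) + Slk p (s.imat cbar) (s.ivec y) (s.ireg u) v
          else s.ivec ell v
        else s.ivec ell v) := by
  refine (WP_forTo q 72 (fun i s' => ∀ v : ℤ, s'.ivec ell v =
        if Res p (s.ivec dbar) (s.ivec sbar) (s.imat flow) (s.ireg u) v ∧ v < p + i then
          if s.ivec ell v < 0 ∨ s.ivec ell (s.ireg u) + Slk p (s.imat cbar) (s.ivec y) (s.ireg u) v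
            < s.ivec ell v
          then s.ivec ell (s.ireg u) + Slk p (s.imat cbar) (s.ivec y) (s.ireg u) v
          else s.ivec ell v
        else s.ivec ell v) rfl ?_ ?_ ?_).mono ?_
  · intro s' hk
    simp [hk.ireg nB rfl, hq]
  · intro v
    rw [if_neg]
    · simp
    · rintro ⟨h | h, h'⟩ <;> omega
  · intro i s' hk hi0 hiN hi hI
    have h1 := hk.ireg u rfl
    have h2 := hk.imat flow rfl
    have h3 := hk.ireg nA rfl
    have h4 := hk.ivec y rfl
    have h5 := hk.imat cbar rfl
    have h6 : s'.ivec ell (s.ireg u) = s.ivec ell (s.ireg u) := by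
      rw [hI, if_neg]
      rintro ⟨h | h, h'⟩ <;> omega
    have h7 : s'.ivec ell (p + i) = s.ivec ell (p + i) := by
      rw [hI, if_neg]
      rintro ⟨h | h, h'⟩ <;> omega
    have h8 : Slk p (s.imat cbar) (s.ivec y) (s.ireg u) (p + i) =
        s.ivec y (s.ireg u) + s.ivec y (p + i) - s.imat cbar (s.ireg u) i := by
      simp [Slk, hu]
    have h9 : Res p (s.ivec dbar) (s.ivec sbar) (s.imat flow) (s.ireg u) (p + i) ↔
        0 < s.imat flow (s.ireg u) i := by
      simp [Res, hu, hi0]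
    have hv : ∀ v : ℤ, v < p + (i + 1) ↔ v < p + i ∨ v = p + i := fun v => by omega
    simp only [WP_when, BExp.holds_ilt, IExp.eval_zero, capBwd, IExp.eval_mat, IExp.eval_reg]
    refine ⟨fun hc => relax_spec fun t ht => ⟨?_, ?_⟩, fun hc => ⟨by simp, ?_⟩⟩
    · simp [slackBwd] at ht ⊢
      omega
    · intro v
      simp only [slackBwd, Store.setIReg_ivec, Store.setIVec_ivec, if_true, IExp.eval_add',
        IExp.eval_sub', IExp.eval_mat, IExp.eval_vec, IExp.eval_reg, h1, h2, h3, h4, h5, h6, hi,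
        hp, h7] at hc ⊢
      rcases eq_or_ne v (p + i) with rfl | hvi
      · rw [Function.update_self, if_pos (c := _ ∧ _) ⟨h9.2 hc, by omega⟩, h8]
      · rw [Function.update_of_ne hvi, hI]
        simp only [hv, hvi, or_false]
    · intro v
      simp only [Store.setIReg_ivec]
      rcases eq_or_ne v (p + i) with rfl | hvi
      · rw [h7, if_neg]
        rw [h9]
        rw [h1, h2, hi] at hc
        tauto
      · rw [hI]
        simp only [hv, hvi, or_false]
  · rintro s' t - ⟨ht, hI⟩
    refine ⟨by simp at ht; omega, hI⟩

theorem dijkstra_relaxFwd {s : Store} {p : ℕ} (hp : s.ireg nA = p) (hu : p ≤ s.ireg u) :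
    WP (forTo a nA (when (0 ≺ capFwd a (u - nA)) (relax a (ell u + slackFwd a (u - nA))))) s
      fun s' t => t ≤ 100 * p + 6 ∧ (∀ v : ℤ, 0 ≤ v → s'.ivec ell v =
        if Res p (s.ivec dbar) (s.ivec sbar) (s.imat flow) (s.ireg u) v then
          if s.ivec ell v < 0 ∨ s.ivec ell (s.ireg u) + Slk p (s.imat cbar) (s.ivec y) (s.ireg u) v
            < s.ivec ell v
          then s.ivec ell (s.ireg u) + Slk p (s.imat cbar) (s.ivec y) (s.ireg u) v
          else s.ivec ell v
        else s.ivec ell v) := by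
  refine (WP_forTo p 92 (fun i s' => ∀ v : ℤ, 0 ≤ v → s'.ivec ell v =
        if Res p (s.ivec dbar) (s.ivec sbar) (s.imat flow) (s.ireg u) v ∧ v < i then
          if s.ivec ell v < 0 ∨ s.ivec ell (s.ireg u) + Slk p (s.imat cbar) (s.ivec y) (s.ireg u) v
            < s.ivec ell v
          then s.ivec ell (s.ireg u) + Slk p (s.imat cbar) (s.ivec y) (s.ireg u) v
          else s.ivec ell v
        else s.ivec ell v) rfl ?_ ?_ ?_).mono ?_
  · intro s' hk
    simp [hk.ireg nA rfl, hp]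
  · intro v hv
    rw [if_neg]
    · simp
    · omega
  · intro i s' hk hi0 hiN hi hI
    have h1 := hk.ireg u rfl
    have h2 := hk.imat flow rfl
    have h3 := hk.ireg nA rfl
    have h4 := hk.ivec y rfl
    have h5 := hk.imat cbar rfl
    have h10 := hk.ivec dbar rfl
    have h11 := hk.ivec sbar rfl
    have h6 : s'.ivec ell (s.ireg u) = s.ivec ell (s.ireg u) := by
      rw [hI _ (by omega), if_neg]
      rintro ⟨h | h, h'⟩ <;> omega
    have h7 : s'.ivec ell i = s.ivec ell i := by
      rw [hI _ hi0, if_neg]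
      omega
    have h8 : Slk p (s.imat cbar) (s.ivec y) (s.ireg u) i =
        s.imat cbar i (s.ireg u - p) + 1 - s.ivec y i - s.ivec y (s.ireg u) := by
      rw [Slk, if_neg (by omega)]
    have h9 : Res p (s.ivec dbar) (s.ivec sbar) (s.imat flow) (s.ireg u) i ↔
        0 < min (s.ivec dbar i) (s.ivec sbar (s.ireg u - p)) - s.imat flow i (s.ireg u - p) := by
      simp only [Res]
      constructor
      · rintro (h | h)
        · omega
        · exact h.2.2
      · exact fun h => Or.inr ⟨hu, hiN, h⟩
    have hv : ∀ v : ℤ, v < i + 1 ↔ v < i ∨ v = i := fun v => by omega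
    simp only [WP_when, BExp.holds_ilt, IExp.eval_zero, capFwd, IExp.eval_mat, IExp.eval_reg,
      IExp.eval_sub', IExp.eval_min', IExp.eval_vec]
    refine ⟨fun hc => relax_spec fun t ht => ⟨?_, ?_⟩, fun hc => ⟨by simp, ?_⟩⟩
    · simp [slackFwd] at ht ⊢
      omega
    · intro v hv0
      have h12 : s'.ireg nA + (s'.ireg u - s'.ireg nA) = s'.ireg u := by ring
      simp only [slackFwd, Store.setIReg_ivec, Store.setIVec_ivec, if_true, IExp.eval_add',
        IExp.eval_sub', IExp.eval_mat, IExp.eval_vec, IExp.eval_reg, IExp.eval_one, h12] at hc ⊢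
      simp only [h1, h2, h3, h4, h5, h6, hi, h10, h11, hp, h7] at hc ⊢
      rcases eq_or_ne v i with rfl | hvi
      · rw [Function.update_self, if_pos (c := _ ∧ _) ⟨h9.2 hc, by omega⟩, h8]
      · rw [Function.update_of_ne hvi, hI _ hv0]
        simp only [hv, hvi, or_false]
    · intro v hv0
      simp only [Store.setIReg_ivec]
      rcases eq_or_ne v i with rfl | hvi
      · rw [h7, if_neg]
        rw [h9]
        rw [h1, h2, h3, h10, h11, hi, hp] at hc
        tauto
      · rw [hI _ hv0]
        simp only [hv, hvi, or_false]
  · rintro s' t - ⟨ht, hI⟩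
    refine ⟨by simp at ht; omega, fun v hv => ?_⟩
    rw [hI v hv]
    congr 1
    simp only [eq_iff_iff, and_iff_left_iff_imp]
    rintro (h | h)
    · omega
    · exact h.2.1

theorem dijkstra_init {s : Store} {p q : ℕ} (hp : s.ireg nA = p) (hq : s.ireg nB = q)
    (E : ℤ → ℤ → Prop) (S : ℤ → ℤ → ℤ) :
    WP (forTo v (nA + nB) (ell.set v (0 - 1) ;; done.set v 0) ;;
      forTo b nB (when (freeSupply b) (ell.set (nA + b) 0))) s
      fun s' t => t ≤ 60 * (p + q) + 20 ∧
        DijkstraInv (p + q) (fun v => p ≤ v ∧ s.ivec used (v - p) < s.ivec sbar (v - p)) E S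
          (s'.ivec ell) (s'.ivec done) := by
  refine WP.seq (WP_forTo (p + q) 10
    (fun i s' => ∀ v : ℤ, 0 ≤ v → v < i → s'.ivec ell v = -1 ∧ s'.ivec done v = 0) rfl ?_ ?_ ?_) ?_
  · intro s' hk
    simp [hk.ireg nA rfl, hk.ireg nB rfl, hp, hq]
  · intro v h0 h1
    omega
  · intro i s' hk hi0 hiN hi hI
    simp only [WP_seq, WP_ivset]
    refine ⟨by simp, fun v hv0 hv1 => ?_⟩
    simp only [Store.setIReg_ivec, Store.setIVec_ivec, Store.setIVec_ireg, reduceCtorEq, if_true,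
      if_false, IExp.eval_reg, IExp.eval_zero, IExp.eval_sub', IExp.eval_one, hi,
      Function.update_apply]
    rcases eq_or_ne v i with rfl | hv
    · simp
    · simpa [hv] using hI v hv0 (by omega)
  rintro s₁ t₁ hk₁ ⟨ht₁, hI₁⟩
  have hI₁' : ∀ v : ℤ, 0 ≤ v → v < p + q → s₁.ivec ell v = -1 ∧ s₁.ivec done v = 0 :=
    fun v h0 h1 => hI₁ v h0 (by push_cast; exact h1)
  have hu := hk₁.ivec used rfl
  have hs := hk₁.ivec sbar rfl
  refine (WP_forTo q 20 (fun i s' => ∀ v : ℤ, 0 ≤ v → v < p + q → s'.ivec ell v =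
    if p ≤ v ∧ v - p < i ∧ s.ivec used (v - p) < s.ivec sbar (v - p) then 0 else -1)
      rfl ?_ ?_ ?_).mono ?_
  · intro s' hk
    simp [hk.ireg nB rfl, hk₁.ireg nB rfl, hq]
  · intro v h0 h1
    rw [if_neg (by omega)]
    exact (hI₁' v h0 h1).1
  · intro i s' hk hi0 hiN hi hI
    have hA : s'.ireg nA = p := by rw [hk.ireg nA rfl, hk₁.ireg nA rfl, hp]
    simp only [WP_when, WP_ivset, freeSupply, BExp.holds_ilt, IExp.eval_vec, IExp.eval_reg, hi,
      hk.ivec used rfl, hk.ivec sbar rfl, hu, hs, IExp.eval_add', IExp.eval_zero, hA,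
      Store.setIReg_ivec, Store.setIVec_ivec, if_true]
    have hii : (p : ℤ) + i - p = i := by ring
    refine ⟨fun hc => ⟨by simp, fun v hv0 hv1 => ?_⟩, fun hc => ⟨by simp, fun v hv0 hv1 => ?_⟩⟩
    · rcases eq_or_ne v (p + i) with rfl | hv
      · rw [Function.update_self, if_pos (c := _ ∧ _)]
        rw [hii]
        exact ⟨by omega, by omega, hc⟩
      · rw [Function.update_of_ne hv, hI v hv0 hv1]
        have : v - p < i + 1 ↔ v - p < i := by omega
        simp only [this]
    · rw [hI v hv0 hv1]
      rcases eq_or_ne v (p + i) with rfl | hv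
      · rw [hii]
        simp [hc]
      · have : v - p < i + 1 ↔ v - p < i := by omega
        simp only [this]
  · rintro s₂ t₂ hk₂ ⟨ht₂, hI₂⟩
    have hd : ∀ v : ℤ, 0 ≤ v → v < p + q → s₂.ivec done v = 0 := fun v h0 h1 => by
      rw [hk₂.ivec done rfl]
      exact (hI₁' v h0 h1).2
    have hl : ∀ v : ℤ, 0 ≤ v → v < p + q → 0 ≤ s₂.ivec ell v →
        s₂.ivec ell v = 0 ∧ p ≤ v ∧ s.ivec used (v - p) < s.ivec sbar (v - p) := by
      intro v h0 h1 h2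
      rw [hI₂ v h0 h1] at h2 ⊢
      split_ifs at h2 ⊢ with h
      · exact ⟨rfl, h.1, h.2.2⟩
      · omega
    refine ⟨by simp at ht₁ ht₂; omega, ?_, ?_, ?_, ?_, ?_, ?_, ?_⟩
    · intro v h0 h1
      rw [hI₂ v h0 h1]
      split_ifs <;> omega
    · rintro v h0 h1 ⟨h2, h3⟩
      rw [hI₂ v h0 h1, if_pos ⟨h2, by omega, h3⟩]
    · exact fun v h0 h1 => Or.inl (hd v h0 h1)
    · intro u v hu0 hu1 _ _ hdu
      rw [hd u hu0 hu1] at hdu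
      omega
    · intro f hf _ v hv0 hv1 hlv
      have := hl v hv0 hv1 hlv
      rw [this.1]
      exact hf v hv0 hv1 this.2
    · intro u hu0 hu1 hdu
      rw [hd u hu0 hu1] at hdu
      omega
    · intro u v hu0 hu1 _ _ hdu
      rw [hd u hu0 hu1] at hdu
      omega

theorem dijkstra_loop {s : Store} {p q : ℕ} (hp : s.ireg nA = p) (hq : s.ireg nB = q)
    (src : ℤ → Prop)
    (hS : ∀ u v : ℤ, 0 ≤ u → u < p + q → 0 ≤ v → v < p + q →
      Res p (s.ivec dbar) (s.ivec sbar) (s.imat flow) u v →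
        0 ≤ Slk p (s.imat cbar) (s.ivec y) u v)
    (h0 : DijkstraInv (p + q) src (Res p (s.ivec dbar) (s.ivec sbar) (s.imat flow))
      (Slk p (s.imat cbar) (s.ivec y)) (s.ivec ell) (s.ivec done)) (hu : 0 ≤ s.ireg u) :
    WP (.loop ((0 - 1) ≺ u)
    (u.set (0 - 1) ;;
     forTo v (nA + nB)
       (when ((done v ≐ 0) ⩓ ((0 - 1) ≺ ell v) ⩓ ((u ≺ 0) ⩔ (ell v ≺ ell u))) (u.set v)) ;;
     when ((0 - 1) ≺ u)
       (done.set u 1 ;;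
        .ite (u ≺ nA)
          (forTo b nB (when (0 ≺ capBwd u b) (relax (nA + b) (ell u + slackBwd u b))))
          (forTo a nA
            (when (0 ≺ capFwd a (u - nA)) (relax a (ell u + slackFwd a (u - nA)))))))) s
      fun s' t => t ≤ (140 * (p + q) + 60) * (p + q + 1) + 6 ∧
        DijkstraInv (p + q) src (Res p (s.ivec dbar) (s.ivec sbar) (s.imat flow))
          (Slk p (s.imat cbar) (s.ivec y)) (s'.ivec ell) (s'.ivec done) ∧
        ∀ v : ℤ, 0 ≤ v → v < p + q → s'.ivec done v = 0 → s'.ivec ell v < 0 := by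
  -- Each round finishes one open vertex, except for the last, in which the selection fails and `u`
  -- becomes -1. The indicator of `0 ≤ u` pays for that round. A round takes about 40n steps for the
  -- selection and 100n for the relaxations.
  refine (WP_loop (fun n s' => DijkstraInv (p + q) src
      (Res p (s.ivec dbar) (s.ivec sbar) (s.imat flow))
      (Slk p (s.imat cbar) (s.ivec y)) (s'.ivec ell) (s'.ivec done) ∧
      (140 * (p + q) + 60) * ((((Finset.Ico (0 : ℤ) (p + q)).filter
        fun v => s'.ivec done v = 0).card) + (if 0 ≤ s'.ireg u then 1 else 0)) ≤ n ∧
      (s'.ireg u < 0 → ∀ v : ℤ, 0 ≤ v → v < p + q → s'.ivec done v = 0 → s'.ivec ell v < 0))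
      ((140 * (p + q) + 60) * (p + q + 1)) ⟨h0, ?_, fun h => by omega⟩ ?_).mono ?_
  · have : ((Finset.Ico (0 : ℤ) (p + q)).filter fun v => s.ivec done v = 0).card ≤ p + q := by
      refine (Finset.card_filter_le _ _).trans ?_
      simp only [Int.card_Ico]
      omega
    rw [if_pos hu]
    exact Nat.mul_le_mul_left _ (by omega)
  · rintro n s₁ hk₁ ⟨hD, hn, -⟩ hB
    simp only [BExp.holds_ilt, IExp.eval_sub', IExp.eval_zero, IExp.eval_one, IExp.eval_reg] at hB
    rw [if_pos (by omega)] at hn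
    have hA₁ : s₁.ireg nA = p := by rw [hk₁.ireg nA rfl, hp]
    have hB₁ : s₁.ireg nB = q := by rw [hk₁.ireg nB rfl, hq]
    refine WP_seq.2 (WP_iset.2 ?_)
    refine WP.seq (dijkstra_select (p := p) (q := q) (by simp [hA₁]) (by simp [hB₁]) (by simp)) ?_
    rintro s₂ t₂ hk₂ ⟨ht₂, hI⟩
    have hd₂ : s₂.ivec done = s₁.ivec done := hk₂.ivec done rfl
    have hl₂ : s₂.ivec ell = s₁.ivec ell := hk₂.ivec ell rfl
    have hA₂ : s₂.ireg nA = p := by rw [hk₂.ireg nA rfl]; simpa using hA₁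
    have hB₂ : s₂.ireg nB = q := by rw [hk₂.ireg nB rfl]; simpa using hB₁
    have hy₂ : s₂.ivec y = s.ivec y := (hk₂.ivec y rfl).trans (hk₁.ivec y rfl)
    have hf₂ : s₂.imat flow = s.imat flow := (hk₂.imat flow rfl).trans (hk₁.imat flow rfl)
    have hc₂ : s₂.imat cbar = s.imat cbar := (hk₂.imat cbar rfl).trans (hk₁.imat cbar rfl)
    have hdb₂ : s₂.ivec dbar = s.ivec dbar := (hk₂.ivec dbar rfl).trans (hk₁.ivec dbar rfl)
    have hsb₂ : s₂.ivec sbar = s.ivec sbar := (hk₂.ivec sbar rfl).trans (hk₁.ivec sbar rfl)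
    simp only [Store.setIReg_ivec] at hI
    simp only [WP_when, BExp.holds_ilt, IExp.eval_sub', IExp.eval_zero, IExp.eval_one,
      IExp.eval_reg]
    refine ⟨fun hc => ?_, fun hc => ?_⟩
    · rcases hI with ⟨hI, hI'⟩ | ⟨hI0, hI1, hI2, hI3, hI4⟩
      · omega
      have hcard : ((Finset.Ico (0 : ℤ) (p + q)).filter
            fun v => Function.update (s₁.ivec done) (s₂.ireg u) 1 v = 0).card + 1 =
          ((Finset.Ico (0 : ℤ) (p + q)).filter fun v => s₁.ivec done v = 0).card := by
        rw [← Finset.card_erase_add_one (a := s₂.ireg u) (s := (Finset.Ico (0 : ℤ) (p + q)).filter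
          fun v => s₁.ivec done v = 0) (by simp [hI0, hI1, hI2])]
        congr 2
        ext v
        simp only [Finset.mem_filter, Finset.mem_erase, Finset.mem_Ico, Function.update_apply]
        by_cases hv : v = s₂.ireg u <;> simp [hv]
      -- both branches relax the edges out of the selected vertex
      suffices H : WP (.ite (u ≺ nA)
            (forTo b nB (when (0 ≺ capBwd u b) (relax (nA + b) (ell u + slackBwd u b))))
            (forTo a nA
              (when (0 ≺ capFwd a (u - nA)) (relax a (ell u + slackFwd a (u - nA))))))
          (s₂.setIVec done (s₂.ireg u) 1) fun s' t => t ≤ 100 * (p + q) + 10 ∧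
            ∀ v : ℤ, 0 ≤ v → v < p + q → s'.ivec ell v =
              if Res p (s.ivec dbar) (s.ivec sbar) (s.imat flow) (s₂.ireg u) v then
                if s₁.ivec ell v < 0 ∨ s₁.ivec ell (s₂.ireg u) +
                  Slk p (s.imat cbar) (s.ivec y) (s₂.ireg u) v < s₁.ivec ell v
                then s₁.ivec ell (s₂.ireg u) + Slk p (s.imat cbar) (s.ivec y) (s₂.ireg u) v
                else s₁.ivec ell v
              else s₁.ivec ell v by
        refine WP_seq.2 (WP_ivset.2 (H.mono ?_))
        rintro s₃ t₃ hk₃ ⟨ht₃, hI₃⟩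
        have hd₃ : s₃.ivec done = Function.update (s₁.ivec done) (s₂.ireg u) 1 := by
          rw [hk₃.ivec done rfl]
          simp [hd₂]
        have hu₃ : s₃.ireg u = s₂.ireg u := hk₃.ireg u rfl
        refine ⟨(140 * (p + q) + 60) * ((Finset.Ico (0 : ℤ) (p + q)).filter
          fun v => s₁.ivec done v = 0).card, ?_, ?_, ?_, fun h => ?_⟩
        · simp only [IExp.steps_sub', IExp.steps_zero, IExp.steps_one, BExp.steps_ilt,
            IExp.steps_reg]
          rw [mul_add] at hn
          omega
        · refine hD.step hS (s₂.ireg u) hI0 hI1 hI2 hI3 hI4 hd₃ ?_ ?_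
          · intro v h0 h1 h2
            rw [hI₃ v h0 h1, if_pos h2]
          · intro v h0 h1 h2
            rw [hI₃ v h0 h1, if_neg h2]
        · refine Nat.mul_le_mul_left _ ?_
          rw [hd₃, ← hcard]
          split_ifs <;> simp
        · rw [hu₃] at h
          omega
      refine WP_ite.2 ⟨fun h => ?_, fun h => ?_⟩
      · simp only [BExp.holds_ilt, IExp.eval_reg, Store.setIVec_ireg, hA₂] at h
        refine (dijkstra_relaxBwd (p := p) (q := q) (by simp [hA₂]) (by simp [hB₂])
          (by simpa using h)).mono ?_
        rintro s₃ t₃ - ⟨ht₃, hI₃⟩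
        refine ⟨by simp; omega, fun v h0 h1 => ?_⟩
        rw [hI₃ v]
        simp [h1, hdb₂, hsb₂, hf₂, hc₂, hy₂, hl₂]
      · simp only [BExp.holds_ilt, IExp.eval_reg, Store.setIVec_ireg, hA₂] at h
        refine (dijkstra_relaxFwd (p := p) (by simp [hA₂]) (by simpa using h)).mono ?_
        rintro s₃ t₃ - ⟨ht₃, hI₃⟩
        refine ⟨by simp; omega, fun v h0 h1 => ?_⟩
        rw [hI₃ v h0]
        simp [hdb₂, hsb₂, hf₂, hc₂, hy₂, hl₂]
    · rcases hI with ⟨hI, hI'⟩ | ⟨hI0, hI1, hI2, hI3, hI4⟩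
      · refine ⟨(140 * (p + q) + 60) * ((Finset.Ico (0 : ℤ) (p + q)).filter
          fun v => s₁.ivec done v = 0).card, ?_, ?_, ?_, fun _ => ?_⟩
        · simp only [IExp.steps_sub', IExp.steps_zero, IExp.steps_one, BExp.steps_ilt,
            IExp.steps_reg]
          rw [mul_add] at hn
          omega
        · rwa [hl₂, hd₂]
        · rw [if_neg (by omega), hd₂, add_zero]
        · rwa [hl₂, hd₂]
      · omega
  · rintro s' t - ⟨n', hn', ⟨hD, -, hI⟩, hB⟩
    simp only [BExp.holds_ilt, IExp.eval_sub', IExp.eval_zero, IExp.eval_one, IExp.eval_reg] at hB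
    refine ⟨by simp at hn'; omega, hD, hI (by omega)⟩

theorem dijkstra_target {s : Store} {p : ℕ} (hp : s.ireg nA = p) :
    WP (ellT.set (0 - 1) ;; forTo a nA
      (when (freeDemand a ⩓ ((0 - 1) ≺ ell a) ⩓ ((ellT ≺ 0) ⩔ (ell a ≺ ellT)))
        (ellT.set (ell a)))) s
      fun s' t => t ≤ 40 * p + 20 ∧
        (∀ a : ℤ, 0 ≤ a → a < p → s.ivec recv a < s.ivec dbar a → 0 ≤ s.ivec ell a →
          0 ≤ s'.ireg ellT ∧ s'.ireg ellT ≤ s.ivec ell a) ∧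
        (0 ≤ s'.ireg ellT → ∃ a : ℤ, 0 ≤ a ∧ a < p ∧ s.ivec recv a < s.ivec dbar a ∧
          s.ivec ell a = s'.ireg ellT) := by
  refine WP_seq.2 (WP_iset.2 ((WP_forTo p 30 (fun i s' =>
        (∀ a : ℤ, 0 ≤ a → a < i → s.ivec recv a < s.ivec dbar a → 0 ≤ s.ivec ell a →
          0 ≤ s'.ireg ellT ∧ s'.ireg ellT ≤ s.ivec ell a) ∧
        (0 ≤ s'.ireg ellT → ∃ a : ℤ, 0 ≤ a ∧ a < p ∧ s.ivec recv a < s.ivec dbar a ∧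
          s.ivec ell a = s'.ireg ellT)) rfl ?_ ?_ ?_).mono ?_))
  · intro s' hk
    have := hk.ireg nA rfl
    simp only [Store.setIReg_ireg, reduceCtorEq, if_false] at this
    simp [this, hp]
  · refine ⟨fun a h0 h1 => by omega, fun h => ?_⟩
    simp at h
  · rintro i s' hk hi0 hiN hi ⟨hI, hI'⟩
    have h1 : s'.ivec ell = s.ivec ell := hk.ivec ell rfl
    have h2 : s'.ivec recv = s.ivec recv := hk.ivec recv rfl
    have h3 : s'.ivec dbar = s.ivec dbar := hk.ivec dbar rfl
    simp only [WP_when, WP_iset, freeDemand, BExp.holds_and, BExp.holds_or, BExp.holds_ilt,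
      IExp.eval_vec, IExp.eval_reg, IExp.eval_zero, IExp.eval_sub', IExp.eval_one, hi, h1, h2, h3,
      Store.setIReg_ireg, reduceCtorEq, if_true, if_false]
    refine ⟨fun hc => ⟨by simp, ?_, ?_⟩, fun hc => ⟨by simp, ?_, hI'⟩⟩
    · intro a ha0 ha1 hf hl
      rcases eq_or_ne a i with rfl | ha
      · omega
      · have := hI a ha0 (by omega) hf hl
        omega
    · exact fun _ => ⟨i, hi0, hiN, hc.1, rfl⟩
    · intro a ha0 ha1 hf hl
      rcases eq_or_ne a i with rfl | ha
      · by_contra h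
        exact hc ⟨hf, by omega, by omega⟩
      · exact hI a ha0 (by omega) hf hl
  · rintro s' t - ⟨ht, hI⟩
    refine ⟨by simp at ht ⊢; omega, hI⟩

theorem dijkstra_spec {s : Store} {p q : ℕ} (hp : s.ireg nA = p) (hq : s.ireg nB = q)
    (hS : ∀ u v : ℤ, 0 ≤ u → u < p + q → 0 ≤ v → v < p + q →
      Res p (s.ivec dbar) (s.ivec sbar) (s.imat flow) u v →
        0 ≤ Slk p (s.imat cbar) (s.ivec y) u v) :
    WP dijkstra s fun s' t => t ≤ (140 * (p + q) + 60) * (p + q + 1) + 100 * (p + q) + 60 ∧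
      DijkstraSpec p q (fun v => p ≤ v ∧ s.ivec used (v - p) < s.ivec sbar (v - p))
        (fun a => s.ivec recv a < s.ivec dbar a)
        (Res p (s.ivec dbar) (s.ivec sbar) (s.imat flow)) (Slk p (s.imat cbar) (s.ivec y))
        (s'.ivec ell) (s'.ireg ellT) := by
  unfold dijkstra
  refine WP_seq_assoc.2 (WP.seq (dijkstra_init hp hq (Res p (s.ivec dbar) (s.ivec sbar)
    (s.imat flow)) (Slk p (s.imat cbar) (s.ivec y))) ?_)
  rintro s₁ t₁ hk₁ ⟨ht₁, hD₁⟩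
  refine WP_seq.2 (WP_iset.2 (WP.seq (dijkstra_loop (p := p) (q := q)
    (by simp [hk₁.ireg nA rfl, hp]) (by simp [hk₁.ireg nB rfl, hq])
    (fun v => p ≤ v ∧ s.ivec used (v - p) < s.ivec sbar (v - p))
    ?_ ?_ (by simp)) ?_))
  · simpa [hk₁.ivec dbar rfl, hk₁.ivec sbar rfl, hk₁.imat flow rfl, hk₁.imat cbar rfl,
      hk₁.ivec y rfl] using hS
  · simpa [hk₁.ivec dbar rfl, hk₁.ivec sbar rfl, hk₁.imat flow rfl, hk₁.imat cbar rfl,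
      hk₁.ivec y rfl] using hD₁
  rintro s₂ t₂ hk₂ ⟨ht₂, hD₂, hdone⟩
  simp only [Store.setIReg_ivec, Store.setIReg_imat, hk₁.ivec dbar rfl, hk₁.ivec sbar rfl,
    hk₁.imat flow rfl, hk₁.imat cbar rfl, hk₁.ivec y rfl] at hD₂
  have hA₂ : s₂.ireg nA = p := by
    rw [hk₂.ireg nA rfl]
    simp [hk₁.ireg nA rfl, hp]
  refine (dijkstra_target hA₂).mono ?_
  rintro s₃ t₃ hk₃ ⟨ht₃, hT, hT'⟩
  have h1 : s₂.ivec recv = s.ivec recv := (hk₂.ivec recv rfl).trans (hk₁.ivec recv rfl)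
  have h2 : s₂.ivec dbar = s.ivec dbar := (hk₂.ivec dbar rfl).trans (hk₁.ivec dbar rfl)
  rw [h1, h2] at hT hT'
  rw [hk₃.ivec ell rfl]
  refine ⟨by simp at *; omega, hD₂.neg_one_le, hD₂.src_eq, ?_, hD₂.lower, hT, hT'⟩
  intro u v hu0 hu1 hv0 hv1 hlu hE
  refine hD₂.closed u v hu0 hu1 hv0 hv1 ?_ hE
  rcases hD₂.done_or u hu0 hu1 with h | h
  · have := hdone u hu0 hu1 h
    omega
  · exact h

/-! ### Hungarian search -/

/-- The integral plan `fl` with the dual weights `y` is `1`-feasible, and the admissible graph has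
no cycles. -/
structure Feasible (p q : ℕ) (db sb : ℤ → ℤ) (cb fl : ℤ → ℤ → ℤ) (rc us y : ℤ → ℤ) : Prop where
  flow_nonneg : ∀ a b : ℤ, 0 ≤ a → a < p → 0 ≤ b → b < q → 0 ≤ fl a b
  recv_eq : ∀ a : ℤ, 0 ≤ a → a < p → rc a = ∑ b ∈ Finset.Ico (0 : ℤ) q, fl a b
  used_eq : ∀ b : ℤ, 0 ≤ b → b < q → us b = ∑ a ∈ Finset.Ico (0 : ℤ) p, fl a b
  recv_le : ∀ a : ℤ, 0 ≤ a → a < p → rc a ≤ db a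
  used_le : ∀ b : ℤ, 0 ≤ b → b < q → us b ≤ sb b
  slack_nonneg : ∀ u v : ℤ, 0 ≤ u → u < p + q → 0 ≤ v → v < p + q → Res p db sb fl u v →
    0 ≤ Slk p cb y u v
  dual_supply : ∀ v : ℤ, p ≤ v → v < p + q → 0 ≤ y v
  dual_demand : ∀ a : ℤ, 0 ≤ a → a < p → y a ≤ 0
  dual_free : ∀ a : ℤ, 0 ≤ a → a < p → rc a < db a → y a = 0
  acyclic : ∃ r : ℤ → ℤ, ∀ u v : ℤ, 0 ≤ u → u < p + q → 0 ≤ v → v < p + q →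
    Res p db sb fl u v → Slk p cb y u v = 0 → r v < r u

/-- No augmenting path is admissible: `D` contains all vertices that are reachable from a free
supply node. -/
def Blocked (p q : ℕ) (db sb : ℤ → ℤ) (cb fl : ℤ → ℤ → ℤ) (rc us y : ℤ → ℤ) : Prop :=
  ∃ D : ℤ → Prop, (∀ v : ℤ, p ≤ v → v < p + q → us (v - p) < sb (v - p) → D v) ∧
    (∀ u v : ℤ, 0 ≤ u → u < p + q → 0 ≤ v → v < p + q → Res p db sb fl u v →
      Slk p cb y u v = 0 → D u → D v) ∧
    ∀ a : ℤ, 0 ≤ a → a < p → rc a < db a → ¬ D a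

/-! ### Feasible weights and the effect of a Hungarian search. -/

section

variable {p q : ℕ} {db sb : ℤ → ℤ} {cb fl : ℤ → ℤ → ℤ} {rc us y y' l : ℤ → ℤ} {lT : ℤ}

theorem Feasible.flow_le_recv (h : Feasible p q db sb cb fl rc us y) {a b : ℤ} (ha0 : 0 ≤ a)
    (ha : a < p) (hb0 : 0 ≤ b) (hb : b < q) : fl a b ≤ rc a := by
  rw [h.recv_eq a ha0 ha]
  refine Finset.single_le_sum (f := fun b => fl a b) (fun b hb => ?_) (by simp [hb0, hb])
  rw [Finset.mem_Ico] at hb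
  exact h.flow_nonneg a b ha0 ha hb.1 hb.2

theorem Feasible.flow_le_used (h : Feasible p q db sb cb fl rc us y) {a b : ℤ} (ha0 : 0 ≤ a)
    (ha : a < p) (hb0 : 0 ≤ b) (hb : b < q) : fl a b ≤ us b := by
  rw [h.used_eq b hb0 hb]
  refine Finset.single_le_sum (f := fun a => fl a b) (fun a ha => ?_) (by simp [ha0, ha])
  rw [Finset.mem_Ico] at ha
  exact h.flow_nonneg a b ha.1 ha.2 hb0 hb

/-- An entry of the plan is at most the amount received by its demand node and the amount used at
its supply node. If both nodes are free, it lies below both bounds in the capacity. This is why all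
free supply nodes are directly connected to all free demand nodes. -/
theorem Feasible.res_of_free (h : Feasible p q db sb cb fl rc us y) {a v : ℤ} (ha0 : 0 ≤ a)
    (ha : a < p) (hv0 : p ≤ v) (hv : v < p + q) (hfa : rc a < db a)
    (hfv : us (v - p) < sb (v - p)) : Res p db sb fl v a := by
  have h1 := h.flow_le_recv ha0 ha (b := v - p) (by omega) (by omega)
  have h2 := h.flow_le_used ha0 ha (b := v - p) (by omega) (by omega)
  exact Or.inr ⟨hv0, ha, by omega⟩

/-- The weight of a free supply node is at most the scaled cost plus one. -/
theorem Feasible.dual_le (h : Feasible p q db sb cb fl rc us y) {a v : ℤ} (ha0 : 0 ≤ a)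
    (ha : a < p) (hv0 : p ≤ v) (hv : v < p + q) (hfa : rc a < db a)
    (hfv : us (v - p) < sb (v - p)) : y v ≤ cb a (v - p) + 1 := by
  have h1 := h.slack_nonneg v a (by omega) hv ha0 (by omega)
    (h.res_of_free ha0 ha hv0 hv hfa hfv)
  have h2 := h.dual_free a ha0 ha hfa
  rw [Slk, if_neg (by omega)] at h1
  omega

/-- Take the potential that is 0 on the set `D` of `Blocked` and 1 outside. An edge that leaves `D`
has a nonzero, hence positive integral slack, so the potential is admissible for `lower`, and free
demand nodes are at distance at least 1. One of them is reached at all by the direct residual edge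
from a free supply node. -/
theorem DijkstraSpec.pos (h : Feasible p q db sb cb fl rc us y)
    (hD : DijkstraSpec p q (fun v => p ≤ v ∧ us (v - p) < sb (v - p)) (fun a => rc a < db a)
      (Res p db sb fl) (Slk p cb y) l lT)
    (hbl : Blocked p q db sb cb fl rc us y)
    (ha : ∃ a : ℤ, 0 ≤ a ∧ a < p ∧ rc a < db a)
    (hb : ∃ v : ℤ, p ≤ v ∧ v < p + q ∧ us (v - p) < sb (v - p)) : 0 < lT := by
  classical
  obtain ⟨a, ha0, ha1, hfa⟩ := ha
  obtain ⟨v, hv0, hv1, hfv⟩ := hb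
  have hl := hD.src_eq v (by omega) hv1 ⟨hv0, hfv⟩
  have h1 := hD.closed v a (by omega) hv1 ha0 (by omega) (by omega)
    (h.res_of_free ha0 ha1 hv0 hv1 hfa hfv)
  obtain ⟨a', ha'0, ha'1, hfa', hla'⟩ := hD.tgt_eq (hD.tgt_le a ha0 ha1 hfa h1.1).1
  have h0 := (hD.tgt_le a ha0 ha1 hfa h1.1).1
  obtain ⟨D, hD1, hD2, hD3⟩ := hbl
  have h2 := hD.lower (fun v => if D v then 0 else 1)
    (fun v hv0 hv1 hv => by simp [hD1 v hv.1 hv1 hv.2]) ?_ a' ha'0 (by omega) (by omega)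
  · simp only [hD3 a' ha'0 ha'1 hfa', if_false] at h2
    omega
  · intro u v hu0 hu1 hv0 hv1 hE
    have h3 := h.slack_nonneg u v hu0 hu1 hv0 hv1 hE
    have h4 := hD2 u v hu0 hu1 hv0 hv1 hE
    by_cases hu : D u <;> by_cases hv : D v <;> simp only [hu, hv, if_true, if_false] <;>
      try omega
    have : Slk p cb y u v ≠ 0 := fun h => hv (h4 h hu)
    omega

/-- With `L` the distance truncated at `lT`, the adjustment adds `L - lT` at demand nodes and `lT -
L` at supply nodes, so the slack of an edge from `u` to `v` grows by `L u - L v`. The triangle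
inequality survives truncation, so slacks stay nonnegative. The signs of the weights persist since
`L ≤ lT`, and free demand nodes are not touched because none of them is nearer than `lT`. -/
theorem Feasible.adjust (h : Feasible p q db sb cb fl rc us y)
    (hD : DijkstraSpec p q (fun v => p ≤ v ∧ us (v - p) < sb (v - p)) (fun a => rc a < db a)
      (Res p db sb fl) (Slk p cb y) l lT)
    (hy : ∀ v : ℤ, 0 ≤ v → v < p + q → y' v = if -1 < l v ∧ l v < lT then
      if v < p then y v - lT + l v else y v + lT - l v else y v) :
    Feasible p q db sb cb fl rc us y' := by
  set L : ℤ → ℤ := fun v => if -1 < l v ∧ l v < lT then l v else lT with hL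
  have hLle : ∀ v, L v ≤ lT := fun v => by
    simp only [hL]
    split_ifs <;> omega
  have hyA : ∀ v : ℤ, 0 ≤ v → v < p → y' v = y v - lT + L v := by
    intro v hv0 hv
    rw [hy v hv0 (by omega)]
    simp only [hL]
    split_ifs <;> omega
  have hyB : ∀ v : ℤ, p ≤ v → v < p + q → y' v = y v + lT - L v := by
    intro v hv0 hv
    rw [hy v (by omega) hv]
    simp only [hL]
    split_ifs <;> omega
  have hE : ∀ u v : ℤ, 0 ≤ u → u < p + q → 0 ≤ v → v < p + q → Res p db sb fl u v →
      Slk p cb y' u v = Slk p cb y u v + L u - L v := by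
    intro u v hu0 hu1 hv0 hv1 hE
    rcases hE with ⟨h1, h2, -⟩ | ⟨h1, h2, -⟩
    · rw [Slk, Slk, if_pos h1, if_pos h1, hyA u hu0 h1, hyB v h2 hv1]
      ring
    · rw [Slk, Slk, if_neg (by omega), if_neg (by omega), hyA v hv0 h2, hyB u h1 hu1]
      ring
  have hLE : ∀ u v : ℤ, 0 ≤ u → u < p + q → 0 ≤ v → v < p + q → Res p db sb fl u v →
      L v ≤ L u + Slk p cb y u v := by
    intro u v hu0 hu1 hv0 hv1 hE
    have h1 := h.slack_nonneg u v hu0 hu1 hv0 hv1 hE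
    have h2 := hD.closed u v hu0 hu1 hv0 hv1
    by_cases hu : -1 < l u ∧ l u < lT
    · have h3 := h2 (by omega) hE
      have h4 : L u = l u := if_pos hu
      have h5 : L v ≤ l v := by
        simp only [hL]
        split_ifs <;> omega
      omega
    · have h4 : L u = lT := if_neg hu
      have := hLle v
      omega
  refine ⟨h.flow_nonneg, h.recv_eq, h.used_eq, h.recv_le, h.used_le, ?_, ?_, ?_, ?_, ?_⟩
  · intro u v hu0 hu1 hv0 hv1 hR
    have := hLE u v hu0 hu1 hv0 hv1 hR
    rw [hE u v hu0 hu1 hv0 hv1 hR]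
    omega
  · intro v hv0 hv1
    have := hLle v
    have := h.dual_supply v hv0 hv1
    rw [hyB v hv0 hv1]
    omega
  · intro v hv0 hv1
    have := hLle v
    have := h.dual_demand v hv0 hv1
    rw [hyA v hv0 hv1]
    omega
  · intro a ha0 ha1 hfa
    have h1 := h.dual_free a ha0 ha1 hfa
    have h2 := hD.tgt_le a ha0 ha1 hfa
    rw [hy a ha0 (by omega), if_neg, h1]
    omega
  · obtain ⟨r, hr⟩ := h.acyclic
    obtain ⟨M, hM⟩ : ∃ M : ℤ, ∀ v : ℤ, 0 ≤ v → v < p + q → |r v| ≤ M :=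
      ⟨∑ v ∈ Finset.Ico (0 : ℤ) (p + q), |r v|, fun v h0 h1 =>
        Finset.single_le_sum (f := fun v => |r v|) (fun _ _ => abs_nonneg _) (by simp [h0, h1])⟩
    -- An edge that is admissible after the adjustment satisfies `L v = L u + slack`. If the old
    -- slack was 0, then `L` is constant along it and the old rank drops. Otherwise `L` grows by at
    -- least 1, and the factor `2 * M + 1` outweighs any change of the old rank, which is at most `2
    -- * M`.
    refine ⟨fun v => r v - (2 * M + 1) * L v, fun u v hu0 hu1 hv0 hv1 hR hS => ?_⟩
    rw [hE u v hu0 hu1 hv0 hv1 hR] at hS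
    have h1 := h.slack_nonneg u v hu0 hu1 hv0 hv1 hR
    have h2 := hr u v hu0 hu1 hv0 hv1 hR
    have h3 := abs_le.1 (hM u hu0 hu1)
    have h4 := abs_le.1 (hM v hv0 hv1)
    rcases h1.eq_or_lt with h5 | h5
    · have h6 : L v = L u := by omega
      have h7 := h2 h5.symm
      change r v - (2 * M + 1) * L v < r u - (2 * M + 1) * L u
      rw [h6]
      linarith
    · have : L u + 1 ≤ L v := by omega
      have : (2 * M + 1) * (L u + 1) ≤ (2 * M + 1) * L v :=
        mul_le_mul_of_nonneg_left this (by omega)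
      change r v - (2 * M + 1) * L v < r u - (2 * M + 1) * L u
      linarith

end

theorem adjustDuals_spec {s : Store} {p q : ℕ} (hp : s.ireg nA = p) (hq : s.ireg nB = q) :
    WP adjustDuals s fun s' t => t ≤ 50 * (p + q) + 10 ∧ ∀ v : ℤ, 0 ≤ v → v < p + q →
      s'.ivec y v = if -1 < s.ivec ell v ∧ s.ivec ell v < s.ireg ellT then
        if v < p then s.ivec y v - s.ireg ellT + s.ivec ell v
        else s.ivec y v + s.ireg ellT - s.ivec ell v else s.ivec y v := by
  unfold adjustDuals
  refine (WP_forTo (p + q) 40 (fun i s' => ∀ v : ℤ, s'.ivec y v =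
      if (0 ≤ v ∧ v < i) ∧ -1 < s.ivec ell v ∧ s.ivec ell v < s.ireg ellT then
        if v < p then s.ivec y v - s.ireg ellT + s.ivec ell v
        else s.ivec y v + s.ireg ellT - s.ivec ell v else s.ivec y v) rfl ?_ ?_ ?_).mono ?_
  · intro s' hk
    simp [hk.ireg nA rfl, hk.ireg nB rfl, hp, hq]
  · intro v
    rw [if_neg (by omega)]
    simp
  · intro i s' hk hi0 hiN hi hI
    have h1 : s'.ivec ell = s.ivec ell := hk.ivec ell rfl
    have h2 : s'.ireg ellT = s.ireg ellT := hk.ireg ellT rfl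
    have h3 : s'.ireg nA = p := (hk.ireg nA rfl).trans hp
    have h4 : s'.ivec y i = s.ivec y i := by
      rw [hI, if_neg (by omega)]
    have hv : ∀ v : ℤ, v ≠ i → (v < i + 1 ↔ v < i) := fun v hv => by omega
    have hm : (-1 < s.ivec ell i ∧ s.ivec ell i < s.ireg ellT → ∀ x : ℤ, x = (if i < p then
        s.ivec y i - s.ireg ellT + s.ivec ell i else s.ivec y i + s.ireg ellT - s.ivec ell i) →
        ∀ v, Function.update (s'.ivec y) i x v =
      if (0 ≤ v ∧ v < i + 1) ∧ -1 < s.ivec ell v ∧ s.ivec ell v < s.ireg ellT then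
        if v < p then s.ivec y v - s.ireg ellT + s.ivec ell v
        else s.ivec y v + s.ireg ellT - s.ivec ell v else s.ivec y v) := by
      intro hc x hx v
      rcases eq_or_ne v i with rfl | hvi
      · rw [Function.update_self, if_pos (c := _ ∧ _) ⟨by omega, hc⟩, hx]
      · rw [Function.update_of_ne hvi, hI]
        simp only [hv v hvi]
    simp only [WP_when, WP_ite, WP_ivset, BExp.holds_and, BExp.holds_ilt, IExp.eval_vec,
      IExp.eval_reg, IExp.eval_zero, IExp.eval_one, IExp.eval_sub', IExp.eval_add', hi, h1, h2, h3,
      h4, Store.setIReg_ivec, Store.setIVec_ivec, if_true]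
    refine ⟨fun hc => ⟨fun hip => ⟨by simp, hm (by omega) _ ?_⟩,
      fun hip => ⟨by simp, hm (by omega) _ ?_⟩⟩, fun hc => ⟨by simp, fun v => ?_⟩⟩
    · rw [if_pos hip]
    · rw [if_neg hip]
    · rw [hI]
      rcases eq_or_ne v i with rfl | hvi
      · rw [if_neg (by omega), if_neg (by omega)]
      · simp only [hv v hvi]
  · rintro s' t - ⟨ht, hI⟩
    refine ⟨by simp at ht ⊢; omega, fun v hv0 hv1 => ?_⟩
    rw [hI]
    simp [hv0, hv1]

/-- Free supply nodes are sources, at distance 0 < `lT`, so their weights rise by exactly `lT ≥ 1`.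
Blockedness enters only through `DijkstraSpec.pos`. -/
theorem hungarianSearch_spec {s : Store} {p q : ℕ} (hp : s.ireg nA = p) (hq : s.ireg nB = q)
    (hF : Feasible p q (s.ivec dbar) (s.ivec sbar) (s.imat cbar) (s.imat flow) (s.ivec recv)
      (s.ivec used) (s.ivec y))
    (hbl : Blocked p q (s.ivec dbar) (s.ivec sbar) (s.imat cbar) (s.imat flow) (s.ivec recv)
      (s.ivec used) (s.ivec y))
    (ha : ∃ a : ℤ, 0 ≤ a ∧ a < p ∧ s.ivec recv a < s.ivec dbar a)
    (hb : ∃ v : ℤ, p ≤ v ∧ v < p + q ∧ s.ivec used (v - p) < s.ivec sbar (v - p)) :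
    WP hungarianSearch s fun s' t => t ≤ 360 * (p + q + 1) ^ 2 ∧
      Feasible p q (s.ivec dbar) (s.ivec sbar) (s.imat cbar) (s.imat flow) (s.ivec recv)
        (s.ivec used) (s'.ivec y) ∧
      ∀ v : ℤ, p ≤ v → v < p + q → s.ivec used (v - p) < s.ivec sbar (v - p) →
        s.ivec y v + 1 ≤ s'.ivec y v := by
  unfold hungarianSearch
  refine WP.seq (dijkstra_spec hp hq hF.slack_nonneg) ?_
  rintro s₁ t₁ hk₁ ⟨ht₁, hD⟩
  have hlT := hD.pos hF hbl ha hb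
  refine (adjustDuals_spec (p := p) (q := q) (by rw [hk₁.ireg nA rfl, hp])
    (by rw [hk₁.ireg nB rfl, hq])).mono ?_
  rintro s₂ t₂ hk₂ ⟨ht₂, hy⟩
  rw [hk₁.ivec y rfl] at hy
  refine ⟨by nlinarith, hF.adjust hD hy, fun v hv0 hv1 hv => ?_⟩
  have := hD.src_eq v (by omega) hv1 ⟨hv0, hv⟩
  rw [hy v (by omega) hv1, if_pos (by omega), if_neg (by omega)]
  omega

/-! ### Depth-first search -/

/-- The candidate number `i` for a successor of the vertex `u`. -/
def nbr (p : ℕ) (u i : ℤ) : ℤ := if u < p then p + i else i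

/-- The number of candidates for successors of the vertex `u`. -/
def nbrCount (p q : ℕ) (u : ℤ) : ℤ := if u < p then q else p

/-- The invariant of the partial depth-first search in the graph `E`: the vertices in `dead` are
deleted, as are the edges out of `u` before `pt u`. -/
structure DFSInv (p q : ℕ) (E : ℤ → ℤ → Prop) (tgt dead : ℤ → Prop) (pt : ℤ → ℤ) : Prop where
  dead_closed : ∀ u v : ℤ, 0 ≤ u → u < p + q → 0 ≤ v → v < p + q → dead u → E u v → dead v
  dead_tgt : ∀ a : ℤ, 0 ≤ a → a < p → dead a → ¬ tgt a
  ptr_nonneg : ∀ u : ℤ, 0 ≤ u → u < p + q → 0 ≤ pt u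
  ptr_le : ∀ u : ℤ, 0 ≤ u → u < p + q → pt u ≤ nbrCount p q u
  scanned : ∀ u i : ℤ, 0 ≤ u → u < p + q → 0 ≤ i → i < pt u → E u (nbr p u i) → dead (nbr p u i)

/-- The marked vertices outside the current path. -/
def Dead (mk pa : ℤ → ℤ) (tp v : ℤ) : Prop := mk v ≠ 0 ∧ ∀ j : ℤ, 0 ≤ j → j ≤ tp → pa j ≠ v

theorem Dead.mono {mk pa : ℤ → ℤ} {tp tp' v : ℤ} (h : Dead mk pa tp v) (htp : tp' ≤ tp) :
    Dead mk pa tp' v :=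
  ⟨h.1, fun j hj0 hj => h.2 j hj0 (hj.trans htp)⟩

/-- The current path consists of marked vertices and starts at `st`. -/
structure PathInv (p q : ℕ) (E : ℤ → ℤ → Prop) (st : ℤ) (mk pa : ℤ → ℤ) (tp : ℤ) : Prop where
  top_ge : -1 ≤ tp
  mem : ∀ j : ℤ, 0 ≤ j → j ≤ tp → 0 ≤ pa j ∧ pa j < p + q ∧ mk (pa j) ≠ 0
  edge : ∀ j : ℤ, 0 ≤ j → j < tp → E (pa j) (pa (j + 1))
  start : 0 ≤ tp → pa 0 = st
  mark_start : mk st ≠ 0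

/-- A bound for the work that is left in the depth-first search. -/
noncomputable def dfsWork (p q : ℕ) (mk pt : ℤ → ℤ) : ℤ :=
  ∑ u ∈ Finset.Ico (0 : ℤ) (p + q), (p + q - pt u + if mk u = 0 then 4 else 0)

theorem sum_eq_of_eq_off {ι M : Type*} [DecidableEq ι] [AddCommGroup M] {s : Finset ι} {u : ι}
    {f f' : ι → M} (hu : u ∈ s) (h : ∀ v ∈ s, v ≠ u → f' v = f v) :
    ∑ v ∈ s, f' v = ∑ v ∈ s, f v - f u + f' u := by
  rw [← Finset.add_sum_erase s f hu, ← Finset.add_sum_erase s f' hu,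
    Finset.sum_congr rfl fun v hv => h v (Finset.mem_of_mem_erase hv) (Finset.ne_of_mem_erase hv)]
  abel

/-! ### Moves of the depth-first search: push, advance, pop. -/

section

variable {p q : ℕ} {E : ℤ → ℤ → Prop} {tgt dead : ℤ → Prop} {st tp w : ℤ} {mk pt pa : ℤ → ℤ}

theorem DFSInv.congr {dead' : ℤ → Prop} (h : DFSInv p q E tgt dead pt)
    (hd : ∀ v, dead' v ↔ dead v) : DFSInv p q E tgt dead' pt := by
  rwa [show dead' = dead from funext fun v => propext (hd v)]

theorem DFSInv.work_nonneg (h : DFSInv p q E tgt dead pt) : 0 ≤ dfsWork p q mk pt := by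
  refine Finset.sum_nonneg fun u hu => ?_
  rw [Finset.mem_Ico] at hu
  have := h.ptr_le u hu.1 hu.2
  rw [nbrCount] at this
  split_ifs at * <;> omega

theorem dfsWork_mark (hw0 : 0 ≤ w) (hw : w < p + q) (hmk : mk w = 0) :
    dfsWork p q (Function.update mk w 1) pt = dfsWork p q mk pt - 4 := by
  rw [dfsWork, dfsWork, sum_eq_of_eq_off (u := w) (by simp [hw0, hw]) fun v _ hv => by
    rw [Function.update_of_ne hv]]
  simp [hmk]
  ring

theorem dfsWork_ptr (hw0 : 0 ≤ w) (hw : w < p + q) :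
    dfsWork p q mk (Function.update pt w (pt w + 1)) = dfsWork p q mk pt - 1 := by
  rw [dfsWork, dfsWork, sum_eq_of_eq_off (u := w) (by simp [hw0, hw]) fun v _ hv => by
    rw [Function.update_of_ne hv]]
  simp
  ring

theorem PathInv.rank_lt (h : PathInv p q E st mk pa tp) {r : ℤ → ℤ}
    (hr : ∀ u v : ℤ, 0 ≤ u → u < p + q → 0 ≤ v → v < p + q → E u v → r v < r u) {i j : ℤ}
    (hi : 0 ≤ i) (hij : i < j) (hj : j ≤ tp) : r (pa j) < r (pa i) := by
  obtain ⟨k, rfl⟩ : ∃ k : ℕ, j = i + 1 + k := ⟨(j - i - 1).toNat, by omega⟩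
  clear hij
  induction k with
  | zero =>
    have h1 := h.mem i hi (by omega)
    have h2 := h.mem (i + 1) (by omega) (by omega)
    simpa using hr _ _ h1.1 h1.2.1 h2.1 h2.2.1 (h.edge i hi (by omega))
  | succ k ih =>
    have h1 := h.mem (i + 1 + k) (by omega) (by push_cast at hj; omega)
    have h2 := h.mem (i + 1 + k + 1) (by omega) (by push_cast at hj; omega)
    have h3 := hr _ _ h1.1 h1.2.1 h2.1 h2.2.1 (h.edge (i + 1 + k) (by omega)
      (by push_cast at hj; omega))
    have h4 := ih (by push_cast at hj; omega)
    push_cast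
    rw [← add_assoc]
    omega

/-- The rank drops strictly along the path, so no vertex repeats. An augmentation therefore changes
every entry of the plan at most once. -/
theorem PathInv.injective (h : PathInv p q E st mk pa tp) {r : ℤ → ℤ}
    (hr : ∀ u v : ℤ, 0 ≤ u → u < p + q → 0 ≤ v → v < p + q → E u v → r v < r u) {i j : ℤ}
    (hi : 0 ≤ i) (hit : i ≤ tp) (hj : 0 ≤ j) (hjt : j ≤ tp) (hij : pa i = pa j) : i = j := by
  rcases lt_trichotomy i j with h1 | h1 | h1
  · have := h.rank_lt hr hi h1 hjt
    rw [hij] at this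
    omega
  · exact h1
  · have := h.rank_lt hr hj h1 hit
    rw [hij] at this
    omega

theorem PathInv.push (h : PathInv p q E st mk pa tp) (htp : 0 ≤ tp) (hw0 : 0 ≤ w)
    (hw : w < p + q) (hE : E (pa tp) w) :
    PathInv p q E st (Function.update mk w 1) (Function.update pa (tp + 1) w) (tp + 1) := by
  refine ⟨by omega, fun j hj0 hj => ?_, fun j hj0 hj => ?_, fun _ => ?_, ?_⟩
  · rcases eq_or_ne j (tp + 1) with rfl | hjt
    · simp [hw0, hw]
    · obtain ⟨h1, h2, h3⟩ := h.mem j hj0 (by omega)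
      rw [Function.update_of_ne hjt]
      refine ⟨h1, h2, ?_⟩
      rw [Function.update_apply]
      split_ifs <;> simp [h3]
  · rw [Function.update_of_ne (by omega : j ≠ tp + 1)]
    rcases eq_or_ne j tp with rfl | hjt
    · simpa using hE
    · rw [Function.update_of_ne (by omega)]
      exact h.edge j hj0 (by omega)
  · rw [Function.update_of_ne (by omega)]
    exact h.start htp
  · have := h.mark_start
    rw [Function.update_apply]
    split_ifs <;> simp [this]

/-- The pushed vertex becomes marked and joins the path at the same time, and it was not dead before
because it was unmarked. -/
theorem dead_push (htp : -1 ≤ tp) (hmk : mk w = 0) (v : ℤ) :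
    Dead (Function.update mk w 1) (Function.update pa (tp + 1) w) (tp + 1) v ↔ Dead mk pa tp v := by
  constructor
  · rintro ⟨h1, h2⟩
    have hvw : v ≠ w := by
      rintro rfl
      exact h2 (tp + 1) (by omega) le_rfl (by simp)
    refine ⟨by rwa [Function.update_of_ne hvw] at h1, fun j hj0 hj => ?_⟩
    have := h2 j hj0 (by omega)
    rwa [Function.update_of_ne (by omega)] at this
  · rintro ⟨h1, h2⟩
    have hvw : v ≠ w := by
      rintro rfl
      exact h1 hmk
    refine ⟨by rwa [Function.update_of_ne hvw], fun j hj0 hj => ?_⟩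
    rcases eq_or_ne j (tp + 1) with rfl | hjt
    · simpa using hvw.symm
    · rw [Function.update_of_ne hjt]
      exact h2 j hj0 (by omega)

theorem PathInv.pop (h : PathInv p q E st mk pa tp) (htp : 0 ≤ tp) :
    PathInv p q E st mk pa (tp - 1) :=
  ⟨by omega, fun j hj0 hj => h.mem j hj0 (by omega), fun j hj0 hj => h.edge j hj0 (by omega),
    fun h0 => h.start (by omega), h.mark_start⟩

/-- A skipped candidate is either not a successor or a marked one. In the second case it cannot lie
on the current path, since its rank is below that of the top and all path vertices have at least the
rank of the top. So it is dead, as `scanned` requires. -/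
theorem DFSInv.advance (h : DFSInv p q E tgt (Dead mk pa tp) pt)
    (hP : PathInv p q E st mk pa tp) {r : ℤ → ℤ}
    (hr : ∀ u v : ℤ, 0 ≤ u → u < p + q → 0 ≤ v → v < p + q → E u v → r v < r u) (htp : 0 ≤ tp)
    (hlt : pt (pa tp) < nbrCount p q (pa tp))
    (hE : ¬ (E (pa tp) (nbr p (pa tp) (pt (pa tp))) ∧ mk (nbr p (pa tp) (pt (pa tp))) = 0)) :
    DFSInv p q E tgt (Dead mk pa tp) (Function.update pt (pa tp) (pt (pa tp) + 1)) := by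
  obtain ⟨hu0, hu, hmu⟩ := hP.mem tp htp le_rfl
  refine ⟨h.dead_closed, h.dead_tgt, fun v hv0 hv => ?_, fun v hv0 hv => ?_,
    fun v i hv0 hv hi0 hi hEv => ?_⟩
  · rw [Function.update_apply]
    have := h.ptr_nonneg (pa tp) hu0 hu
    have := h.ptr_nonneg v hv0 hv
    split_ifs <;> omega
  · rcases eq_or_ne v (pa tp) with rfl | hvu
    · simp only [Function.update_self]
      omega
    · rw [Function.update_of_ne hvu]
      exact h.ptr_le v hv0 hv
  · rcases eq_or_ne v (pa tp) with rfl | hvu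
    · rw [Function.update_self] at hi
      rcases eq_or_ne i (pt (pa tp)) with rfl | hip
      · have hm : mk (nbr p (pa tp) (pt (pa tp))) ≠ 0 := fun hm => hE ⟨hEv, hm⟩
        refine ⟨hm, fun j hj0 hj hje => ?_⟩
        obtain ⟨hj1, hj2, -⟩ := hP.mem j hj0 hj
        have h1 := hr _ _ hu0 hu hj1 hj2 (hje ▸ hEv)
        rcases eq_or_ne j tp with rfl | hjt
        · omega
        · have := hP.rank_lt hr hj0 (lt_of_le_of_ne hj hjt) le_rfl
          omega
      · exact h.scanned (pa tp) i hu0 hu hi0 (by omega) hEv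
    · rw [Function.update_of_ne hvu] at hi
      exact h.scanned v i hv0 hv hi0 hi hEv

/-- When the pointer has reached the end, all successors of the top are dead. The graph being
bipartite, the candidates exhaust the successors. So the top can join the dead vertices without
breaking closure. -/
theorem DFSInv.pop (h : DFSInv p q E tgt (Dead mk pa tp) pt)
    (hE : ∀ u v : ℤ, E u v → (u < p ↔ p ≤ v))
    (htp : 0 ≤ tp) (htgt : pa tp < p → ¬ tgt (pa tp)) (hlt : ¬ pt (pa tp) < nbrCount p q (pa tp))
    (hu0 : 0 ≤ pa tp) (hu : pa tp < p + q) :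
    DFSInv p q E tgt (Dead mk pa (tp - 1)) pt := by
  have h1 : ∀ v, Dead mk pa (tp - 1) v → Dead mk pa tp v ∨ v = pa tp := by
    rintro v ⟨hv1, hv2⟩
    by_cases hv : v = pa tp
    · exact Or.inr hv
    · refine Or.inl ⟨hv1, fun j hj0 hj => ?_⟩
      rcases eq_or_ne j tp with rfl | hjt
      · exact fun h => hv h.symm
      · exact hv2 j hj0 (by omega)
  have h2 : ∀ v, Dead mk pa tp v → Dead mk pa (tp - 1) v :=
    fun v hv => ⟨hv.1, fun j hj0 hj => hv.2 j hj0 (by omega)⟩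
  refine ⟨fun u v hu0' hu' hv0 hv hud hEv => h2 v ?_, fun a ha0 ha had => ?_, h.ptr_nonneg,
    h.ptr_le, fun u i hu0' hu' hi0 hi hEv => h2 _ (h.scanned u i hu0' hu' hi0 hi hEv)⟩
  · rcases h1 u hud with hud | rfl
    · exact h.dead_closed u v hu0' hu' hv0 hv hud hEv
    · have hbi := hE _ _ hEv
      rw [nbrCount] at hlt
      by_cases hup : pa tp < p
      · rw [if_pos hup] at hlt
        have h3 : nbr p (pa tp) (v - p) = v := by simp [nbr, hup]
        have := h.scanned (pa tp) (v - p) hu0 hu (by omega) (by omega)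
        rw [h3] at this
        exact this hEv
      · rw [if_neg hup] at hlt
        have h3 : nbr p (pa tp) v = v := by simp [nbr, hup]
        have := h.scanned (pa tp) v hu0 hu (by omega) (by omega)
        rw [h3] at this
        exact this hEv
  · rcases h1 a had with had | rfl
    · exact h.dead_tgt a ha0 ha had
    · exact htgt ha

end

/-- The admissible graph. -/
def Adm (p : ℕ) (db sb : ℤ → ℤ) (cb fl : ℤ → ℤ → ℤ) (y : ℤ → ℤ) (u v : ℤ) : Prop :=
  Res p db sb fl u v ∧ Slk p cb y u v = 0

theorem Adm.bipartite {p : ℕ} {db sb : ℤ → ℤ} {cb fl : ℤ → ℤ → ℤ} {y : ℤ → ℤ} {u v : ℤ}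
    (h : Adm p db sb cb fl y u v) : u < p ↔ p ≤ v := by
  rcases h.1 with h | h <;> omega

/-- The time is charged to the drop of `dfsWork`, less a charge for each vertex left on the path.
The surplus of 100 pays for the test that follows the search. A failing search leaves an empty path,
so its marked vertices are exactly the dead ones. -/
theorem search_spec {s : Store} {p q : ℕ} (hp : s.ireg nA = p) (hq : s.ireg nB = q)
    {E : ℤ → ℤ → Prop} {tgt : ℤ → Prop}
    (hE : E = Adm p (s.ivec dbar) (s.ivec sbar) (s.imat cbar) (s.imat flow) (s.ivec y))
    (htgt : tgt = fun a => s.ivec recv a < s.ivec dbar a)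
    {r : ℤ → ℤ}
    (hr : ∀ u v : ℤ, 0 ≤ u → u < p + q → 0 ≤ v → v < p + q → E u v → r v < r u)
    (hD : DFSInv p q E tgt (fun v => s.ivec mark v ≠ 0) (s.ivec ptr))
    (hst0 : 0 ≤ s.ireg start) (hst : s.ireg start < q) (hmk : s.ivec mark (p + s.ireg start) = 0) :
    WP search s fun s' t =>
      t + 100 * (dfsWork p q (s'.ivec mark) (s'.ivec ptr) + (s'.ireg top + 1)) + 100 ≤
        100 * dfsWork p q (s.ivec mark) (s.ivec ptr) ∧
      DFSInv p q E tgt (Dead (s'.ivec mark) (s'.ivec path) (s'.ireg top)) (s'.ivec ptr) ∧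
      PathInv p q E (p + s.ireg start) (s'.ivec mark) (s'.ivec path) (s'.ireg top) ∧
      (∀ v, s.ivec mark v ≠ 0 → Dead (s'.ivec mark) (s'.ivec path) (s'.ireg top) v) ∧
      ((s'.ireg found = 0 ∧ s'.ireg top = -1) ∨
        (s'.ireg found = 1 ∧ 0 ≤ s'.ireg top ∧ s'.ivec path (s'.ireg top) < p ∧
          tgt (s'.ivec path (s'.ireg top)))) := by
  have hD' : DFSInv p q E tgt (Dead (s.ivec mark) (s.ivec path) (-1)) (s.ivec ptr) :=
    hD.congr fun v => ⟨fun h => h.1, fun h => ⟨h, fun j hj0 hj => by omega⟩⟩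
  have hD1 := hD'.congr (dead_push (pa := s.ivec path) (le_refl (-1)) hmk)
  have hw1 := dfsWork_mark (p := p) (q := q) (pt := s.ivec ptr) (by omega) (by omega) hmk
  have hw0 := hD1.work_nonneg (mk := Function.update (s.ivec mark) (p + s.ireg start) 1)
  obtain ⟨W, hW⟩ := Int.eq_ofNat_of_zero_le hw0
  unfold search push
  simp only [WP_seq, WP_iset, WP_ivset, IExp.eval_sub', IExp.eval_zero, IExp.eval_one,
    IExp.eval_add', IExp.eval_reg, Store.setIReg_ireg, Store.setIVec_ireg, reduceCtorEq, if_true, if_false, hp]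
  -- Every round lowers `dfsWork + (top + 1) + [found = 0]` by at least one, which is worth 100
  -- steps: a push gains 4 from the new mark and pays 1 for the path, an advance gains 1 from the
  -- pointer, a pop 1 from the path, and the discovery of a target 1 from the indicator. Marking the
  -- start gains 4 units; two of them are the credit for its path entry and the indicator, the other
  -- two pay for the commands around the loop and the surplus.
  refine (WP_loop (fun n s' =>
      DFSInv p q E tgt (Dead (s'.ivec mark) (s'.ivec path) (s'.ireg top)) (s'.ivec ptr) ∧
      PathInv p q E (p + s.ireg start) (s'.ivec mark) (s'.ivec path) (s'.ireg top) ∧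
      (∀ v, s.ivec mark v ≠ 0 → Dead (s'.ivec mark) (s'.ivec path) (s'.ireg top) v) ∧
      (s'.ireg found = 0 ∨
        (s'.ireg found = 1 ∧ 0 ≤ s'.ireg top ∧ s'.ivec path (s'.ireg top) < p ∧
          tgt (s'.ivec path (s'.ireg top)))) ∧
      100 * (dfsWork p q (s'.ivec mark) (s'.ivec ptr) + (s'.ireg top + 1) +
        if s'.ireg found = 0 then 1 else 0) ≤ n) (100 * (W + 2)) ⟨?_, ?_, ?_, ?_, ?_⟩ ?_).mono ?_
  · simpa [hp] using hD1
  · simp only [Store.setIVec_ireg, Store.setIReg_ireg, if_true]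
    simp
    refine ⟨by simp, fun j hj0 hj => ?_, fun j hj0 hj => by omega, fun _ => by simp, by simp⟩
    obtain rfl : j = 0 := by omega
    simp
    omega
  · intro v hv
    have h := (dead_push (pa := s.ivec path) (le_refl (-1)) hmk v).2
      ⟨hv, fun j hj0 hj => by omega⟩
    simpa using h
  · simp
  · simp [hW]
  · rintro n s₁ hk₁ ⟨hI, hP, hM, hf, hn⟩ hB
    simp only [BExp.holds_and, BExp.holds_ilt, BExp.holds_ieq, IExp.eval_sub', IExp.eval_zero,
      IExp.eval_one, IExp.eval_reg] at hB
    obtain ⟨hf0, htop⟩ := hB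
    have hA : s₁.ireg nA = p := by
      rw [hk₁.ireg nA rfl]
      simp [hp]
    have hB : s₁.ireg nB = q := by
      rw [hk₁.ireg nB rfl]
      simp [hq]
    have h1 : s₁.ivec recv = s.ivec recv := hk₁.ivec recv rfl
    have h2 : s₁.ivec dbar = s.ivec dbar := hk₁.ivec dbar rfl
    have h3 : s₁.ivec sbar = s.ivec sbar := hk₁.ivec sbar rfl
    have h4 : s₁.ivec y = s.ivec y := hk₁.ivec y rfl
    have h5 : s₁.imat flow = s.imat flow := hk₁.imat flow rfl
    have h6 : s₁.imat cbar = s.imat cbar := hk₁.imat cbar rfl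
    clear hk₁ hf hD hD' hD1
    rw [if_pos hf0] at hn
    obtain ⟨hu0, hu, hmu⟩ := hP.mem _ (by omega : 0 ≤ s₁.ireg top) le_rfl
    have hWn := hI.work_nonneg (mk := s₁.ivec mark)
    have hpt0 := hI.ptr_nonneg _ hu0 hu
    have hadv := hI.advance hP hr (by omega)
    have hpop := hI.pop (fun u v h => by rw [hE] at h; exact h.bipartite) (by omega)
    have hpush := fun w => hP.push (w := w) (by omega : 0 ≤ s₁.ireg top)
    have hpushD := fun (w : ℤ) (hw : s₁.ivec mark w = 0) =>
      hI.congr (dead_push (pa := s₁.ivec path) hP.top_ge hw)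
    have hwpush := fun w => dfsWork_mark (p := p) (q := q) (mk := s₁.ivec mark)
      (pt := s₁.ivec ptr) (w := w)
    have hwptr := dfsWork_ptr (mk := s₁.ivec mark) (pt := s₁.ivec ptr) hu0 hu
    refine WP_seq.2 (WP_iset.2 ?_)
    simp only [IExp.eval_vec, IExp.eval_reg]
    generalize hx : s₁.ivec path (s₁.ireg top) = x at *
    simp only [WP_ite, WP_seq, WP_iset, WP_ivset, BExp.holds_and, BExp.holds_ilt, BExp.holds_ieq,
      freeDemand, capBwd, capFwd, slackBwd, slackFwd,
      IExp.eval_vec, IExp.eval_mat, IExp.eval_reg, IExp.eval_zero, IExp.eval_one, IExp.eval_sub',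
      IExp.eval_add', IExp.eval_min', Store.setIReg_ireg, Store.setIVec_ireg, Store.setIReg_ivec,
      Store.setIVec_ivec, Store.setIReg_imat,
      reduceCtorEq, if_true, if_false, hA, hB, h1, h2, h3, h4, h5, h6]
    have hn100 : 100 ≤ n := by omega
    have hEx : ∀ v, E x v ↔ Adm p (s.ivec dbar) (s.ivec sbar) (s.imat cbar) (s.imat flow)
      (s.ivec y) x v := fun v => by rw [hE]
    refine ⟨fun hxp => ?_, fun hxp => ?_⟩
    · have hnb : nbr p x (s₁.ivec ptr x) = p + s₁.ivec ptr x := if_pos hxp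
      have hnc : nbrCount p q x = q := if_pos hxp
      have hEw : E x (p + s₁.ivec ptr x) ↔ 0 < s.imat flow x (s₁.ivec ptr x) ∧
          s.ivec y x + s.ivec y (p + s₁.ivec ptr x) - s.imat cbar x (s₁.ivec ptr x) = 0 := by
        rw [hEx, Adm, Res, Slk, if_pos hxp, add_sub_cancel_left]
        constructor
        · rintro ⟨h | h, h'⟩
          · exact ⟨h.2.2, h'⟩
          · omega
        · exact fun h => ⟨Or.inl ⟨hxp, by omega, h.1⟩, h.2⟩
      rw [hnb, hnc, hEw] at hadv
      rw [hnc] at hpop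
      refine ⟨fun htg => ⟨n - 100, by simp; omega, hI, hP, hM, ?_, ?_⟩,
        fun htg => ⟨fun hlt => ⟨fun hc => ?_, fun hc => ?_⟩, fun hlt => ?_⟩⟩
      · rw [hx, htgt]
        exact Or.inr ⟨trivial, by omega, hxp, htg⟩
      · rw [if_neg (by omega)]
        omega
      · have hw := hwpush (p + s₁.ivec ptr x) (by omega) (by omega) hc.2.2
        refine ⟨n - 100, by simp; omega, hpushD _ hc.2.2,
          hpush _ (by omega) (by omega) (hEw.2 ⟨hc.1, hc.2.1⟩),
          fun v hv => (dead_push hP.top_ge hc.2.2 v).2 (hM v hv), Or.inl hf0, ?_⟩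
        rw [if_pos hf0]
        omega
      · refine ⟨n - 100, by simp; omega, hadv hlt fun h => hc ⟨h.1.1, h.1.2, h.2⟩, hP,
          hM, Or.inl hf0, ?_⟩
        rw [if_pos hf0]
        omega
      · refine ⟨n - 100, by simp; omega, hpop (fun _ => by rw [htgt]; exact htg) hlt hu0 hu,
          hP.pop (by omega), fun v hv => (hM v hv).mono (by omega), Or.inl hf0, ?_⟩
        rw [if_pos hf0]
        omega
    · have hnb : nbr p x (s₁.ivec ptr x) = s₁.ivec ptr x := if_neg hxp
      have hnc : nbrCount p q x = p := if_neg hxp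
      have hEw : s₁.ivec ptr x < p → (E x (s₁.ivec ptr x) ↔
          0 < min (s.ivec dbar (s₁.ivec ptr x)) (s.ivec sbar (x - p)) -
            s.imat flow (s₁.ivec ptr x) (x - p) ∧
          s.imat cbar (s₁.ivec ptr x) (x - p) + 1 - s.ivec y (s₁.ivec ptr x) -
            s.ivec y (p + (x - p)) = 0) := by
        intro hlt
        rw [hEx, Adm, Res, Slk, if_neg hxp, add_sub_cancel]
        constructor
        · rintro ⟨h | h, h'⟩
          · omega
          · exact ⟨h.2.2, h'⟩
        · exact fun h => ⟨Or.inr ⟨by omega, hlt, h.1⟩, h.2⟩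
      rw [hnb, hnc] at hadv
      rw [hnc] at hpop
      refine ⟨fun hlt => ⟨fun hc => ?_, fun hc => ?_⟩, fun hlt => ?_⟩
      · have hw := hwpush (s₁.ivec ptr x) (by omega) (by omega) hc.2.2
        refine ⟨n - 100, by simp; omega, hpushD _ hc.2.2,
          hpush _ (by omega) (by omega) ((hEw hlt).2 ⟨hc.1, hc.2.1⟩),
          fun v hv => (dead_push hP.top_ge hc.2.2 v).2 (hM v hv), Or.inl hf0, ?_⟩
        rw [if_pos hf0]
        omega
      · refine ⟨n - 100, by simp; omega, hadv hlt fun h => hc ?_, hP, hM, Or.inl hf0, ?_⟩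
        · have := (hEw hlt).1 h.1
          exact ⟨this.1, this.2, h.2⟩
        · rw [if_pos hf0]
          omega
      · refine ⟨n - 100, by simp; omega, hpop (fun h => absurd h hxp) hlt hu0 hu,
          hP.pop (by omega), fun v hv => (hM v hv).mono (by omega), Or.inl hf0, ?_⟩
        rw [if_pos hf0]
        omega
  · rintro s₂ t₂ - ⟨n', hn', ⟨hI, hP, hM, hf, hn⟩, hB⟩
    simp only [BExp.holds_and, BExp.holds_ilt, BExp.holds_ieq, IExp.eval_sub', IExp.eval_zero,
      IExp.eval_one, IExp.eval_reg] at hB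
    have := hP.top_ge
    simp at hn' ⊢
    refine ⟨?_, hI, hP, hM, ?_⟩
    · split_ifs at hn <;> omega
    · rcases hf with hf | hf
      · exact Or.inl ⟨hf, by omega⟩
      · exact Or.inr hf

/-! ### Augmentation -/

/-! ### Row, column and weighted sums after a change of one entry. -/

section MatrixUpdate

variable {M : Type*} [CommRing M] {A B : Finset ℤ} {f : ℤ → ℤ → M} {a b : ℤ} {z : M}

theorem update_update_apply {N : Type*} (f : ℤ → ℤ → N) (a b : ℤ) (z : N) (i j : ℤ) :
    Function.update f a (Function.update (f a) b z) i j = if i = a ∧ j = b then z else f i j := by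
  rcases eq_or_ne i a with rfl | hi
  · simp [Function.update_apply]
  · simp [hi]

theorem sum_row_update (hb : b ∈ B) (i : ℤ) :
    ∑ j ∈ B, Function.update f a (Function.update (f a) b z) i j =
      ∑ j ∈ B, f i j + if i = a then z - f a b else 0 := by
  simp only [update_update_apply]
  rcases eq_or_ne i a with rfl | hi
  · rw [sum_eq_of_eq_off (f := fun j => f i j) hb fun j _ hj => by simp [hj]]
    simp
    ring
  · simp [hi]

theorem sum_col_update (ha : a ∈ A) (j : ℤ) :
    ∑ i ∈ A, Function.update f a (Function.update (f a) b z) i j =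
      ∑ i ∈ A, f i j + if j = b then z - f a b else 0 := by
  simp only [update_update_apply]
  rcases eq_or_ne j b with rfl | hj
  · rw [sum_eq_of_eq_off (f := fun i => f i j) ha fun i _ hi => by simp [hi]]
    simp
    ring
  · simp [hj]

theorem sum_sum_update (ha : a ∈ A) (hb : b ∈ B) (c : ℤ → ℤ → M) :
    ∑ i ∈ A, ∑ j ∈ B, Function.update f a (Function.update (f a) b z) i j * c i j =
      ∑ i ∈ A, ∑ j ∈ B, f i j * c i j + (z - f a b) * c a b := by
  have h : ∑ j ∈ B, (if j = b then z else f a j) * c a j =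
      ∑ j ∈ B, f a j * c a j - f a b * c a b + z * c a b := by
    rw [sum_eq_of_eq_off (f := fun j => f a j * c a j) hb fun j _ hj => by simp [hj]]
    simp
  simp only [update_update_apply]
  rw [sum_eq_of_eq_off (f := fun i => ∑ j ∈ B, f i j * c i j) ha fun i _ hi => by simp [hi]]
  simp only [true_and, h]
  ring

end MatrixUpdate

/-- The cost of an integral plan. -/
noncomputable def flowCost (p q : ℕ) (cb fl : ℤ → ℤ → ℤ) : ℤ :=
  ∑ a ∈ Finset.Ico (0 : ℤ) p, ∑ b ∈ Finset.Ico (0 : ℤ) q, fl a b * cb a b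

/-- The plan `fl'` arises from `fl` by sending `ρ` units along the first `k` edges of a path. -/
structure PartialAug (p q : ℕ) (cb fl : ℤ → ℤ → ℤ) (rc us y pa : ℤ → ℤ) (st ρ k : ℤ)
    (fl' : ℤ → ℤ → ℤ) : Prop where
  entry : ∀ a b : ℤ, fl' a b = fl a b ∨
    (∃ j : ℤ, 0 ≤ j ∧ j < k ∧ pa j = p + b ∧ pa (j + 1) = a ∧ fl' a b = fl a b + ρ) ∨
    ∃ j : ℤ, 0 ≤ j ∧ j < k ∧ pa j = a ∧ pa (j + 1) = p + b ∧ fl' a b = fl a b - ρ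
  row : ∀ a : ℤ, 0 ≤ a → a < p →
    ∑ b ∈ Finset.Ico (0 : ℤ) q, fl' a b = rc a + if pa k = a then ρ else 0
  col : ∀ b : ℤ, 0 ≤ b → b < q → ∑ a ∈ Finset.Ico (0 : ℤ) p, fl' a b =
    us b + (if b = st then ρ else 0) - if pa k = p + b then ρ else 0
  weight : 2 * flowCost p q cb fl' = 2 * flowCost p q cb fl +
    ρ * (2 * y (p + st) + (if pa k < p then 2 * y (pa k) - 1 else - 2 * y (pa k)) - k)

/-! ### Sending flow along an admissible path. -/

section

variable {p q : ℕ} {db sb : ℤ → ℤ} {cb fl fl' : ℤ → ℤ → ℤ} {rc us y pa mk : ℤ → ℤ}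
  {st tp ρ k : ℤ}

theorem PartialAug.init (h : Feasible p q db sb cb fl rc us y) (h0 : pa 0 = p + st)
    (hst : 0 ≤ st) : PartialAug p q cb fl rc us y pa st ρ 0 fl := by
  refine ⟨fun a b => Or.inl rfl, fun a ha0 ha => ?_, fun b hb0 hb => ?_, ?_⟩
  · rw [h.recv_eq a ha0 ha, if_neg (by omega), add_zero]
  · rw [h.used_eq b hb0 hb]
    split_ifs <;> omega
  · rw [if_neg (by omega), h0]
    ring

/-- A tight forward edge costs y(a) + y(b) - 1, and a tight backward edge saves y(a) + y(b). The
weights of inner vertices therefore cancel, and only every forward edge leaves a -1. Since forward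
and backward edges alternate, this is one half per edge up to parity, whence the doubled costs in
`weight`. -/
theorem PartialAug.step_forward (h : PartialAug p q cb fl rc us y pa st ρ k fl')
    (hinj : ∀ i j : ℤ, 0 ≤ i → i ≤ tp → 0 ≤ j → j ≤ tp → pa i = pa j → i = j)
    (hk0 : 0 ≤ k) (hk : k < tp) (hA : Adm p db sb cb fl y (pa k) (pa (k + 1)))
    (hu : p ≤ pa k) (hu' : pa k < p + q) (hv : 0 ≤ pa (k + 1)) :
    PartialAug p q cb fl rc us y pa st ρ (k + 1)
      (Function.update fl' (pa (k + 1)) (Function.update (fl' (pa (k + 1))) (pa k - p)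
        (fl' (pa (k + 1)) (pa k - p) + ρ))) := by
  have hv' : pa (k + 1) < p := by
    have := hA.bipartite
    omega
  have hs := hA.2
  rw [Slk, if_neg (by omega)] at hs
  have hma : pa (k + 1) ∈ Finset.Ico (0 : ℤ) p := by simp [hv, hv']
  have hmb : pa k - p ∈ Finset.Ico (0 : ℤ) q := by
    rw [Finset.mem_Ico]
    omega
  refine ⟨fun a b => ?_, fun a ha0 ha => ?_, fun b hb0 hb => ?_, ?_⟩
  · rw [update_update_apply]
    split_ifs with hab
    · obtain ⟨rfl, rfl⟩ := hab
      refine Or.inr (Or.inl ⟨k, hk0, by omega, by omega, rfl, ?_⟩)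
      -- If this entry had been changed by an earlier edge, the path would repeat a vertex.
      rcases h.entry (pa (k + 1)) (pa k - p) with h | ⟨j, hj0, hj, h1, h2, h3⟩ |
        ⟨j, hj0, hj, h1, h2, h3⟩
      · rw [h]
      · have := hinj j k hj0 (by omega) hk0 (by omega) (by omega)
        omega
      · have := hinj j (k + 1) hj0 (by omega) (by omega) (by omega) h1
        omega
    · rcases h.entry a b with h | ⟨j, hj0, hj, h1⟩ | ⟨j, hj0, hj, h1⟩
      · exact Or.inl h
      · exact Or.inr (Or.inl ⟨j, hj0, by omega, h1⟩)
      · exact Or.inr (Or.inr ⟨j, hj0, by omega, h1⟩)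
  · rw [sum_row_update hmb, h.row a ha0 ha]
    split_ifs <;> omega
  · rw [sum_col_update hma, h.col b hb0 hb]
    split_ifs <;> omega
  · have h1 := h.weight
    rw [flowCost] at h1 ⊢
    rw [sum_sum_update hma hmb, mul_add, h1, if_neg (by omega), if_pos hv']
    linear_combination (2 * ρ) * hs

theorem PartialAug.step_backward (h : PartialAug p q cb fl rc us y pa st ρ k fl')
    (hinj : ∀ i j : ℤ, 0 ≤ i → i ≤ tp → 0 ≤ j → j ≤ tp → pa i = pa j → i = j)
    (hk0 : 0 ≤ k) (hk : k < tp) (hA : Adm p db sb cb fl y (pa k) (pa (k + 1)))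
    (hu : pa k < p) (hu' : 0 ≤ pa k) (hv : pa (k + 1) < p + q) :
    PartialAug p q cb fl rc us y pa st ρ (k + 1)
      (Function.update fl' (pa k) (Function.update (fl' (pa k)) (pa (k + 1) - p)
        (fl' (pa k) (pa (k + 1) - p) - ρ))) := by
  have hv' : p ≤ pa (k + 1) := hA.bipartite.1 hu
  have hs := hA.2
  rw [Slk, if_pos hu] at hs
  have hma : pa k ∈ Finset.Ico (0 : ℤ) p := by simp [hu, hu']
  have hmb : pa (k + 1) - p ∈ Finset.Ico (0 : ℤ) q := by
    rw [Finset.mem_Ico]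
    omega
  refine ⟨fun a b => ?_, fun a ha0 ha => ?_, fun b hb0 hb => ?_, ?_⟩
  · rw [update_update_apply]
    split_ifs with hab
    · obtain ⟨rfl, rfl⟩ := hab
      refine Or.inr (Or.inr ⟨k, hk0, by omega, rfl, by omega, ?_⟩)
      rcases h.entry (pa k) (pa (k + 1) - p) with h | ⟨j, hj0, hj, h1, h2, h3⟩ |
        ⟨j, hj0, hj, h1, h2, h3⟩
      · rw [h]
      · have := hinj j (k + 1) hj0 (by omega) (by omega) (by omega) (by omega)
        omega
      · have := hinj j k hj0 (by omega) hk0 (by omega) h1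
        omega
    · rcases h.entry a b with h | ⟨j, hj0, hj, h1⟩ | ⟨j, hj0, hj, h1⟩
      · exact Or.inl h
      · exact Or.inr (Or.inl ⟨j, hj0, by omega, h1⟩)
      · exact Or.inr (Or.inr ⟨j, hj0, by omega, h1⟩)
  · rw [sum_row_update hmb, h.row a ha0 ha]
    split_ifs <;> omega
  · rw [sum_col_update hma, h.col b hb0 hb]
    split_ifs <;> omega
  · have h1 := h.weight
    rw [flowCost] at h1 ⊢
    rw [sum_sum_update hma hmb, mul_add, h1, if_pos hu, if_neg (by omega)]
    linear_combination (2 * ρ) * hs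

/-- The edges of the residual graph after an augmentation are old or have slack one. -/
theorem PartialAug.res (h : PartialAug p q cb fl rc us y pa st ρ tp fl') (hρ : 0 < ρ)
    (hA : ∀ j : ℤ, 0 ≤ j → j < tp → Adm p db sb cb fl y (pa j) (pa (j + 1))) {u v : ℤ}
    (hR : Res p db sb fl' u v) : Res p db sb fl u v ∨ Slk p cb y u v = 1 := by
  rcases hR with ⟨hu, hv, hR⟩ | ⟨hu, hv, hR⟩
  · rcases h.entry u (v - p) with h | ⟨j, hj0, hj, h1, h2, h3⟩ | ⟨j, hj0, hj, h1, h2, h3⟩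
    · exact Or.inl (Or.inl ⟨hu, hv, h ▸ hR⟩)
    · right
      -- A new backward edge reverses a tight forward one: y(a) + y(b) = c̄ + 1, so its slack is 1.
      have hs := (hA j hj0 hj).2
      rw [h1, h2, add_sub_cancel, Slk, if_neg (by omega)] at hs
      rw [Slk, if_pos hu]
      omega
    · exact Or.inl (Or.inl ⟨hu, hv, by omega⟩)
  · rcases h.entry v (u - p) with h | ⟨j, hj0, hj, h1, h2, h3⟩ | ⟨j, hj0, hj, h1, h2, h3⟩
    · exact Or.inl (Or.inr ⟨hu, hv, h ▸ hR⟩)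
    · exact Or.inl (Or.inr ⟨hu, hv, by omega⟩)
    · right
      -- A new forward edge reverses a tight backward one: y(a) + y(b) = c̄, so its slack is again
      -- 1.
      have hs := (hA j hj0 hj).2
      rw [h1, h2, add_sub_cancel, Slk, if_pos hv] at hs
      rw [Slk, if_neg (by omega)]
      omega

/-- By `PartialAug.res` every residual edge is old or has slack one. So slacks remain nonnegative,
no new edge is admissible, and the old rank still certifies acyclicity. -/
theorem PartialAug.feasible (h : PartialAug p q cb fl rc us y pa st ρ tp fl')
    (hF : Feasible p q db sb cb fl rc us y) (hρ : 0 < ρ)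
    (hA : ∀ j : ℤ, 0 ≤ j → j < tp → Adm p db sb cb fl y (pa j) (pa (j + 1)))
    (hback : ∀ j : ℤ, 0 ≤ j → j < tp → pa j < p → ρ ≤ fl (pa j) (pa (j + 1) - p))
    (hρs : ρ ≤ sb st - us st) (hρt : ρ ≤ db (pa tp) - rc (pa tp)) (ht : pa tp < p) :
    Feasible p q db sb cb fl' (Function.update rc (pa tp) (rc (pa tp) + ρ))
      (Function.update us st (us st + ρ)) y := by
  have hres := fun u v => h.res (u := u) (v := v) hρ hA
  refine ⟨fun a b ha0 ha hb0 hb => ?_, fun a ha0 ha => ?_, fun b hb0 hb => ?_, fun a ha0 ha => ?_,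
    fun b hb0 hb => ?_, fun u v hu0 hu hv0 hv hR => ?_, hF.dual_supply, hF.dual_demand,
    fun a ha0 ha hfa => ?_, ?_⟩
  · have := hF.flow_nonneg a b ha0 ha hb0 hb
    rcases h.entry a b with h | ⟨j, hj0, hj, h1, h2, h3⟩ | ⟨j, hj0, hj, h1, h2, h3⟩
    · omega
    · omega
    · have := hback j hj0 hj (by omega)
      rw [h1, h2, add_sub_cancel_left] at this
      omega
  · rw [h.row a ha0 ha, Function.update_apply]
    split_ifs with h1 h2 h2
    · rw [h1]
    · exact absurd h1.symm h2
    · exact absurd h2.symm h1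
    · simp
  · rw [h.col b hb0 hb, Function.update_apply, if_neg (by omega : pa tp ≠ p + b)]
    split_ifs with h1
    · rw [h1]; simp
    · simp
  · have := hF.recv_le a ha0 ha
    rw [Function.update_apply]
    split_ifs with h1
    · rw [h1]; omega
    · exact this
  · have := hF.used_le b hb0 hb
    rw [Function.update_apply]
    split_ifs with h1
    · rw [h1]; omega
    · exact this
  · rcases hres u v hR with h1 | h1
    · exact hF.slack_nonneg u v hu0 hu hv0 hv h1
    · omega
  · refine hF.dual_free a ha0 ha ?_
    rw [Function.update_apply] at hfa
    split_ifs at hfa with h1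
    · rw [h1] at *
      omega
    · exact hfa
  · obtain ⟨r, hr⟩ := hF.acyclic
    refine ⟨r, fun u v hu0 hu hv0 hv hR hS => ?_⟩
    rcases hres u v hR with h1 | h1
    · exact hr u v hu0 hu hv0 hv h1 hS
    · omega

end

/-- The bottleneck is positive because admissible edges have positive residual capacity. Only the
bounds at the two ends and on the backward edges are recorded: upper bounds on single entries follow
from the row and column bounds, so feasibility does not need the forward capacities. -/
theorem augment_bottleneck {s : Store} {p : ℕ} (hp : s.ireg nA = p)
    (hA : ∀ j : ℤ, 0 ≤ j → j < s.ireg top → Adm p (s.ivec dbar) (s.ivec sbar) (s.imat cbar)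
      (s.imat flow) (s.ivec y) (s.ivec path j) (s.ivec path (j + 1)))
    (hs : s.ivec used (s.ireg start) < s.ivec sbar (s.ireg start)) (htop : 0 ≤ s.ireg top)
    (ht : s.ivec recv (s.ivec path (s.ireg top)) < s.ivec dbar (s.ivec path (s.ireg top))) :
    WP (r.set (min (sbar start - used start) (dbar (path top) - recv (path top))) ;;
      forTo k top
        (.ite (path k ≺ nA)
          (r.set (min r (capBwd (path k) (path (k + 1) - nA))))
          (r.set (min r (capFwd (path (k + 1)) (path k - nA)))))) s
      fun s' t => t ≤ 50 * s.ireg top + 30 ∧ 0 < s'.ireg r ∧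
        s'.ireg r ≤ s.ivec sbar (s.ireg start) - s.ivec used (s.ireg start) ∧
        s'.ireg r ≤ s.ivec dbar (s.ivec path (s.ireg top)) -
          s.ivec recv (s.ivec path (s.ireg top)) ∧
        ∀ j : ℤ, 0 ≤ j → j < s.ireg top → s.ivec path j < p →
          s'.ireg r ≤ s.imat flow (s.ivec path j) (s.ivec path (j + 1) - p) := by
  obtain ⟨N, hN⟩ : ∃ N : ℕ, (N : ℤ) = s.ireg top := ⟨_, Int.toNat_of_nonneg htop⟩
  refine WP_seq.2 (WP_iset.2 ((WP_forTo N 40 (fun i s' => 0 < s'.ireg r ∧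
        s'.ireg r ≤ s.ivec sbar (s.ireg start) - s.ivec used (s.ireg start) ∧
        s'.ireg r ≤ s.ivec dbar (s.ivec path (s.ireg top)) -
          s.ivec recv (s.ivec path (s.ireg top)) ∧
        ∀ j : ℤ, 0 ≤ j → j < i → s.ivec path j < p →
          s'.ireg r ≤ s.imat flow (s.ivec path j) (s.ivec path (j + 1) - p)) rfl ?_ ?_ ?_).mono ?_))
  · intro s' hk
    have := hk.ireg top rfl
    simp only [Store.setIReg_ireg, reduceCtorEq, if_false] at this
    simp [this, hN]
  · simp only [Store.setIReg_ireg, reduceCtorEq, if_false, if_true, IExp.eval_min', IExp.eval_sub',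
      IExp.eval_vec, IExp.eval_reg]
    refine ⟨by omega, by omega, by omega, fun j h0 h1 => by omega⟩
  · rintro i s' hk hi0 hiN hi ⟨h1, h2, h3, h4⟩
    have e1 : s'.ivec path = s.ivec path := hk.ivec path rfl
    have e2 : s'.imat flow = s.imat flow := hk.imat flow rfl
    have e3 : s'.ivec dbar = s.ivec dbar := hk.ivec dbar rfl
    have e4 : s'.ivec sbar = s.ivec sbar := hk.ivec sbar rfl
    have e5 : s'.ireg nA = p := by
      have := hk.ireg nA rfl
      simp only [Store.setIReg_ireg, reduceCtorEq, if_false] at this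
      rw [this, hp]
    have hAi := (hA i hi0 (by omega)).1
    simp only [WP_ite, WP_iset, capBwd, capFwd, BExp.holds_ilt, IExp.eval_min', IExp.eval_sub',
      IExp.eval_add', IExp.eval_one, IExp.eval_mat,
      IExp.eval_vec, IExp.eval_reg, e1, e2, e3, e4, e5, hi, Store.setIReg_ireg, reduceCtorEq,
      if_true, if_false]
    refine ⟨fun hc => ⟨by simp, ?_, by omega, by omega, fun j hj0 hj hjp => ?_⟩,
      fun hc => ⟨by simp, ?_, by omega, by omega, fun j hj0 hj hjp => ?_⟩⟩
    · rcases hAi with h | h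
      · exact lt_min h1 h.2.2
      · omega
    · rcases eq_or_ne j i with rfl | hji
      · exact min_le_right _ _
      · exact (min_le_left _ _).trans (h4 j hj0 (by omega) hjp)
    · rcases hAi with h | h
      · omega
      · exact lt_min h1 h.2.2
    · rcases eq_or_ne j i with rfl | hji
      · omega
      · exact (min_le_left _ _).trans (h4 j hj0 (by omega) hjp)
  · rintro s' t - ⟨ht, h⟩
    rw [hN] at h
    refine ⟨?_, h⟩
    simp at ht ⊢
    omega

theorem augment_flow {s : Store} {p q : ℕ} (hp : s.ireg nA = p)
    (hF : Feasible p q (s.ivec dbar) (s.ivec sbar) (s.imat cbar) (s.imat flow) (s.ivec recv)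
      (s.ivec used) (s.ivec y))
    (hP : PathInv p q (Adm p (s.ivec dbar) (s.ivec sbar) (s.imat cbar) (s.imat flow) (s.ivec y))
      (p + s.ireg start) (s.ivec mark) (s.ivec path) (s.ireg top))
    (hst : 0 ≤ s.ireg start) (htop : 0 ≤ s.ireg top) :
    WP (forTo k top
        (.ite (path k ≺ nA)
          (flow.set (path k) (path (k + 1) - nA) (flow (path k) (path (k + 1) - nA) - r))
          (flow.set (path (k + 1)) (path k - nA) (flow (path (k + 1)) (path k - nA) + r)))) s
      fun s' t => t ≤ 50 * s.ireg top + 10 ∧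
        PartialAug p q (s.imat cbar) (s.imat flow) (s.ivec recv) (s.ivec used) (s.ivec y)
          (s.ivec path) (s.ireg start) (s.ireg r) (s.ireg top) (s'.imat flow) := by
  obtain ⟨N, hN⟩ : ∃ N : ℕ, (N : ℤ) = s.ireg top := ⟨_, Int.toNat_of_nonneg htop⟩
  obtain ⟨rk, hrk⟩ := hF.acyclic
  have hinj := fun i j hi hit hj hjt => hP.injective
    (fun u v hu0 hu hv0 hv h => hrk u v hu0 hu hv0 hv h.1 h.2) (i := i) (j := j) hi hit hj hjt
  refine (WP_forTo N 40 (fun i s' => PartialAug p q (s.imat cbar) (s.imat flow) (s.ivec recv)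
    (s.ivec used) (s.ivec y) (s.ivec path) (s.ireg start) (s.ireg r) i (s'.imat flow))
      rfl ?_ ?_ ?_).mono ?_
  · intro s' hk
    simp [hk.ireg top rfl, hN]
  · exact PartialAug.init hF (hP.start htop) hst
  · intro i s' hk hi0 hiN hi hI
    have e1 : s'.ivec path = s.ivec path := hk.ivec path rfl
    have e2 : s'.ireg r = s.ireg r := hk.ireg r rfl
    have e5 : s'.ireg nA = p := (hk.ireg nA rfl).trans hp
    have hiN' : i < s.ireg top := by omega
    obtain ⟨hi1, hi2, -⟩ := hP.mem i hi0 (by omega)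
    obtain ⟨hi3, hi4, -⟩ := hP.mem (i + 1) (by omega) (by omega)
    simp only [WP_ite, WP_imset, BExp.holds_ilt, IExp.eval_sub',
      IExp.eval_add', IExp.eval_one, IExp.eval_mat,
      IExp.eval_vec, IExp.eval_reg, e1, e2, e5, hi, Store.setIReg_imat, Store.setIMat_imat,
      if_true]
    refine ⟨fun hc => ⟨by simp, hI.step_backward hinj hi0 hiN' (hP.edge i hi0 hiN') hc hi1 hi4⟩,
      fun hc => ⟨by simp, hI.step_forward hinj hi0 hiN' (hP.edge i hi0 hiN') (by omega) hi2 hi3⟩⟩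
  · rintro s' t - ⟨ht, h⟩
    rw [hN] at h
    refine ⟨?_, h⟩
    simp at ht
    omega

theorem augment_unmark {s : Store} (htop : 0 ≤ s.ireg top) :
    WP (forTo k (top + 1) (mark.set (path k) 0)) s
      fun s' t => t ≤ 20 * s.ireg top + 50 ∧ ∀ v : ℤ,
        (s'.ivec mark v ≠ 0 ↔ Dead (s.ivec mark) (s.ivec path) (s.ireg top) v) := by
  obtain ⟨N, hN⟩ : ∃ N : ℕ, (N : ℤ) = s.ireg top + 1 :=
    ⟨_, Int.toNat_of_nonneg (by omega)⟩
  refine (WP_forTo N 10 (fun i s' => ∀ v : ℤ,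
        (s'.ivec mark v ≠ 0 ↔ Dead (s.ivec mark) (s.ivec path) (i - 1) v))
      rfl ?_ ?_ ?_).mono ?_
  · intro s' hk
    simp [hk.ireg top rfl, hN]
  · intro v
    exact ⟨fun h => ⟨h, fun j hj0 hj => by omega⟩, fun h => h.1⟩
  · intro i s' hk hi0 hiN hi hI
    have e1 : s'.ivec path = s.ivec path := hk.ivec path rfl
    simp only [WP_ivset, IExp.eval_vec, IExp.eval_zero, IExp.eval_reg, e1, hi, Store.setIReg_ivec,
      Store.setIVec_ivec, if_true]
    refine ⟨by simp, fun v => ?_⟩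
    rcases eq_or_ne v (s.ivec path i) with rfl | hv
    · simp only [Function.update_self, ne_eq, not_true_eq_false, false_iff]
      exact fun h => h.2 i hi0 (by omega) rfl
    · rw [Function.update_of_ne hv, hI v]
      refine ⟨fun h => ⟨h.1, fun j hj0 hj => ?_⟩, fun h => ⟨h.1, fun j hj0 hj => h.2 j hj0
        (by omega)⟩⟩
      rcases eq_or_ne j i with rfl | hji
      · exact hv.symm
      · exact h.2 j hj0 (by omega)
  · rintro s' t - ⟨ht, h⟩
    rw [hN, add_sub_cancel_right] at h
    refine ⟨?_, h⟩
    simp at ht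
    omega

/-- The path ends at a free demand node, whose weight is 0, so only the weight of the start and the
length of the path remain in the change of the cost. The admissible graph and the sets of free nodes
can only shrink. -/
theorem augment_spec {s : Store} {p q : ℕ} (hp : s.ireg nA = p)
    (hF : Feasible p q (s.ivec dbar) (s.ivec sbar) (s.imat cbar) (s.imat flow) (s.ivec recv)
      (s.ivec used) (s.ivec y))
    (hP : PathInv p q (Adm p (s.ivec dbar) (s.ivec sbar) (s.imat cbar) (s.imat flow) (s.ivec y))
      (p + s.ireg start) (s.ivec mark) (s.ivec path) (s.ireg top))
    (hst : 0 ≤ s.ireg start) (hst' : s.ireg start < q)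
    (hs : s.ivec used (s.ireg start) < s.ivec sbar (s.ireg start)) (htop : 0 ≤ s.ireg top)
    (htp : s.ivec path (s.ireg top) < p)
    (ht : s.ivec recv (s.ivec path (s.ireg top)) < s.ivec dbar (s.ivec path (s.ireg top))) :
    WP augment s fun s' t => t ≤ 120 * s.ireg top + 140 ∧
      Feasible p q (s.ivec dbar) (s.ivec sbar) (s.imat cbar) (s'.imat flow) (s'.ivec recv)
        (s'.ivec used) (s.ivec y) ∧
      (∀ u v : ℤ, Adm p (s.ivec dbar) (s.ivec sbar) (s.imat cbar) (s'.imat flow) (s.ivec y) u v →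
        Adm p (s.ivec dbar) (s.ivec sbar) (s.imat cbar) (s.imat flow) (s.ivec y) u v) ∧
      (∀ a, s'.ivec recv a < s.ivec dbar a → s.ivec recv a < s.ivec dbar a) ∧
      (∀ b, s'.ivec used b < s.ivec sbar b → s.ivec used b < s.ivec sbar b) ∧
      (∀ v, s'.ivec mark v ≠ 0 ↔ Dead (s.ivec mark) (s.ivec path) (s.ireg top) v) ∧
      ∃ ρ : ℤ, 0 < ρ ∧ s'.ireg left = s.ireg left - ρ ∧
        ∑ b ∈ Finset.Ico (0 : ℤ) q, s'.ivec used b =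
          ∑ b ∈ Finset.Ico (0 : ℤ) q, s.ivec used b + ρ ∧
        2 * flowCost p q (s.imat cbar) (s'.imat flow) = 2 * flowCost p q (s.imat cbar)
          (s.imat flow) + ρ * (2 * s.ivec y (p + s.ireg start) - 1 - s.ireg top) := by
  unfold augment
  refine WP_seq_assoc.2 (WP.seq (augment_bottleneck hp hP.edge hs htop ht) ?_)
  rintro s₁ t₁ hk₁ ⟨ht₁, hr, hr1, hr2, hr3⟩
  have a1 : s₁.ivec path = s.ivec path := hk₁.ivec path rfl
  have a2 : s₁.ivec mark = s.ivec mark := hk₁.ivec mark rfl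
  have a3 : s₁.ivec used = s.ivec used := hk₁.ivec used rfl
  have a4 : s₁.ivec recv = s.ivec recv := hk₁.ivec recv rfl
  have a5 : s₁.ivec y = s.ivec y := hk₁.ivec y rfl
  have a6 : s₁.imat flow = s.imat flow := hk₁.imat flow rfl
  have a7 : s₁.imat cbar = s.imat cbar := hk₁.imat cbar rfl
  have a8 : s₁.ivec dbar = s.ivec dbar := hk₁.ivec dbar rfl
  have a9 : s₁.ivec sbar = s.ivec sbar := hk₁.ivec sbar rfl
  have a10 : s₁.ireg top = s.ireg top := hk₁.ireg top rfl
  have a11 : s₁.ireg start = s.ireg start := hk₁.ireg start rfl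
  have a12 : s₁.ireg left = s.ireg left := hk₁.ireg left rfl
  refine WP.seq (augment_flow (p := p) (q := q) (by rw [hk₁.ireg nA rfl, hp])
    (by rwa [a3, a4, a5, a6, a7, a8, a9])
    (by rwa [a1, a2, a5, a6, a7, a8, a9, a10, a11]) (by rwa [a11]) (by rwa [a10])) ?_
  rintro s₂ t₂ hk₂ ⟨ht₂, hA⟩
  rw [a1, a3, a4, a5, a6, a7, a10, a11] at hA
  have b1 : s₂.ivec path = s.ivec path := (hk₂.ivec path rfl).trans a1
  have b2 : s₂.ivec mark = s.ivec mark := (hk₂.ivec mark rfl).trans a2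
  have b3 : s₂.ivec used = s.ivec used := (hk₂.ivec used rfl).trans a3
  have b4 : s₂.ivec recv = s.ivec recv := (hk₂.ivec recv rfl).trans a4
  have b10 : s₂.ireg top = s.ireg top := (hk₂.ireg top rfl).trans a10
  have b11 : s₂.ireg start = s.ireg start := (hk₂.ireg start rfl).trans a11
  have b12 : s₂.ireg left = s.ireg left := (hk₂.ireg left rfl).trans a12
  have b13 : s₂.ireg r = s₁.ireg r := hk₂.ireg r rfl
  simp only [WP_seq, WP_ivset, WP_iset, IExp.eval_vec, IExp.eval_reg, IExp.eval_add',
    IExp.eval_sub', Store.setIVec_ireg, Store.setIVec_ivec, reduceCtorEq, if_false,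
    b1, b3, b4, b10, b11, b12, b13]
  refine (augment_unmark (by simpa [b10] using htop)).mono ?_
  rintro s₃ t₃ hk₃ ⟨ht₃, hm⟩
  simp only [Store.setIReg_ireg, Store.setIReg_ivec, Store.setIVec_ireg, Store.setIVec_ivec,
    reduceCtorEq, if_false, b1, b2, b10] at hm ht₃
  have c1 : s₃.imat flow = s₂.imat flow := hk₃.imat flow rfl
  have c2 : s₃.ivec used = Function.update (s.ivec used) (s.ireg start)
      (s.ivec used (s.ireg start) + s₁.ireg r) := by
    rw [hk₃.ivec used rfl]
    simp [b3]
  have c3 : s₃.ivec recv = Function.update (s.ivec recv) (s.ivec path (s.ireg top))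
      (s.ivec recv (s.ivec path (s.ireg top)) + s₁.ireg r) := by
    rw [hk₃.ivec recv rfl]
    simp [b4]
  have c4 : s₃.ireg left = s.ireg left - s₁.ireg r := by
    rw [hk₃.ireg left rfl]
    simp
  obtain ⟨h0, h1, -⟩ := hP.mem _ htop le_rfl
  refine ⟨?_, ?_, ?_, ?_, ?_, hm, s₁.ireg r, hr, c4, ?_, ?_⟩
  · simp at ht₁ ht₂ ht₃ ⊢
    omega
  · rw [c1, c2, c3]
    exact hA.feasible hF hr hP.edge hr3 hr1 hr2 htp
  · rw [c1]
    rintro u v ⟨hR, hS⟩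
    rcases hA.res hr hP.edge hR with h | h
    · exact ⟨h, hS⟩
    · omega
  · intro a
    rw [c3, Function.update_apply]
    split_ifs with h
    · rw [h]; omega
    · exact id
  · intro b
    rw [c2, Function.update_apply]
    split_ifs with h
    · rw [h]; omega
    · exact id
  · rw [c2, sum_eq_of_eq_off (f := s.ivec used) (u := s.ireg start) (by simp [hst, hst'])
      fun v _ hv => by rw [Function.update_of_ne hv]]
    simp
    ring
  · rw [c1, hA.weight, if_pos htp, hF.dual_free _ h0 htp ht]
    ring

/-! ### Phases -/

/-- Within a phase the admissible edges and the free demand nodes only decrease, so pointers and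
dead vertices remain valid from one search to the next. -/
theorem DFSInv.anti {p q : ℕ} {E E' : ℤ → ℤ → Prop} {tgt tgt' dead : ℤ → Prop} {pt : ℤ → ℤ}
    (h : DFSInv p q E tgt dead pt) (hE : ∀ u v, E' u v → E u v) (ht : ∀ a, tgt' a → tgt a) :
    DFSInv p q E' tgt' dead pt :=
  ⟨fun u v hu0 hu hv0 hv hd hE' => h.dead_closed u v hu0 hu hv0 hv hd (hE u v hE'),
    fun a ha0 ha hd ht' => h.dead_tgt a ha0 ha hd (ht a ht'), h.ptr_nonneg, h.ptr_le,
    fun u i hu0 hu hi0 hi hE' => h.scanned u i hu0 hu hi0 hi (hE _ _ hE')⟩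

/-- Only vertices of the path lose their mark, and each of them gives back its 4 units. The pointers
are not reset. -/
theorem dfsWork_unmark {p q : ℕ} {mk mk' pt pa : ℤ → ℤ} {tp : ℤ} (htp : -1 ≤ tp)
    (h : ∀ v, mk' v ≠ 0 ↔ Dead mk pa tp v) :
    dfsWork p q mk' pt ≤ dfsWork p q mk pt + 4 * (tp + 1) := by
  have h1 : ∀ v, (if mk' v = 0 then (4 : ℤ) else 0) ≤ (if mk v = 0 then 4 else 0) +
      ∑ j ∈ Finset.Ico (0 : ℤ) (tp + 1), if v = pa j then 4 else 0 := by
    intro v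
    have h0 : ∀ j ∈ Finset.Ico (0 : ℤ) (tp + 1), (0 : ℤ) ≤ if v = pa j then 4 else 0 :=
      fun j _ => by split_ifs <;> simp
    have hs := Finset.sum_nonneg h0
    by_cases hmk : mk v = 0
    · rw [if_pos hmk]
      split_ifs <;> omega
    by_cases hmk' : mk' v = 0
    · have hd := (not_congr (h v)).1 (by simpa using hmk')
      obtain ⟨j, hj0, hj, hjv⟩ : ∃ j : ℤ, 0 ≤ j ∧ j ≤ tp ∧ pa j = v := by
        by_contra hc
        exact hd ⟨hmk, fun j hj0 hj hjv => hc ⟨j, hj0, hj, hjv⟩⟩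
      have := Finset.single_le_sum h0 (a := j) (by rw [Finset.mem_Ico]; omega)
      rw [if_pos hjv.symm] at this
      rw [if_pos hmk', if_neg hmk]
      omega
    · rw [if_neg hmk', if_neg hmk]
      omega
  calc dfsWork p q mk' pt ≤ ∑ v ∈ Finset.Ico (0 : ℤ) (p + q),
        ((p + q - pt v + if mk v = 0 then 4 else 0) +
          ∑ j ∈ Finset.Ico (0 : ℤ) (tp + 1), if v = pa j then 4 else 0) :=
        Finset.sum_le_sum fun v _ => by have := h1 v; omega
    _ ≤ dfsWork p q mk pt + ∑ j ∈ Finset.Ico (0 : ℤ) (tp + 1), 4 := by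
        rw [Finset.sum_add_distrib, Finset.sum_comm]
        refine add_le_add le_rfl (Finset.sum_le_sum fun j _ => ?_)
        rw [Finset.sum_ite_eq']
        split_ifs <;> simp
    _ = dfsWork p q mk pt + 4 * (tp + 1) := by
        simp [Finset.sum_const, Int.card_Ico]
        rw [max_eq_left (by omega)]
        ring

/-- A potential that pays for the augmentations; `N` is the largest scaled cost. -/
noncomputable def augWork (p q : ℕ) (N : ℤ) (cb fl : ℤ → ℤ → ℤ) (lft : ℤ) : ℤ :=
  2 * ((N + 1) * lft) + 2 * flowCost p q cb fl

theorem Feasible.left_nonneg {p q : ℕ} {db sb : ℤ → ℤ} {cb fl : ℤ → ℤ → ℤ} {rc us y : ℤ → ℤ}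
    (h : Feasible p q db sb cb fl rc us y) :
    0 ≤ ∑ b ∈ Finset.Ico (0 : ℤ) q, sb b - ∑ b ∈ Finset.Ico (0 : ℤ) q, us b := by
  rw [← Finset.sum_sub_distrib]
  refine Finset.sum_nonneg fun b hb => ?_
  rw [Finset.mem_Ico] at hb
  have := h.used_le b hb.1 hb.2
  omega

theorem Feasible.augWork_nonneg {p q : ℕ} {db sb : ℤ → ℤ} {cb fl : ℤ → ℤ → ℤ} {rc us y : ℤ → ℤ}
    (h : Feasible p q db sb cb fl rc us y) {N lft : ℤ}
    (hcb : ∀ a b : ℤ, 0 ≤ a → a < p → 0 ≤ b → b < q → 0 ≤ cb a b) (hN : 0 ≤ N)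
    (hl : lft = ∑ b ∈ Finset.Ico (0 : ℤ) q, sb b - ∑ b ∈ Finset.Ico (0 : ℤ) q, us b) :
    0 ≤ augWork p q N cb fl lft := by
  have h1 := h.left_nonneg
  have h2 : 0 ≤ flowCost p q cb fl := by
    refine Finset.sum_nonneg fun a ha => Finset.sum_nonneg fun b hb => ?_
    rw [Finset.mem_Ico] at ha hb
    exact mul_nonneg (h.flow_nonneg a b ha.1 ha.2 hb.1 hb.2) (hcb a b ha.1 ha.2 hb.1 hb.2)
  rw [augWork, hl]
  positivity

/-- What remains true during the phases. The costs, demands and supplies are those of `s`. -/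
structure PhaseInv (p q : ℕ) (s s' : Store) : Prop where
  feasible : Feasible p q (s.ivec dbar) (s.ivec sbar) (s.imat cbar) (s'.imat flow) (s'.ivec recv)
    (s'.ivec used) (s'.ivec y)
  left_eq : s'.ireg left = ∑ b ∈ Finset.Ico (0 : ℤ) q, s.ivec sbar b -
    ∑ b ∈ Finset.Ico (0 : ℤ) q, s'.ivec used b
  nA_eq : s'.ireg nA = p
  nB_eq : s'.ireg nB = q
  dbar_eq : s'.ivec dbar = s.ivec dbar
  sbar_eq : s'.ivec sbar = s.ivec sbar
  cbar_eq : s'.imat cbar = s.imat cbar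

/-- One round of the partial depth-first search: a search with the augmentation that follows it. -/
theorem searchAugment_spec {s₀ s : Store} {p q : ℕ} {N : ℤ} (hI : PhaseInv p q s₀ s)
    (hcN : ∀ a b : ℤ, 0 ≤ a → a < p → 0 ≤ b → b < q → s₀.imat cbar a b ≤ N)
    (hD : DFSInv p q (Adm p (s₀.ivec dbar) (s₀.ivec sbar) (s₀.imat cbar) (s.imat flow) (s.ivec y))
      (fun a => s.ivec recv a < s₀.ivec dbar a) (fun v => s.ivec mark v ≠ 0) (s.ivec ptr))
    (hst0 : 0 ≤ s.ireg start) (hst : s.ireg start < q)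
    (hs : s.ivec used (s.ireg start) < s₀.ivec sbar (s.ireg start))
    (hmk : s.ivec mark (p + s.ireg start) = 0) :
    WP (search ;; when (found ≐ 1) augment) s fun s' t =>
      t + 50 + 100 * dfsWork p q (s'.ivec mark) (s'.ivec ptr) +
          500 * augWork p q N (s₀.imat cbar) (s'.imat flow) (s'.ireg left) ≤
        100 * dfsWork p q (s.ivec mark) (s.ivec ptr) +
          500 * augWork p q N (s₀.imat cbar) (s.imat flow) (s.ireg left) ∧
      PhaseInv p q s₀ s' ∧
      DFSInv p q
        (Adm p (s₀.ivec dbar) (s₀.ivec sbar) (s₀.imat cbar) (s'.imat flow) (s'.ivec y))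
        (fun a => s'.ivec recv a < s₀.ivec dbar a) (fun v => s'.ivec mark v ≠ 0) (s'.ivec ptr) ∧
      (∀ v, s.ivec mark v ≠ 0 → s'.ivec mark v ≠ 0) ∧
      (∀ b, s'.ivec used b < s₀.ivec sbar b → s.ivec used b < s₀.ivec sbar b) := by
  obtain ⟨hF, hl, hA, hB, hdb, hsb, hcb⟩ := hI
  obtain ⟨r, hr⟩ := hF.acyclic
  refine WP.seq (search_spec hA hB (by rw [hdb, hsb, hcb]) (by rw [hdb])
    (fun u v hu0 hu hv0 hv h => hr u v hu0 hu hv0 hv h.1 h.2) hD hst0 hst hmk) ?_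
  rintro s₁ t₁ hk₁ ⟨ht₁, hD₁, hP₁, hM₁, hf₁⟩
  have a3 : s₁.ivec used = s.ivec used := hk₁.ivec used rfl
  have a4 : s₁.ivec recv = s.ivec recv := hk₁.ivec recv rfl
  have a5 : s₁.ivec y = s.ivec y := hk₁.ivec y rfl
  have a6 : s₁.imat flow = s.imat flow := hk₁.imat flow rfl
  have a7 : s₁.imat cbar = s₀.imat cbar := (hk₁.imat cbar rfl).trans hcb
  have a8 : s₁.ivec dbar = s₀.ivec dbar := (hk₁.ivec dbar rfl).trans hdb
  have a9 : s₁.ivec sbar = s₀.ivec sbar := (hk₁.ivec sbar rfl).trans hsb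
  have a11 : s₁.ireg start = s.ireg start := hk₁.ireg start rfl
  have a12 : s₁.ireg left = s.ireg left := hk₁.ireg left rfl
  have a13 : s₁.ireg nA = p := (hk₁.ireg nA rfl).trans hA
  have a14 : s₁.ireg nB = q := (hk₁.ireg nB rfl).trans hB
  simp only [WP_when, BExp.holds_ieq, IExp.eval_reg, IExp.eval_one]
  refine ⟨fun hc => ?_, fun hc => ?_⟩
  · rcases hf₁ with hf₁ | ⟨hf₁, htop, htp, htg⟩
    · omega
    obtain ⟨h0, h1, -⟩ := hP₁.mem _ htop le_rfl
    refine (augment_spec (p := p) (q := q) a13 (by rwa [a3, a4, a5, a6, a7, a8, a9])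
      (by rwa [a5, a6, a7, a8, a9, a11]) (by rwa [a11]) (by rwa [a11]) (by rwa [a3, a9, a11]) htop
      htp (by rwa [a4, a8])).mono ?_
    rintro s₂ t₂ hk₂ ⟨ht₂, hF₂, hA₂, hr₂, hu₂, hm₂, ρ, hρ, hl₂, hs₂, hw₂⟩
    have b5 : s₂.ivec y = s.ivec y := (hk₂.ivec y rfl).trans a5
    have b7 : s₂.imat cbar = s₀.imat cbar := (hk₂.imat cbar rfl).trans a7
    have b8 : s₂.ivec dbar = s₀.ivec dbar := (hk₂.ivec dbar rfl).trans a8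
    have b9 : s₂.ivec sbar = s₀.ivec sbar := (hk₂.ivec sbar rfl).trans a9
    have b10 : s₂.ivec ptr = s₁.ivec ptr := hk₂.ivec ptr rfl
    rw [a5, a6, a7, a8, a9] at hA₂
    rw [a4, a8] at hr₂
    rw [a3, a9] at hu₂
    rw [a5, a7, a8, a9] at hF₂
    rw [a3] at hs₂
    rw [a5, a6, a7, a11] at hw₂
    rw [a12] at hl₂
    have hW := dfsWork_unmark (p := p) (q := q) (pt := s₁.ivec ptr) hP₁.top_ge hm₂
    refine ⟨?_, ⟨by rwa [b5], by rw [hl₂, hs₂, hl]; ring, (hk₂.ireg nA rfl).trans a13,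
      (hk₂.ireg nB rfl).trans a14, b8, b9, b7⟩, ?_, fun v hv => (hm₂ v).2 (hM₁ v hv), hu₂⟩
    · have hy : s.ivec y (p + s.ireg start) ≤ N + 1 := by
        have h2 := hF.dual_le h0 htp (v := p + s.ireg start) (by omega) (by omega) htg
          (by rwa [add_sub_cancel_left])
        rw [add_sub_cancel_left] at h2
        have := hcN _ (s.ireg start) h0 htp hst0 hst
        omega
      -- The potential falls by ρ(2(N+1) - 2y(start)) + ρ(top + 1), where the first summand is
      -- nonnegative by `hy` and ρ ≥ 1. With the factor 500, each unit pays for the work restored by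
      -- unmarking (400) and, with the surplus of the search, for the augmentation itself.
      have haug : augWork p q N (s₀.imat cbar) (s₂.imat flow) (s₂.ireg left) ≤
          augWork p q N (s₀.imat cbar) (s.imat flow) (s.ireg left) - (s₁.ireg top + 1) := by
        rw [augWork, augWork, hl₂]
        nlinarith [mul_nonneg hρ.le (by omega : 0 ≤ 2 * (N + 1) - 2 * s.ivec y (p + s.ireg start)),
          mul_nonneg (by omega : 0 ≤ ρ - 1) (by omega : 0 ≤ s₁.ireg top + 1)]
      rw [b10]
      simp
      omega
    · rw [b10, b5]
      exact (hD₁.congr hm₂).anti hA₂ hr₂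
  · rcases hf₁ with ⟨hf₁, htop⟩ | hf₁
    · refine ⟨?_, ⟨by rwa [a3, a4, a5, a6], by rw [a12, a3, hl], a13, a14, a8, a9, a7⟩, ?_,
        fun v hv => (hM₁ v hv).1, fun b => by rw [a3]; exact id⟩
      · rw [a6, a12]
        simp
        omega
      · rw [a4, a5, a6]
        rw [htop] at hD₁
        exact hD₁.congr fun v => ⟨fun h => ⟨h, fun j hj0 hj => by omega⟩, fun h => h.1⟩
    · omega

theorem partialDFS_init {s : Store} {p q : ℕ} (hp : s.ireg nA = p) (hq : s.ireg nB = q) :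
    WP (forTo v (nA + nB) (ptr.set v 0 ;; mark.set v 0)) s fun s' t =>
      t ≤ 20 * (p + q) + 10 ∧
        ∀ v : ℤ, 0 ≤ v → v < p + q → s'.ivec ptr v = 0 ∧ s'.ivec mark v = 0 := by
  refine (WP_forTo (p + q) 10
    (fun i s' => ∀ v : ℤ, 0 ≤ v → v < i → s'.ivec ptr v = 0 ∧ s'.ivec mark v = 0)
      rfl ?_ ?_ ?_).mono ?_
  · intro s' hk
    simp [hk.ireg nA rfl, hk.ireg nB rfl, hp, hq]
  · intro v h0 h1
    omega
  · intro i s' hk hi0 hiN hi hI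
    simp only [WP_seq, WP_ivset]
    refine ⟨by simp, fun v hv0 hv1 => ?_⟩
    simp only [Store.setIReg_ivec, Store.setIVec_ivec, Store.setIVec_ireg, reduceCtorEq, if_true,
      if_false, IExp.eval_reg, IExp.eval_zero, hi, Function.update_apply]
    rcases eq_or_ne v i with rfl | hv
    · simp
    · simpa [hv] using hI v hv0 (by omega)
  · rintro s' t - ⟨ht, h⟩
    exact ⟨by simp at ht; omega, fun v h0 h1 => h v h0 (by push_cast; exact h1)⟩

/-- The inner loop leaves a supply node only when it is exhausted or marked. Marks of dead vertices
persist and exhausted nodes stay exhausted. At the end all free supply nodes are dead, and the dead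
vertices are closed under admissible edges and contain no free demand node. -/
theorem partialDFS_spec {s₀ s : Store} {p q : ℕ} {N : ℤ} (hI : PhaseInv p q s₀ s)
    (hcb : ∀ a b : ℤ, 0 ≤ a → a < p → 0 ≤ b → b < q → 0 ≤ s₀.imat cbar a b) (hN : 0 ≤ N)
    (hcN : ∀ a b : ℤ, 0 ≤ a → a < p → 0 ≤ b → b < q → s₀.imat cbar a b ≤ N) :
    WP partialDFS s fun s' t =>
      t + 500 * augWork p q N (s₀.imat cbar) (s'.imat flow) (s'.ireg left) ≤
        500 * augWork p q N (s₀.imat cbar) (s.imat flow) (s.ireg left) + 500 * (p + q + 1) ^ 2 ∧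
      PhaseInv p q s₀ s' ∧
      Blocked p q (s₀.ivec dbar) (s₀.ivec sbar) (s₀.imat cbar) (s'.imat flow) (s'.ivec recv)
        (s'.ivec used) (s'.ivec y) ∧
      ∀ b, s'.ivec used b < s₀.ivec sbar b → s.ivec used b < s₀.ivec sbar b := by
  unfold partialDFS
  refine WP.seq (partialDFS_init hI.nA_eq hI.nB_eq) ?_
  rintro s₁ t₁ hk₁ ⟨ht₁, hpm⟩
  have a3 : s₁.ivec used = s.ivec used := hk₁.ivec used rfl
  have a6 : s₁.imat flow = s.imat flow := hk₁.imat flow rfl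
  have a12 : s₁.ireg left = s.ireg left := hk₁.ireg left rfl
  have hI₁ : PhaseInv p q s₀ s₁ := by
    obtain ⟨hF, hl, hA, hB, hdb, hsb, hcb⟩ := hI
    refine ⟨?_, ?_, (hk₁.ireg nA rfl).trans hA, (hk₁.ireg nB rfl).trans hB,
      (hk₁.ivec dbar rfl).trans hdb, (hk₁.ivec sbar rfl).trans hsb, (hk₁.imat cbar rfl).trans hcb⟩
    · rwa [a3, a6, hk₁.ivec recv rfl, hk₁.ivec y rfl]
    · rw [a12, a3, hl]
  have hD₁ : DFSInv p q
      (Adm p (s₀.ivec dbar) (s₀.ivec sbar) (s₀.imat cbar) (s₁.imat flow) (s₁.ivec y))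
      (fun a => s₁.ivec recv a < s₀.ivec dbar a) (fun v => s₁.ivec mark v ≠ 0) (s₁.ivec ptr) := by
    refine ⟨fun u v hu0 hu _ _ h => absurd (hpm u hu0 hu).2 h,
      fun a ha0 ha h => absurd (hpm a ha0 (by omega)).2 h, fun u hu0 hu => ?_, fun u hu0 hu => ?_,
      fun u i hu0 hu hi0 hi => ?_⟩
    · rw [(hpm u hu0 hu).1]
    · rw [(hpm u hu0 hu).1, nbrCount]
      split_ifs <;> omega
    · rw [(hpm u hu0 hu).1] at hi
      omega
  have hW₁ : dfsWork p q (s₁.ivec mark) (s₁.ivec ptr) = (p + q) * (p + q + 4) := by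
    have h : ∀ v ∈ Finset.Ico (0 : ℤ) (p + q),
        (p + q - s₁.ivec ptr v + if s₁.ivec mark v = 0 then 4 else 0 : ℤ) = p + q + 4 := by
      intro v hv
      rw [Finset.mem_Ico] at hv
      rw [(hpm v hv.1 hv.2).1, (hpm v hv.1 hv.2).2, if_pos rfl, sub_zero]
    rw [dfsWork, Finset.sum_congr rfl h, Finset.sum_const, Int.card_Ico, nsmul_eq_mul]
    congr 1
  set Good : ℤ → ℕ → Store → Prop := fun i n s' =>
    PhaseInv p q s₀ s' ∧ DFSInv p q
        (Adm p (s₀.ivec dbar) (s₀.ivec sbar) (s₀.imat cbar) (s'.imat flow) (s'.ivec y))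
        (fun a => s'.ivec recv a < s₀.ivec dbar a) (fun v => s'.ivec mark v ≠ 0) (s'.ivec ptr) ∧
      (∀ b, s'.ivec used b < s₀.ivec sbar b → s.ivec used b < s₀.ivec sbar b) ∧
      (∀ v : ℤ, p ≤ v → v < p + i → s'.ivec used (v - p) < s₀.ivec sbar (v - p) →
        s'.ivec mark v ≠ 0) ∧
      100 * dfsWork p q (s'.ivec mark) (s'.ivec ptr) +
          500 * augWork p q N (s₀.imat cbar) (s'.imat flow) (s'.ireg left) + 100 * (q - i) ≤ n
    with hGood
  -- Credit for the searches, for the augmentations, and 100 per supply node for the outer loop with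
  -- the last test of the inner one.
  obtain ⟨n₁, hn₁⟩ : ∃ n₁ : ℕ, (n₁ : ℤ) = 100 * dfsWork p q (s₁.ivec mark) (s₁.ivec ptr) +
      500 * augWork p q N (s₀.imat cbar) (s₁.imat flow) (s₁.ireg left) + 100 * q := by
    have h1 := hD₁.work_nonneg (mk := s₁.ivec mark)
    have h2 := hI₁.feasible.augWork_nonneg hcb hN hI₁.left_eq
    exact ⟨_, Int.toNat_of_nonneg (by positivity)⟩
  refine (WP_forTo_credit q Good n₁ rfl ?_ ?_ ?_).mono ?_
  · intro s' hk
    simp [hk.ireg nB rfl, hI₁.nB_eq]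
  · refine ⟨⟨hI₁.1, hI₁.2, hI₁.3, hI₁.4, hI₁.5, hI₁.6, hI₁.7⟩, hD₁, fun b => ?_, fun v h0 h1 => by omega, ?_⟩
    · simp only [Store.setIReg_ivec, a3]
      exact id
    · simp [hn₁]
  · rintro i n s₂ hk₂ hi0 hiN hi hG₂
    refine (WP_loop (fun n s' => s'.ireg start = i ∧ Good i n s') n ⟨hi, hG₂⟩ ?_).mono ?_
    · rintro n s₃ hk₃ ⟨hi₃, hI₃, hD₃, hu₃, hm₃, hn₃⟩ hB
      simp only [freeSupply, BExp.holds_and, BExp.holds_ilt, BExp.holds_ieq, IExp.eval_vec,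
        IExp.eval_reg, IExp.eval_add', IExp.eval_zero, hI₃.nA_eq, hI₃.sbar_eq] at hB
      refine (searchAugment_spec hI₃ hcN hD₃ (by omega) (by omega) hB.1 hB.2).mono ?_
      rintro s₄ t₄ hk₄ ⟨ht₄, hI₄, hD₄, hm₄, hu₄⟩
      have h1 := hD₄.work_nonneg (mk := s₄.ivec mark)
      have h2 := hI₄.feasible.augWork_nonneg hcb hN hI₄.left_eq
      refine ⟨n - (t₄ + 50), ?_, (hk₄.ireg start rfl).trans hi₃, hI₄, hD₄,
        fun b hb => hu₃ b (hu₄ b hb), fun v h0 h1 hv => hm₄ v (hm₃ v h0 h1 (hu₄ _ hv)), ?_⟩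
      · simp [freeSupply]
        omega
      · omega
    · rintro s₃ t₃ hk₃ ⟨n₃, hn₃, ⟨hi₃, hI₃, hD₃, hu₃, hm₃, hc₃⟩, hB⟩
      simp only [freeSupply, BExp.holds_and, BExp.holds_ilt, BExp.holds_ieq, IExp.eval_vec,
        IExp.eval_reg, IExp.eval_add', IExp.eval_zero, hI₃.nA_eq, hI₃.sbar_eq, hi₃] at hB
      have h1 := hD₃.work_nonneg (mk := s₃.ivec mark)
      have h2 := hI₃.feasible.augWork_nonneg hcb hN hI₃.left_eq
      refine ⟨n₃ - 100, ?_, ⟨hI₃.1, hI₃.2, hI₃.3, hI₃.4, hI₃.5, hI₃.6, hI₃.7⟩, hD₃, hu₃,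
        fun v h0 h1 hv => ?_, ?_⟩
      · simp [freeSupply] at hn₃ ⊢
        omega
      · simp only [Store.setIReg_ivec] at hv ⊢
        rcases eq_or_ne v (p + i) with rfl | hvi
        · intro hmk
          rw [add_sub_cancel_left] at hv
          exact hB ⟨hv, hmk⟩
        · exact hm₃ v h0 (by omega) hv
      · simp only [Store.setIReg_ivec, Store.setIReg_imat, Store.setIReg_ireg, reduceCtorEq,
          if_false]
        omega
  · rintro s₂ t₂ - ⟨n₂, hn₂, hI₂, hD₂, hu₂, hm₂, hc₂⟩
    have h1 := hD₂.work_nonneg (mk := s₂.ivec mark)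
    -- The path is empty now, so the marked vertices are the dead ones and serve as the set of
    -- `Blocked`.
    refine ⟨?_, hI₂, ⟨fun v => s₂.ivec mark v ≠ 0, fun v h0 h1 h2 => hm₂ v h0 h1 h2,
      fun u v hu0 hu hv0 hv hR hS hu' => hD₂.dead_closed u v hu0 hu hv0 hv hu' ⟨hR, hS⟩,
      fun a ha0 ha hf hd => hD₂.dead_tgt a ha0 ha hd hf⟩, hu₂⟩
    rw [a6, a12, hW₁] at hn₁
    simp at hn₂
    push_cast
    nlinarith

/-- Total received equals total used, which is less than the scaled supply and hence less than the
scaled demand. -/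
theorem Feasible.exists_free {p q : ℕ} {db sb : ℤ → ℤ} {cb fl : ℤ → ℤ → ℤ} {rc us y : ℤ → ℤ}
    (h : Feasible p q db sb cb fl rc us y)
    (hsd : ∑ b ∈ Finset.Ico (0 : ℤ) q, sb b ≤ ∑ a ∈ Finset.Ico (0 : ℤ) p, db a)
    (hl : 0 < ∑ b ∈ Finset.Ico (0 : ℤ) q, sb b - ∑ b ∈ Finset.Ico (0 : ℤ) q, us b) :
    (∃ a : ℤ, 0 ≤ a ∧ a < p ∧ rc a < db a) ∧
      ∃ v : ℤ, p ≤ v ∧ v < p + q ∧ us (v - p) < sb (v - p) := by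
  constructor
  · have h1 : ∑ a ∈ Finset.Ico (0 : ℤ) p, rc a < ∑ a ∈ Finset.Ico (0 : ℤ) p, db a := by
      calc ∑ a ∈ Finset.Ico (0 : ℤ) p, rc a
          = ∑ a ∈ Finset.Ico (0 : ℤ) p, ∑ b ∈ Finset.Ico (0 : ℤ) q, fl a b :=
            Finset.sum_congr rfl fun a ha => by
              rw [Finset.mem_Ico] at ha
              exact h.recv_eq a ha.1 ha.2
        _ = ∑ b ∈ Finset.Ico (0 : ℤ) q, us b := by
            rw [Finset.sum_comm]
            refine Finset.sum_congr rfl fun b hb => ?_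
            rw [Finset.mem_Ico] at hb
            exact (h.used_eq b hb.1 hb.2).symm
        _ < _ := by omega
    obtain ⟨a, ha, h2⟩ := Finset.exists_lt_of_sum_lt h1
    rw [Finset.mem_Ico] at ha
    exact ⟨a, ha.1, ha.2, h2⟩
  · obtain ⟨b, hb, h2⟩ := Finset.exists_lt_of_sum_lt (by omega :
      ∑ b ∈ Finset.Ico (0 : ℤ) q, us b < ∑ b ∈ Finset.Ico (0 : ℤ) q, sb b)
    rw [Finset.mem_Ico] at hb
    exact ⟨p + b, by omega, by omega, by rwa [add_sub_cancel_left]⟩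

/-- The phase counter is bounded by the weight of each node that is still free: a phase raises the
counter by one and these weights by at least one, while the depth-first search changes no weight and
frees no supply node. The coefficient 864 is 360 for the Hungarian search, 500 for the depth-first
search and 4 for the counter. -/
theorem phase_spec {s₀ s : Store} {p q : ℕ} {N : ℤ} (hI : PhaseInv p q s₀ s)
    (hbl : Blocked p q (s₀.ivec dbar) (s₀.ivec sbar) (s₀.imat cbar) (s.imat flow) (s.ivec recv)
        (s.ivec used) (s.ivec y))
    (hcb : ∀ a b : ℤ, 0 ≤ a → a < p → 0 ≤ b → b < q → 0 ≤ s₀.imat cbar a b) (hN : 0 ≤ N)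
    (hcN : ∀ a b : ℤ, 0 ≤ a → a < p → 0 ≤ b → b < q → s₀.imat cbar a b ≤ N)
    (hsd : ∑ b ∈ Finset.Ico (0 : ℤ) q, s₀.ivec sbar b ≤ ∑ a ∈ Finset.Ico (0 : ℤ) p, s₀.ivec dbar a)
    (hleft : 0 < s.ireg left)
    (hph : ∀ v : ℤ, p ≤ v → v < p + q → s.ivec used (v - p) < s₀.ivec sbar (v - p) →
      s.ireg phases ≤ s.ivec y v) :
    WP phase s fun s' t =>
      t + 500 * augWork p q N (s₀.imat cbar) (s'.imat flow) (s'.ireg left) ≤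
        500 * augWork p q N (s₀.imat cbar) (s.imat flow) (s.ireg left) + 864 * (p + q + 1) ^ 2 ∧
      PhaseInv p q s₀ s' ∧
      Blocked p q (s₀.ivec dbar) (s₀.ivec sbar) (s₀.imat cbar) (s'.imat flow) (s'.ivec recv)
        (s'.ivec used) (s'.ivec y) ∧
      s'.ireg phases = s.ireg phases + 1 ∧ s'.ireg phases ≤ N + 1 ∧
      ∀ v : ℤ, p ≤ v → v < p + q → s'.ivec used (v - p) < s₀.ivec sbar (v - p) →
        s'.ireg phases ≤ s'.ivec y v := by
  have hF := hI.feasible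
  obtain ⟨hfa, hfb⟩ := hF.exists_free hsd (by rw [← hI.left_eq]; exact hleft)
  unfold phase
  refine WP_seq.2 (WP_iset.2 (WP.seq (hungarianSearch_spec (p := p) (q := q)
    (by simp [hI.nA_eq]) (by simp [hI.nB_eq]) (by simpa [hI.dbar_eq, hI.sbar_eq, hI.cbar_eq])
    (by simpa [hI.dbar_eq, hI.sbar_eq, hI.cbar_eq]) (by simpa [hI.dbar_eq])
    (by simpa [hI.sbar_eq])) ?_))
  rintro s₁ t₁ hk₁ ⟨ht₁, hF₁, hy₁⟩
  simp only [Store.setIReg_ivec, Store.setIReg_imat, hI.dbar_eq, hI.sbar_eq, hI.cbar_eq]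
    at hF₁ hy₁
  have a3 : s₁.ivec used = s.ivec used := hk₁.ivec used rfl
  have a4 : s₁.ivec recv = s.ivec recv := hk₁.ivec recv rfl
  have a6 : s₁.imat flow = s.imat flow := hk₁.imat flow rfl
  have a7 : s₁.imat cbar = s₀.imat cbar := (hk₁.imat cbar rfl).trans hI.cbar_eq
  have a8 : s₁.ivec dbar = s₀.ivec dbar := (hk₁.ivec dbar rfl).trans hI.dbar_eq
  have a9 : s₁.ivec sbar = s₀.ivec sbar := (hk₁.ivec sbar rfl).trans hI.sbar_eq
  have a12 : s₁.ireg left = s.ireg left := by rw [hk₁.ireg left rfl]; simp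
  have a13 : s₁.ireg nA = p := by rw [hk₁.ireg nA rfl]; simp [hI.nA_eq]
  have a14 : s₁.ireg nB = q := by rw [hk₁.ireg nB rfl]; simp [hI.nB_eq]
  have a15 : s₁.ireg phases = s.ireg phases + 1 := by rw [hk₁.ireg phases rfl]; simp
  refine (partialDFS_spec ⟨by rwa [a3, a4, a6], by rw [a12, a3, hI.left_eq], a13, a14, a8, a9, a7⟩
    hcb hN hcN).mono ?_
  rintro s₂ t₂ hk₂ ⟨ht₂, hI₂, hbl₂, hu₂⟩
  have b15 : s₂.ireg phases = s.ireg phases + 1 := (hk₂.ireg phases rfl).trans a15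
  have b5 : s₂.ivec y = s₁.ivec y := hk₂.ivec y rfl
  rw [a3] at hu₂
  rw [a6, a12] at ht₂
  refine ⟨?_, hI₂, hbl₂, b15, ?_, fun v h0 h1 hv => ?_⟩
  · zify at ht₁
    simp
    nlinarith
  -- The bound on the counter is read off between the two steps of the phase, when the free nodes
  -- found above are still free and the weights are already raised.
  · obtain ⟨a, ha0, ha1, hfa⟩ := hfa
    obtain ⟨v, hv0, hv1, hfv⟩ := hfb
    have h1 := hF₁.dual_le ha0 ha1 hv0 hv1 hfa hfv
    have h2 := hy₁ v hv0 hv1 hfv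
    have h3 := hph v hv0 hv1 hfv
    have h4 := hcN a (v - p) ha0 ha1 (by omega) (by omega)
    omega
  · have h2 := hy₁ v h0 h1 (hu₂ _ hv)
    have h3 := hph v h0 h1 (hu₂ _ hv)
    rw [b15, b5]
    omega

/-- The counter never exceeds N + 1, so `N + 1 - phases` measures the phases to come. Each of them
is paid with 868 (n+1)², the cost of a phase plus 4 for the loop test, while the augmentations draw
on `augWork`. -/
theorem phases_spec {s₀ s : Store} {p q : ℕ} {N : ℤ} (hI : PhaseInv p q s₀ s)
    (hbl : Blocked p q (s₀.ivec dbar) (s₀.ivec sbar) (s₀.imat cbar) (s.imat flow) (s.ivec recv)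
        (s.ivec used) (s.ivec y))
    (hcb : ∀ a b : ℤ, 0 ≤ a → a < p → 0 ≤ b → b < q → 0 ≤ s₀.imat cbar a b) (hN : 0 ≤ N)
    (hcN : ∀ a b : ℤ, 0 ≤ a → a < p → 0 ≤ b → b < q → s₀.imat cbar a b ≤ N)
    (hsd : ∑ b ∈ Finset.Ico (0 : ℤ) q, s₀.ivec sbar b ≤ ∑ a ∈ Finset.Ico (0 : ℤ) p, s₀.ivec dbar a)
    (hph0 : s.ireg phases = 0) :
    WP (.loop (0 ≺ left) phase) s fun s' t =>
      t ≤ 500 * augWork p q N (s₀.imat cbar) (s.imat flow) (s.ireg left) +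
        868 * (p + q + 1) ^ 2 * (N + 1) + 4 ∧
      PhaseInv p q s₀ s' ∧ s'.ireg left = 0 ∧ s'.ireg phases ≤ N + 1 := by
  set Good : ℕ → Store → Prop := fun n s' => PhaseInv p q s₀ s' ∧
      Blocked p q (s₀.ivec dbar) (s₀.ivec sbar) (s₀.imat cbar) (s'.imat flow) (s'.ivec recv)
        (s'.ivec used) (s'.ivec y) ∧ s'.ireg phases ≤ N + 1 ∧
      (∀ v : ℤ, p ≤ v → v < p + q → s'.ivec used (v - p) < s₀.ivec sbar (v - p) →
        s'.ireg phases ≤ s'.ivec y v) ∧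
      500 * augWork p q N (s₀.imat cbar) (s'.imat flow) (s'.ireg left) +
        868 * (p + q + 1) ^ 2 * (N + 1 - s'.ireg phases) ≤ n
  obtain ⟨n₁, hn₁⟩ : ∃ n₁ : ℕ, (n₁ : ℤ) =
      500 * augWork p q N (s₀.imat cbar) (s.imat flow) (s.ireg left) +
        868 * (p + q + 1) ^ 2 * (N + 1) := by
    have h2 := hI.feasible.augWork_nonneg hcb hN hI.left_eq
    exact ⟨_, Int.toNat_of_nonneg (by positivity)⟩
  refine (WP_loop Good n₁ ⟨hI, hbl, by omega, fun v h0 h1 hv => ?_, ?_⟩ ?_).mono ?_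
  · rw [hph0]
    exact hI.feasible.dual_supply v h0 h1
  · rw [hph0, sub_zero, hn₁]
  · rintro n s₁ hk₁ ⟨hI₁, hbl₁, hp₁, hy₁, hn⟩ hB
    refine (phase_spec hI₁ hbl₁ hcb hN hcN hsd hB hy₁).mono ?_
    rintro s₂ t₂ hk₂ ⟨ht₂, hI₂, hbl₂, hph₂, hp₂, hy₂⟩
    have h2 := hI₂.feasible.augWork_nonneg hcb hN hI₂.left_eq
    have h3 : (0 : ℤ) ≤ 868 * (p + q + 1) ^ 2 * (N + 1 - s₂.ireg phases) :=
      mul_nonneg (by positivity) (by omega)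
    have h4 : (868 * (p + q + 1) ^ 2 * (N + 1 - s₁.ireg phases) : ℤ) =
        868 * (p + q + 1) ^ 2 * (N + 1 - s₂.ireg phases) + 864 * (p + q + 1) ^ 2 +
          4 * (p + q + 1) ^ 2 := by
      rw [hph₂]
      ring
    have h5 : (1 : ℤ) ≤ (p + q + 1) ^ 2 := one_le_pow₀ (by omega)
    refine ⟨n - (t₂ + 4), ?_, hI₂, hbl₂, hp₂, hy₂, ?_⟩
    · simp
      omega
    · omega
  · rintro s₁ t₁ - ⟨n, hn, ⟨hI₁, hbl₁, hp₁, hy₁, -⟩, hB⟩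
    have h1 := hI₁.feasible.left_nonneg
    rw [← hI₁.left_eq] at h1
    simp only [BExp.holds_ilt, IExp.eval_zero, IExp.eval_reg] at hB
    refine ⟨?_, hI₁, by omega, hp₁⟩
    simp at hn
    omega

/-- For the zero plan all residual edges are forward, and with zero weights their slacks are c̄ + 1
≥ 1. So there is no admissible edge at all: any rank certifies acyclicity, and the set of supply
nodes certifies blockedness, which already makes the first phase raise the weights. -/
theorem initPlan_spec {s : Store} {p q : ℕ} (hp : s.ireg nA = p) (hq : s.ireg nB = q)
    (hcb : ∀ a b : ℤ, 0 ≤ a → a < p → 0 ≤ b → b < q → 0 ≤ s.imat cbar a b)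
    (hdb : ∀ a : ℤ, 0 ≤ a → a < p → 0 ≤ s.ivec dbar a)
    (hsb : ∀ b : ℤ, 0 ≤ b → b < q → 0 ≤ s.ivec sbar b) :
    WP initPlan s fun s' t => t ≤ 100 * (p + q + 1) ^ 2 ∧ PhaseInv p q s s' ∧
      Blocked p q (s.ivec dbar) (s.ivec sbar) (s.imat cbar) (s'.imat flow) (s'.ivec recv)
        (s'.ivec used) (s'.ivec y) ∧ flowCost p q (s.imat cbar) (s'.imat flow) = 0 ∧
      s'.ireg left = ∑ b ∈ Finset.Ico (0 : ℤ) q, s.ivec sbar b ∧ s'.ireg phases = 0 := by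
  unfold initPlan
  refine WP.seq (WP_forTo p (10 + q * 20 + 10) (fun i s' => ∀ a : ℤ, 0 ≤ a → a < i →
    s'.ivec recv a = 0 ∧ ∀ b : ℤ, 0 ≤ b → b < q → s'.imat flow a b = 0) rfl ?_ ?_ ?_) ?_
  · intro s' hk
    simp [hk.ireg nA rfl, hp]
  · intro a h0 h1
    omega
  · intro i s' hk hi0 hiN hi hI
    refine WP_seq.2 (WP_ivset.2 ((WP_forTo q 10 (fun j s'' => (∀ b : ℤ, 0 ≤ b → b < j →
      s''.imat flow i b = 0) ∧ ∀ a : ℤ, a ≠ i → s''.imat flow a = s'.imat flow a)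
        rfl ?_ ?_ ?_).mono ?_))
    · intro s'' hk'
      have := hk'.ireg nB rfl
      simp only [Store.setIVec_ireg, hk.ireg nB rfl, hq] at this
      simp [this]
    · exact ⟨fun b h0 h1 => by omega, fun a _ => rfl⟩
    · rintro j s'' hk' hj0 hjN hj ⟨hI', hI''⟩
      have ha : s''.ireg a = i := (hk'.ireg a rfl).trans hi
      simp only [WP_imset, IExp.eval_reg, IExp.eval_zero, ha, hj, Store.setIReg_imat,
        Store.setIMat_imat, if_true]
      refine ⟨by simp, fun b hb0 hb => ?_, fun a' ha' => ?_⟩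
      · rw [update_update_apply]
        split_ifs with h
        · rfl
        · exact hI' b hb0 (by omega)
      · rw [Function.update_of_ne ha', hI'' a' ha']
    · rintro s'' t hk' ⟨ht, hI', hI''⟩
      have hr : s''.ivec recv = Function.update (s'.ivec recv) i 0 := by
        rw [hk'.ivec recv rfl]
        simp [hi]
      refine ⟨by simp at ht ⊢; omega, fun a h0 h1 => ?_⟩
      simp only [Store.setIReg_ivec, Store.setIReg_imat, hr]
      rcases eq_or_ne a i with rfl | hai
      · exact ⟨by simp, hI'⟩
      · rw [Function.update_of_ne hai, hI'' a hai]
        exact hI a h0 (by omega)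
  rintro s₁ t₁ hk₁ ⟨ht₁, hI₁⟩
  have e1 : s₁.ireg nB = q := (hk₁.ireg nB rfl).trans hq
  have e2 : s₁.ivec sbar = s.ivec sbar := hk₁.ivec sbar rfl
  refine WP_seq.2 (WP_iset.2 (WP.seq (WP_forTo q 20 (fun i s' =>
    (∀ b : ℤ, 0 ≤ b → b < i → s'.ivec used b = 0) ∧
      s'.ireg left = ∑ b ∈ Finset.Ico (0 : ℤ) i, s.ivec sbar b) rfl ?_ ?_ ?_) ?_))
  · intro s' hk
    have := hk.ireg nB rfl
    simp only [Store.setIReg_ireg, reduceCtorEq, if_false, e1] at this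
    simp [this]
  · refine ⟨fun b h0 h1 => by omega, by simp⟩
  · rintro i s' hk hi0 hiN hi ⟨hI, hI'⟩
    have e3 : s'.ivec sbar = s.ivec sbar := (hk.ivec sbar rfl).trans e2
    simp only [WP_seq, WP_ivset, WP_iset, IExp.eval_reg, IExp.eval_zero, IExp.eval_add',
      IExp.eval_vec, Store.setIReg_ivec, Store.setIReg_ireg, Store.setIVec_ivec,
      Store.setIVec_ireg, reduceCtorEq, if_true, if_false, hi, hI', e3]
    refine ⟨by simp, fun b h0 h1 => ?_, ?_⟩
    · rcases eq_or_ne b i with rfl | hb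
      · simp
      · rw [Function.update_of_ne hb]
        exact hI b h0 (by omega)
    · rw [← Finset.insert_Ico_right_eq_Ico_add_one hi0, Finset.sum_insert (by simp), add_comm]
  rintro s₂ t₂ hk₂ ⟨ht₂, hu₂, hl₂⟩
  have f1 : s₂.ireg nB = q := by rw [hk₂.ireg nB rfl]; simp [e1]
  have f2 : s₂.ireg nA = p := by rw [hk₂.ireg nA rfl]; simp [hk₁.ireg nA rfl, hp]
  refine WP.seq (WP_forTo (p + q) 10 (fun i s' => ∀ v : ℤ, 0 ≤ v → v < i → s'.ivec y v = 0)
    rfl ?_ ?_ ?_) ?_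
  · intro s' hk
    simp [hk.ireg nA rfl, hk.ireg nB rfl, f1, f2]
  · intro v h0 h1
    omega
  · intro i s' hk hi0 hiN hi hI
    simp only [WP_ivset, IExp.eval_reg, IExp.eval_zero, Store.setIReg_ivec, Store.setIVec_ivec,
      if_true, hi]
    refine ⟨by simp, fun v h0 h1 => ?_⟩
    rcases eq_or_ne v i with rfl | hb
    · simp
    · rw [Function.update_of_ne hb]
      exact hI v h0 (by omega)
  rintro s₃ t₃ hk₃ ⟨ht₃, hy₃'⟩
  have hy₃ : ∀ v : ℤ, 0 ≤ v → v < p + q → s₃.ivec y v = 0 :=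
    fun v h0 h1 => hy₃' v h0 (by push_cast; exact h1)
  have g1 : s₃.ivec recv = s₁.ivec recv := (hk₃.ivec recv rfl).trans (hk₂.ivec recv rfl)
  have g2 : s₃.imat flow = s₁.imat flow := (hk₃.imat flow rfl).trans (hk₂.imat flow rfl)
  have g3 : s₃.ivec used = s₂.ivec used := hk₃.ivec used rfl
  have g4 : s₃.ireg left = ∑ b ∈ Finset.Ico (0 : ℤ) q, s.ivec sbar b :=
    (hk₃.ireg left rfl).trans hl₂
  rw [← g1, ← g2] at hI₁
  rw [← g3] at hu₂
  refine WP_iset.2 ⟨?_, ⟨⟨?_, ?_, ?_, ?_, ?_, ?_, ?_, ?_, ?_, ?_⟩, ?_, ?_, ?_, ?_, ?_, ?_⟩, ?_, ?_,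
    ?_, ?_⟩ <;> try simp only [Store.setIReg_ivec, Store.setIReg_imat, Store.setIReg_ireg, reduceCtorEq,
      if_true, if_false, IExp.eval_zero]
  · simp at ht₁ ht₂ ht₃ ⊢
    nlinarith
  · intro a b ha0 ha hb0 hb
    rw [(hI₁ a ha0 ha).2 b hb0 hb]
  · intro a ha0 ha
    rw [(hI₁ a ha0 ha).1, eq_comm]
    refine Finset.sum_eq_zero fun b hb => ?_
    rw [Finset.mem_Ico] at hb
    exact (hI₁ a ha0 ha).2 b hb.1 hb.2
  · intro b hb0 hb
    rw [hu₂ b hb0 hb, eq_comm]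
    refine Finset.sum_eq_zero fun a ha => ?_
    rw [Finset.mem_Ico] at ha
    exact (hI₁ a ha.1 ha.2).2 b hb0 hb
  · intro a ha0 ha
    rw [(hI₁ a ha0 ha).1]
    exact hdb a ha0 ha
  · intro b hb0 hb
    rw [hu₂ b hb0 hb]
    exact hsb b hb0 hb
  · rintro u v hu0 hu hv0 hv (⟨h1, h2, h3⟩ | ⟨h1, h2, h3⟩)
    · rw [(hI₁ u hu0 h1).2 (v - p) (by omega) (by omega)] at h3
      omega
    · have := hcb v (u - p) hv0 h2 (by omega) (by omega)
      rw [Slk, if_neg (by omega), hy₃ u hu0 hu, hy₃ v hv0 hv]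
      omega
  · intro v hv0 hv
    rw [hy₃ v (by omega) hv]
  · intro v hv0 hv
    rw [hy₃ v hv0 (by omega)]
  · intro v hv0 hv _
    exact hy₃ v hv0 (by omega)
  · refine ⟨fun _ => 0, ?_⟩
    rintro u v hu0 hu hv0 hv (⟨h1, h2, h3⟩ | ⟨h1, h2, h3⟩) hS
    · rw [(hI₁ u hu0 h1).2 (v - p) (by omega) (by omega)] at h3
      omega
    · have := hcb v (u - p) hv0 h2 (by omega) (by omega)
      rw [Slk, if_neg (by omega), hy₃ u hu0 hu, hy₃ v hv0 hv] at hS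
      omega
  · rw [g4, eq_comm, sub_eq_self]
    refine Finset.sum_eq_zero fun b hb => ?_
    rw [Finset.mem_Ico] at hb
    exact hu₂ b hb.1 hb.2
  · exact (hk₃.ireg nA rfl).trans f2
  · exact (hk₃.ireg nB rfl).trans f1
  · exact (hk₃.ivec dbar rfl).trans ((hk₂.ivec dbar rfl).trans (hk₁.ivec dbar rfl))
  · exact (hk₃.ivec sbar rfl).trans ((hk₂.ivec sbar rfl).trans (hk₁.ivec sbar rfl))
  · exact (hk₃.imat cbar rfl).trans ((hk₂.imat cbar rfl).trans (hk₁.imat cbar rfl))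
  · refine ⟨fun v => p ≤ v, fun v h0 _ _ => h0, ?_, fun a _ h1 _ h2 => by omega⟩
    rintro u v hu0 hu hv0 hv (⟨h1, h2, h3⟩ | ⟨h1, h2, h3⟩) hS hpu
    · omega
    · have := hcb v (u - p) hv0 h2 (by omega) (by omega)
      rw [Slk, if_neg (by omega), hy₃ u hu0 hu, hy₃ v hv0 hv] at hS
      omega
  · refine Finset.sum_eq_zero fun a ha => Finset.sum_eq_zero fun b hb => ?_
    rw [Finset.mem_Ico] at ha hb
    rw [(hI₁ a ha.1 ha.2).2 b hb.1 hb.2, zero_mul]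
  · exact g4

/-! ### Scaling -/

/-- A double loop over all edges. -/
theorem WP_forTo_forTo {s : Store} {c : Cmd} {p q : ℕ} (T : ℕ) (Inv : ℤ → ℤ → Store → Prop)
    (hp : s.ireg nA = p) (hq : s.ireg nB = q)
    (ha : c.Writes (.i a) = false) (hb : c.Writes (.i b) = false)
    (hnA : c.Writes (.i nA) = false) (hnB : c.Writes (.i nB) = false)
    (h0 : ∀ s', Keeps (forTo a nA (forTo b nB c)) s s' → s' = s.setIReg a 0 → Inv 0 0 s')
    (hnext : ∀ (i : ℤ) s', Inv i q s' → Inv (i + 1) 0 (s'.setIReg a (i + 1)))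
    (hreg : ∀ i s', Inv i 0 s' → Inv i 0 (s'.setIReg b 0))
    (hstep : ∀ (i j : ℤ) s', Keeps (forTo a nA (forTo b nB c)) s s' → 0 ≤ i → i < p → 0 ≤ j →
      j < q → s'.ireg a = i → s'.ireg b = j → Inv i j s' →
      WP c s' fun s'' t => t ≤ T ∧ Inv i (j + 1) (s''.setIReg b (j + 1))) :
    WP (forTo a nA (forTo b nB c)) s fun s' t => t ≤ p * (q * (T + 8) + 14) + 6 ∧ Inv p 0 s' := by
  have hw : ∀ l, (forTo a nA (forTo b nB c)).Writes l = false →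
      (forTo b nB c).Writes l = false := by
    intro l hl
    simp only [forTo, Cmd.Writes, Bool.or_eq_false_iff] at hl ⊢
    exact hl.2.1
  have hkA : (forTo a nA (forTo b nB c)).Writes (.i nA) = false := by
    simp [forTo, Cmd.Writes, hnA]
  have hkB : (forTo a nA (forTo b nB c)).Writes (.i nB) = false := by
    simp [forTo, Cmd.Writes, hnB]
  have hka : (forTo b nB c).Writes (.i a) = false := by simp [forTo, Cmd.Writes, ha]
  refine (WP_forTo p (q * (T + 8) + 6) (fun i s' => Inv i 0 s') hka ?_ ?_ ?_).mono ?_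
  · intro s' hk
    rw [IExp.eval_reg, hk.ireg nA hkA, hp]
  · refine h0 _ ((Exec.iset s a 0).keeps.mono fun l hl => ?_) rfl
    simp only [forTo, Cmd.Writes, Bool.or_eq_false_iff] at hl ⊢
    exact hl.1
  · intro i s' hk hi0 hi hia hI
    refine (WP_forTo q T (fun j s'' => Inv i j s'') hb ?_ (hreg _ _ hI) ?_).mono ?_
    · intro s'' hk'
      rw [IExp.eval_reg, hk'.ireg nB (hw _ hkB), hk.ireg nB hkB, hq]
    · intro j s'' hk' hj0 hj hjb hI'
      exact hstep i j s'' (hk.trans (hk'.mono hw)) hi0 hi hj0 hj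
        ((hk'.ireg a hka).trans hia) hjb hI'
    · rintro s'' t - ⟨ht, hI'⟩
      refine ⟨by simp at ht; omega, hnext i s'' hI'⟩
  · rintro s' t - ⟨ht, hI⟩
    refine ⟨?_, hI⟩
    simp at ht
    nlinarith

theorem totalSupply_spec {s : Store} {q : ℕ} (hq : s.ireg nB = q) :
    WP (totalS.set 0 ;; forTo b nB (totalS.set (totalS + supply b))) s fun s' t =>
      t ≤ 20 * q + 10 ∧ s'.rreg totalS = ∑ b ∈ Finset.Ico (0 : ℤ) q, s.rvec supply b := by
  refine WP_seq.2 (WP_rset.2 ((WP_forTo q 10 (fun i s' =>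
    s'.rreg totalS = ∑ b ∈ Finset.Ico (0 : ℤ) i, s.rvec supply b) rfl ?_ ?_ ?_).mono ?_))
  · intro s' hk
    have := hk.ireg nB rfl
    simp only [Store.setRReg_ireg, hq] at this
    simp [this]
  · simp
  · intro i s' hk hi0 hi hib hI
    have e : s'.rvec supply = s.rvec supply := hk.rvec supply rfl
    simp only [WP_rset, RExp.eval_add', RExp.eval_reg, RExp.eval_vec, IExp.eval_reg, hib, hI, e,
      Store.setIReg_rreg, Store.setRReg_rreg, if_true]
    refine ⟨by simp, ?_⟩
    rw [← Finset.insert_Ico_right_eq_Ico_add_one hi0, Finset.sum_insert (by simp), add_comm]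
  · rintro s' t - ⟨ht, h⟩
    exact ⟨by simp at ht ⊢; omega, h⟩

theorem maxCost_spec {s : Store} {p q : ℕ} (hp : s.ireg nA = p) (hq : s.ireg nB = q) {C : ℝ}
    (hC : 0 ≤ C)
    (hle : ∀ a b : ℤ, 0 ≤ a → a < p → 0 ≤ b → b < q → s.rmat cost a b ≤ C)
    (heq : ∃ a b : ℤ, 0 ≤ a ∧ a < p ∧ 0 ≤ b ∧ b < q ∧ s.rmat cost a b = C) :
    WP (maxC.set 0 ;;
      forTo a nA (forTo b nB (when (maxC ≺ᵣ cost a b) (maxC.set (cost a b))))) s fun s' t =>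
      t ≤ p * (q * 28 + 14) + 10 ∧ s'.rreg maxC = C := by
  -- Starting the maximum from 0 is harmless because `C` is nonnegative. Edges before the current
  -- one are those smaller in the lexicographic order.
  refine WP_seq.2 (WP_rset.2 ((WP_forTo_forTo 20 (fun i j s' => 0 ≤ s'.rreg maxC ∧
    s'.rreg maxC ≤ C ∧ ∀ a b : ℤ, 0 ≤ a → 0 ≤ b → b < q → (a < i ∨ a = i ∧ b < j) →
      s.rmat cost a b ≤ s'.rreg maxC) (by simpa using hp) (by simpa using hq) rfl rfl rfl rfl
      ?_ ?_ ?_ ?_).mono ?_))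
  · rintro s' - rfl
    refine ⟨by simp, by simpa using hC, fun a b h0 h1 h2 h3 => by omega⟩
  · rintro i s' ⟨h1, h2, h3⟩
    exact ⟨h1, h2, fun a b h4 h5 h6 h7 => h3 a b h4 h5 h6 (by omega)⟩
  · exact fun i s' h => h
  · rintro i j s' hk hi0 hi hj0 hj hia hjb ⟨h1, h2, h3⟩
    have e : s'.rmat cost = s.rmat cost := hk.rmat cost rfl
    simp only [WP_when, WP_rset, BExp.holds_rlt, RExp.eval_reg, RExp.eval_mat, IExp.eval_reg, hia,
      hjb, e, Store.setIReg_rreg, Store.setRReg_rreg, if_true]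
    refine ⟨fun hc => ⟨by simp, by linarith, hle i j hi0 hi hj0 hj, fun a b h4 h5 h6 h7 => ?_⟩,
      fun hc => ⟨by simp, h1, h2, fun a b h4 h5 h6 h7 => ?_⟩⟩
    · by_cases h : a = i ∧ b = j
      · rw [h.1, h.2]
      · exact (h3 a b h4 h5 h6 (by omega)).trans hc.le
    · by_cases h : a = i ∧ b = j
      · rw [h.1, h.2]
        exact not_lt.1 hc
      · exact h3 a b h4 h5 h6 (by omega)
  · rintro s' t - ⟨ht, -, h1, h2⟩
    refine ⟨by simp at ht ⊢; omega, le_antisymm h1 ?_⟩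
    obtain ⟨a, b, ha0, ha, hb0, hb, hab⟩ := heq
    rw [← hab]
    exact h2 a b ha0 hb0 hb (Or.inl ha)

theorem scaleVec_spec {s : Store} {p q : ℕ} (hp : s.ireg nA = p) (hq : s.ireg nB = q) :
    WP (forTo a nA (tmp.setFloor (0 - demand a * alpha) ;; dbar.set a (0 - tmp)) ;;
      forTo b nB (tmp.setFloor (supply b * alpha) ;; sbar.set b tmp)) s fun s' t =>
      t ≤ 40 * (p + q) + 20 ∧
      (∀ a : ℤ, 0 ≤ a → a < p → s'.ivec dbar a = ⌈s.rvec demand a * s.rreg alpha⌉) ∧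
      ∀ b : ℤ, 0 ≤ b → b < q → s'.ivec sbar b = ⌊s.rvec supply b * s.rreg alpha⌋ := by
  refine WP.seq (WP_forTo p 20 (fun i s' => ∀ a : ℤ, 0 ≤ a → a < i →
    s'.ivec dbar a = ⌈s.rvec demand a * s.rreg alpha⌉) rfl ?_ ?_ ?_) ?_
  · intro s' hk
    simp [hk.ireg nA rfl, hp]
  · intro a h0 h1
    omega
  · intro i s' hk hi0 hi hia hI
    simp only [WP_seq, WP_ifloor, WP_ivset, RExp.eval_zero, RExp.eval_sub', RExp.eval_mul',
      RExp.eval_vec, RExp.eval_reg, IExp.eval_reg, IExp.eval_zero, IExp.eval_sub', hia,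
      Store.setIReg_ireg, Store.setIReg_ivec, Store.setIVec_ivec, reduceCtorEq, if_true, if_false,
      hk.rvec demand rfl, hk.rreg alpha rfl]
    refine ⟨by simp, fun a h0 h1 => ?_⟩
    rcases eq_or_ne a i with rfl | ha
    -- The machine only rounds down; the ceiling is obtained as -⌊-x⌋.
    · simp [Int.floor_neg]
    · rw [Function.update_of_ne ha]
      exact hI a h0 (by omega)
  rintro s₁ t₁ hk₁ ⟨ht₁, hI₁⟩
  refine (WP_forTo q 20 (fun i s' => ∀ b : ℤ, 0 ≤ b → b < i →
    s'.ivec sbar b = ⌊s.rvec supply b * s.rreg alpha⌋) rfl ?_ ?_ ?_).mono ?_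
  · intro s' hk
    simp [hk.ireg nB rfl, hk₁.ireg nB rfl, hq]
  · intro a h0 h1
    omega
  · intro i s' hk hi0 hi hia hI
    simp only [WP_seq, WP_ifloor, WP_ivset, RExp.eval_mul',
      RExp.eval_vec, RExp.eval_reg, IExp.eval_reg, hia,
      Store.setIReg_ireg, Store.setIReg_ivec, Store.setIVec_ivec, reduceCtorEq, if_true, if_false,
      hk.rvec supply rfl, hk.rreg alpha rfl, hk₁.rvec supply rfl, hk₁.rreg alpha rfl]
    refine ⟨by simp, fun a h0 h1 => ?_⟩
    rcases eq_or_ne a i with rfl | ha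
    · simp
    · rw [Function.update_of_ne ha]
      exact hI a h0 (by omega)
  · rintro s₂ t₂ hk₂ ⟨ht₂, hI₂⟩
    rw [hk₂.ivec dbar rfl]
    exact ⟨by simp at ht₁ ht₂; omega, hI₁, hI₂⟩

theorem scaleCost_spec {s : Store} {p q : ℕ} (hp : s.ireg nA = p) (hq : s.ireg nB = q) :
    WP (forTo a nA (forTo b nB (tmp.setFloor (2 * cost a b / deltaP) ;; cbar.set a b tmp))) s
      fun s' t => t ≤ p * (q * 38 + 14) + 6 ∧
      ∀ a b : ℤ, 0 ≤ a → a < p → 0 ≤ b → b < q →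
        s'.imat cbar a b = ⌊2 * s.rmat cost a b / s.rreg deltaP⌋ := by
  refine (WP_forTo_forTo 30 (fun i j s' =>
    ∀ a b : ℤ, 0 ≤ a → 0 ≤ b → b < q → (a < i ∨ a = i ∧ b < j) →
      s'.imat cbar a b = ⌊2 * s.rmat cost a b / s.rreg deltaP⌋) hp hq rfl rfl rfl rfl
      ?_ ?_ ?_ ?_).mono ?_
  · rintro s' - rfl a b h0 h1 h2 h3
    omega
  · intro i s' h a b h1 h2 h3 h4
    exact h a b h1 h2 h3 (by omega)
  · exact fun i s' h => h
  · rintro i j s' hk hi0 hi hj0 hj hia hjb h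
    simp only [WP_seq, WP_ifloor, WP_imset, RExp.eval_mul', RExp.eval_div', RExp.eval_two,
      RExp.eval_mat, RExp.eval_reg, IExp.eval_reg, hia, hjb,
      Store.setIReg_ireg, Store.setIReg_imat, Store.setIMat_imat, reduceCtorEq, if_true, if_false,
      hk.rmat cost rfl, hk.rreg deltaP rfl]
    refine ⟨by simp, fun a b h0 h1 h2 h3 => ?_⟩
    rw [update_update_apply]
    split_ifs with hab
    · rw [hab.1, hab.2]
    · exact h a b h0 h1 h2 (by omega)
  · rintro s' t - ⟨ht, h⟩
    exact ⟨by omega, fun a b h0 h1 h2 h3 => h a b h0 h2 h3 (Or.inl h1)⟩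

theorem scaleInstance_spec {s : Store} {p q : ℕ} (hp : s.ireg nA = p) (hq : s.ireg nB = q) {C : ℝ}
    (hC : 0 ≤ C)
    (hle : ∀ a b : ℤ, 0 ≤ a → a < p → 0 ≤ b → b < q → s.rmat cost a b ≤ C)
    (heq : ∃ a b : ℤ, 0 ≤ a ∧ a < p ∧ 0 ≤ b ∧ b < q ∧ s.rmat cost a b = C) {α : ℝ}
    (hα : α = 2 * (p + q) * C /
      (s.rreg eps * (∑ b ∈ Finset.Ico (0 : ℤ) q, s.rvec supply b) * s.rreg delta)) :
    WP scaleInstance s fun s' t => t ≤ 200 * (p + q + 1) ^ 2 ∧ s'.rreg alpha = α ∧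
      (∀ a : ℤ, 0 ≤ a → a < p → s'.ivec dbar a = ⌈s.rvec demand a * α⌉) ∧
      (∀ b : ℤ, 0 ≤ b → b < q → s'.ivec sbar b = ⌊s.rvec supply b * α⌋) ∧
      ∀ a b : ℤ, 0 ≤ a → a < p → 0 ≤ b → b < q →
        s'.imat cbar a b = ⌊2 * s.rmat cost a b / ((1 - s.rreg eps) * s.rreg delta)⌋ := by
  unfold scaleInstance
  refine WP_seq_assoc.2 (WP.seq (totalSupply_spec hq) ?_)
  rintro s₁ t₁ hk₁ ⟨ht₁, hU⟩
  refine WP_seq_assoc.2 (WP.seq (maxCost_spec (p := p) (q := q) (C := C)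
    ((hk₁.ireg nA rfl).trans hp) ((hk₁.ireg nB rfl).trans hq) hC
    (by rwa [hk₁.rmat cost rfl]) (by rwa [hk₁.rmat cost rfl])) ?_)
  rintro s₂ t₂ hk₂ ⟨ht₂, hC₂⟩
  have e1 : s₂.ireg nA = p := (hk₂.ireg nA rfl).trans ((hk₁.ireg nA rfl).trans hp)
  have e2 : s₂.ireg nB = q := (hk₂.ireg nB rfl).trans ((hk₁.ireg nB rfl).trans hq)
  have e3 : s₂.rreg eps = s.rreg eps := (hk₂.rreg eps rfl).trans (hk₁.rreg eps rfl)
  have e4 : s₂.rreg delta = s.rreg delta := (hk₂.rreg delta rfl).trans (hk₁.rreg delta rfl)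
  have e5 : s₂.rreg totalS = ∑ b ∈ Finset.Ico (0 : ℤ) q, s.rvec supply b :=
    (hk₂.rreg totalS rfl).trans hU
  have e6 : s₂.rvec demand = s.rvec demand := (hk₂.rvec demand rfl).trans (hk₁.rvec demand rfl)
  have e7 : s₂.rvec supply = s.rvec supply := (hk₂.rvec supply rfl).trans (hk₁.rvec supply rfl)
  have e8 : s₂.rmat cost = s.rmat cost := (hk₂.rmat cost rfl).trans (hk₁.rmat cost rfl)
  refine WP_seq.2 (WP_rset.2 (WP_seq.2 (WP_rset.2 (WP_seq_assoc.2 (WP.seq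
    (scaleVec_spec (p := p) (q := q) (by simpa using e1) (by simpa using e2)) ?_)))))
  simp only [Store.setRReg_rreg, Store.setRReg_rvec, RExp.eval_div', RExp.eval_mul',
    RExp.eval_sub', RExp.eval_one, RExp.eval_two, RExp.eval_reg, RExp.eval_ofInt, IExp.eval_add',
    IExp.eval_reg, e1, e2, e3, e4, e5, e6, e7, hC₂, reduceCtorEq, if_true, if_false]
  have hα' : 2 * (((p + q : ℤ)) : ℝ) * C /
      (s.rreg eps * (∑ b ∈ Finset.Ico (0 : ℤ) q, s.rvec supply b) * s.rreg delta) = α := by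
    rw [hα]
    push_cast
    rfl
  rw [hα']
  rintro s₃ t₃ hk₃ ⟨ht₃, hd₃, hs₃⟩
  have f1 : s₃.ireg nA = p := (hk₃.ireg nA rfl).trans (by simpa using e1)
  have f2 : s₃.ireg nB = q := (hk₃.ireg nB rfl).trans (by simpa using e2)
  refine (scaleCost_spec f1 f2).mono ?_
  rintro s₄ t₄ hk₄ ⟨ht₄, hc₄⟩
  have g1 : s₃.rreg alpha = α := by
    rw [hk₃.rreg alpha rfl]
    simp
  have g2 : s₃.rreg deltaP = (1 - s.rreg eps) * s.rreg delta := by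
    rw [hk₃.rreg deltaP rfl]
    simp
  have g3 : s₃.rmat cost = s.rmat cost := by
    rw [hk₃.rmat cost rfl]
    exact e8
  rw [g2, g3] at hc₄
  refine ⟨?_, (hk₄.rreg alpha rfl).trans g1, ?_, ?_, hc₄⟩
  · simp at ht₁ ht₂ ht₃ ht₄ ⊢
    nlinarith
  · rwa [hk₄.ivec dbar rfl]
  · rwa [hk₄.ivec sbar rfl]

/-! ### Recovering a plan of the given instance -/

theorem unscale_spec {s : Store} {p q : ℕ} (hp : s.ireg nA = p) (hq : s.ireg nB = q) :
    WP (forTo a nA (forTo b nB (plan.set a b ((flow a b : IExp) / alpha)))) s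
      fun s' t => t ≤ p * (q * 28 + 14) + 6 ∧
      ∀ a b : ℤ, 0 ≤ a → a < p → 0 ≤ b → b < q →
        s'.rmat plan a b = s.imat flow a b / s.rreg alpha := by
  refine (WP_forTo_forTo 20 (fun i j s' =>
    ∀ a b : ℤ, 0 ≤ a → 0 ≤ b → b < q → (a < i ∨ a = i ∧ b < j) →
      s'.rmat plan a b = s.imat flow a b / s.rreg alpha) hp hq rfl rfl rfl rfl
      ?_ ?_ ?_ ?_).mono ?_
  · rintro s' - rfl a b h0 h1 h2 h3
    omega
  · intro i s' h a b h1 h2 h3 h4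
    exact h a b h1 h2 h3 (by omega)
  · exact fun i s' h => h
  · rintro i j s' hk hi0 hi hj0 hj hia hjb h
    simp only [WP_rmset, RExp.eval_div', RExp.eval_ofInt, IExp.eval_mat, RExp.eval_reg,
      IExp.eval_reg, hia, hjb, Store.setIReg_rmat, Store.setRMat_rmat, if_true,
      hk.imat flow rfl, hk.rreg alpha rfl]
    refine ⟨by simp, fun a b h0 h1 h2 h3 => ?_⟩
    rw [update_update_apply]
    split_ifs with hab
    · rw [hab.1, hab.2]
    · exact h a b h0 h1 h2 (by omega)
  · rintro s' t - ⟨ht, h⟩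
    exact ⟨by omega, fun a b h0 h1 h2 h3 => h a b h0 h2 h3 (Or.inl h1)⟩

/-- The row `P a` has been reduced from `x a` to the demand `d`. -/
structure RowReduced (q : ℕ) (d : ℝ) (x P : ℤ → ℝ) (rm : ℝ) : Prop where
  nonneg : ∀ b : ℤ, 0 ≤ b → b < q → 0 ≤ P b
  le : ∀ b : ℤ, 0 ≤ b → b < q → P b ≤ x b
  sum_eq : ∑ b ∈ Finset.Ico (0 : ℤ) q, P b = min d (∑ b ∈ Finset.Ico (0 : ℤ) q, x b)
  room_eq : rm = d - min d (∑ b ∈ Finset.Ico (0 : ℤ) q, x b)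

theorem sum_Ico_succ {M : Type*} [AddCommMonoid M] (f : ℤ → M) {i : ℤ} (hi : 0 ≤ i) :
    ∑ j ∈ Finset.Ico (0 : ℤ) (i + 1), f j = ∑ j ∈ Finset.Ico (0 : ℤ) i, f j + f i := by
  rw [← Finset.insert_Ico_right_eq_Ico_add_one hi, Finset.sum_insert (by simp), add_comm]

/-- The register `acc` holds the excess not yet removed. At each moment it is 0 or all entries
treated so far are 0. If the whole row were emptied, the balance would make `acc` equal to minus the
minimum of the demand and the row sum, so nonnegativity gives `acc = 0` in that case too. -/
theorem reduceRow_spec {s : Store} {q : ℕ} {i : ℤ} (hq : s.ireg nB = q) (hi : s.ireg a = i)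
    {x : ℤ → ℝ} (hx0 : ∀ b : ℤ, 0 ≤ b → b < q → 0 ≤ x b)
    (hx : ∀ b : ℤ, 0 ≤ b → b < q → s.rmat plan i b = x b) (hd : 0 ≤ s.rvec demand i) :
    WP (acc.set 0 ;;
     forTo b nB (acc.set (acc + plan a b)) ;;
     room.set a (demand a - min (demand a) acc) ;;
     acc.set (acc - min (demand a) acc) ;;
     forTo b nB
       (m.set (min (plan a b) acc) ;;
        plan.set a b (plan a b - m) ;;
        acc.set (acc - m))) s fun s' t => t ≤ 80 * q + 60 ∧
      RowReduced q (s.rvec demand i) x (s'.rmat plan i) (s'.rvec room i) ∧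
      (∀ a, a ≠ i → s'.rmat plan a = s.rmat plan a) ∧
      ∀ a, a ≠ i → s'.rvec room a = s.rvec room a := by
  refine WP_seq.2 (WP_rset.2 (WP.seq (WP_forTo q 10 (fun j s' =>
    s'.rreg acc = ∑ b ∈ Finset.Ico (0 : ℤ) j, x b) rfl ?_ ?_ ?_) ?_))
  · intro s' hk
    have := hk.ireg nB rfl
    simp only [Store.setRReg_ireg, hq] at this
    simp [this]
  · simp
  · intro j s' hk hj0 hj hjb hI
    have e1 : s'.rmat plan = s.rmat plan := hk.rmat plan rfl
    have e2 : s'.ireg a = i := (hk.ireg a rfl).trans hi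
    simp only [WP_rset, RExp.eval_add', RExp.eval_reg, RExp.eval_mat, IExp.eval_reg, hjb, e2, hI,
      e1, Store.setIReg_rreg, Store.setRReg_rreg, if_true]
    refine ⟨by simp, ?_⟩
    rw [sum_Ico_succ _ hj0, hx j hj0 hj]
  rintro s₁ t₁ hk₁ ⟨ht₁, hX⟩
  set X := ∑ b ∈ Finset.Ico (0 : ℤ) q, x b with hXdef
  have e1 : s₁.ireg a = i := (hk₁.ireg a rfl).trans hi
  have e2 : s₁.ireg nB = q := (hk₁.ireg nB rfl).trans hq
  have e3 : s₁.rvec demand = s.rvec demand := hk₁.rvec demand rfl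
  have e4 : s₁.rmat plan = s.rmat plan := hk₁.rmat plan rfl
  have e5 : s₁.rvec room = s.rvec room := hk₁.rvec room rfl
  have hX0 : 0 ≤ X := Finset.sum_nonneg fun b hb => by
    rw [Finset.mem_Ico] at hb
    exact hx0 b hb.1 hb.2
  refine WP_seq.2 (WP_rvset.2 (WP_seq.2 (WP_rset.2 ?_)))
  simp only [RExp.eval_sub', RExp.eval_min', RExp.eval_vec, RExp.eval_reg, IExp.eval_reg,
    Store.setRVec_rreg, Store.setRVec_rvec, Store.setRVec_ireg, reduceCtorEq, if_false, e1, e3, hX]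
  refine (WP_forTo q 50 (fun j s' =>
    0 ≤ s'.rreg acc ∧ ∑ b ∈ Finset.Ico (0 : ℤ) j, (x b - s'.rmat plan i b) + s'.rreg acc =
      X - min (s.rvec demand i) X ∧
    (s'.rreg acc = 0 ∨ ∀ b : ℤ, 0 ≤ b → b < j → s'.rmat plan i b = 0) ∧
    (∀ b : ℤ, 0 ≤ b → b < q → 0 ≤ s'.rmat plan i b ∧ s'.rmat plan i b ≤ x b) ∧
    (∀ b : ℤ, j ≤ b → b < q → s'.rmat plan i b = x b) ∧
    ∀ a, a ≠ i → s'.rmat plan a = s.rmat plan a) rfl ?_ ?_ ?_).mono ?_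
  · intro s' hk
    have := hk.ireg nB rfl
    simp only [Store.setRReg_ireg, Store.setRVec_ireg, e2] at this
    simp [this]
  · refine ⟨by simp, by simp, Or.inr fun b h0 h1 => by omega, fun b h0 h1 => ?_,
      fun b h0 h1 => ?_, fun a ha => ?_⟩ <;>
      simp only [Store.setIReg_rmat, Store.setRReg_rmat, Store.setRVec_rmat, e4]
    · rw [hx b h0 h1]
      exact ⟨hx0 b h0 h1, le_rfl⟩
    · exact hx b h0 h1
  · rintro j s' hk hj0 hj hjb ⟨h1, h2, h3, h4, h5, h6⟩
    have f1 : s'.ireg a = i := (hk.ireg a rfl).trans e1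
    have h5j := h5 j le_rfl hj
    have h0j := hx0 j hj0 hj
    simp only [WP_seq, WP_rset, WP_rmset, RExp.eval_sub', RExp.eval_min', RExp.eval_mat,
      RExp.eval_reg, IExp.eval_reg, f1, hjb, Store.setRReg_ireg, Store.setRReg_rmat,
      Store.setRReg_rreg, Store.setRMat_rreg, Store.setRMat_rmat, Store.setIReg_rreg,
      Store.setIReg_rmat, reduceCtorEq, if_true, if_false, h5j, update_update_apply, true_and]
    refine ⟨by simp, by linarith [min_le_right (x j) (s'.rreg acc)], ?_, ?_, fun b hb0 hb => ?_,
      fun b hb0 hb => ?_, fun a ha => ?_⟩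
    · have hs : ∀ b ∈ Finset.Ico (0 : ℤ) j,
          (x b - if b = j then x j - min (x j) (s'.rreg acc) else s'.rmat plan i b) =
            x b - s'.rmat plan i b := fun b hb => by
        rw [Finset.mem_Ico] at hb
        rw [if_neg (by omega)]
      rw [sum_Ico_succ _ hj0, if_pos rfl, Finset.sum_congr rfl hs, ← h2]
      ring
    · rcases le_total (x j) (s'.rreg acc) with h | h
      · rcases h3 with h3 | h3
        · left
          rw [min_eq_left h]
          linarith
        · right
          intro b hb0 hb
          split_ifs with hbj
          · rw [min_eq_left h, sub_self]
          · exact h3 b hb0 (by omega)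
      · left
        rw [min_eq_right h, sub_self]
    · split_ifs with hbj
      · rw [hbj]
        have := min_le_left (x j) (s'.rreg acc)
        have := le_min h0j h1
        constructor <;> linarith
      · exact h4 b hb0 hb
    · rw [if_neg (by omega)]
      exact h5 b (by omega) hb
    · rw [Function.update_of_ne ha]
      exact h6 a ha
  · rintro s₂ t₂ hk₂ ⟨ht₂, h1, h2, h3, h4, h5, h6⟩
    have hr : s₂.rvec room = Function.update (s.rvec room) i
        (s.rvec demand i - min (s.rvec demand i) X) := by
      rw [hk₂.rvec room rfl]
      simp [e5]
    have hm0 := le_min hd hX0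
    rw [Finset.sum_sub_distrib, ← hXdef] at h2
    have hacc : s₂.rreg acc = 0 := by
      rcases h3 with h3 | h3
      · exact h3
      · rw [Finset.sum_eq_zero (f := fun b => s₂.rmat plan i b) fun b hb => by
          rw [Finset.mem_Ico] at hb
          exact h3 b hb.1 hb.2] at h2
        linarith
    refine ⟨by simp at ht₁ ht₂ ⊢; omega, ⟨fun b h0 h1 => (h4 b h0 h1).1,
      fun b h0 h1 => (h4 b h0 h1).2, by linarith, by simp [hr, hXdef]⟩, h6, fun a ha => ?_⟩
    rw [hr, Function.update_of_ne ha]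

/-- The state of the greedy completion of the plan `x`: the supplies before `j` are used up, and
nothing has been added for the supply nodes from `k` on. -/
structure FillInv (p q : ℕ) (dm sp : ℤ → ℝ) (x : ℤ → ℤ → ℝ) (j k : ℤ) (P : ℤ → ℤ → ℝ)
    (rm : ℤ → ℝ) : Prop where
  le : ∀ a b : ℤ, 0 ≤ a → a < p → 0 ≤ b → b < q → x a b ≤ P a b
  fresh : ∀ a b : ℤ, 0 ≤ a → a < p → k ≤ b → b < q → P a b = x a b
  room_nonneg : ∀ a : ℤ, 0 ≤ a → a < p → 0 ≤ rm a
  row : ∀ a : ℤ, 0 ≤ a → a < p → ∑ b ∈ Finset.Ico (0 : ℤ) q, P a b + rm a = dm a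
  col : ∀ b : ℤ, 0 ≤ b → b < j → ∑ a ∈ Finset.Ico (0 : ℤ) p, P a b = sp b

theorem FillInv.step {p q : ℕ} {dm sp rm : ℤ → ℝ} {x P : ℤ → ℤ → ℝ} {i j : ℤ} {μ : ℝ}
    (h : FillInv p q dm sp x j (j + 1) P rm) (hi0 : 0 ≤ i) (hi : i < p) (hj0 : 0 ≤ j) (hj : j < q)
    (hμ0 : 0 ≤ μ) (hμ : μ ≤ rm i) :
    FillInv p q dm sp x j (j + 1) (Function.update P i (Function.update (P i) j (P i j + μ)))
      (Function.update rm i (rm i - μ)) := by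
  refine ⟨fun a b ha0 ha hb0 hb => ?_, fun a b ha0 ha hb0 hb => ?_, fun a ha0 ha => ?_,
    fun a ha0 ha => ?_, fun b hb0 hb => ?_⟩
  · rw [update_update_apply]
    have := h.le a b ha0 ha hb0 hb
    split_ifs with hab
    · rw [hab.1, hab.2] at this ⊢
      linarith
    · exact this
  · rw [update_update_apply, if_neg (by omega)]
    exact h.fresh a b ha0 ha hb0 hb
  · rw [Function.update_apply]
    split_ifs with hai
    · linarith
    · exact h.room_nonneg a ha0 ha
  · rw [sum_row_update (by simp [hj0, hj]), Function.update_apply, ← h.row a ha0 ha]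
    split_ifs with hai
    · rw [hai]
      ring
    · ring
  · rw [sum_col_update (by simp [hi0, hi]), if_neg (by omega), add_zero]
    exact h.col b hb0 hb

/-- At each moment the remaining supply `acc` of the column is 0 or the demand nodes visited so far
have no room. If no demand node has room at the end, the plan meets all demands, and since total
supply is at most total demand, nothing can be left. -/
theorem fillColumn_spec {s : Store} {p q : ℕ} {j : ℤ} {sp dm : ℤ → ℝ} {x : ℤ → ℤ → ℝ}
    (hp : s.ireg nA = p) (hj : s.ireg b = j) (hj0 : 0 ≤ j) (hjq : j < q)
    (hsp : s.rvec supply = sp)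
    (hcol : ∀ b : ℤ, 0 ≤ b → b < q → ∑ a ∈ Finset.Ico (0 : ℤ) p, x a b ≤ sp b)
    (hsd : ∑ b ∈ Finset.Ico (0 : ℤ) q, sp b ≤ ∑ a ∈ Finset.Ico (0 : ℤ) p, dm a)
    (h : FillInv p q dm sp x j j (s.rmat plan) (s.rvec room)) :
    WP (acc.set (supply b) ;;
     forTo a nA (acc.set (acc - plan a b)) ;;
     forTo a nA
       (m.set (min (room a) acc) ;;
        plan.set a b (plan a b + m) ;;
        room.set a (room a - m) ;;
        acc.set (acc - m))) s fun s' t => t ≤ 100 * p + 60 ∧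
      FillInv p q dm sp x (j + 1) (j + 1) (s'.rmat plan) (s'.rvec room) := by
  refine WP_seq.2 (WP_rset.2 (WP.seq (WP_forTo p 10 (fun i s' =>
    s'.rreg acc = sp j - ∑ a ∈ Finset.Ico (0 : ℤ) i, s.rmat plan a j) rfl ?_ ?_ ?_) ?_))
  · intro s' hk
    have := hk.ireg nA rfl
    simp only [Store.setRReg_ireg, hp] at this
    simp [this]
  · simp [hj, hsp]
  · intro i s' hk hi0 hi hia hI
    have e1 : s'.rmat plan = s.rmat plan := hk.rmat plan rfl
    have e2 : s'.ireg b = j := (hk.ireg b rfl).trans hj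
    simp only [WP_rset, RExp.eval_sub', RExp.eval_reg, RExp.eval_mat, IExp.eval_reg, hia, e2, hI,
      e1, Store.setIReg_rreg, Store.setRReg_rreg, if_true]
    refine ⟨by simp, ?_⟩
    rw [sum_Ico_succ _ hi0]
    ring
  rintro s₁ t₁ hk₁ ⟨ht₁, hacc⟩
  have e1 : s₁.ireg b = j := (hk₁.ireg b rfl).trans hj
  have e2 : s₁.ireg nA = p := (hk₁.ireg nA rfl).trans hp
  have e4 : s₁.rmat plan = s.rmat plan := hk₁.rmat plan rfl
  have e5 : s₁.rvec room = s.rvec room := hk₁.rvec room rfl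
  rw [← e4] at hacc
  rw [← e4, ← e5] at h
  refine (WP_forTo p 60 (fun i s' => FillInv p q dm sp x j (j + 1) (s'.rmat plan) (s'.rvec room) ∧
    0 ≤ s'.rreg acc ∧
    ∑ a ∈ Finset.Ico (0 : ℤ) p, s'.rmat plan a j + s'.rreg acc = sp j ∧
    (s'.rreg acc = 0 ∨ ∀ a : ℤ, 0 ≤ a → a < i → s'.rvec room a = 0)) rfl ?_ ?_ ?_).mono ?_
  · intro s' hk
    simp [hk.ireg nA rfl, e2]
  · refine ⟨⟨h.le, fun a b ha0 ha hb0 hb => h.fresh a b ha0 ha (by omega) hb, h.room_nonneg, h.row,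
      h.col⟩, ?_, ?_, Or.inr fun a h0 h1 => by omega⟩
    · have h1 := hcol j hj0 hjq
      have h2 : ∑ a ∈ Finset.Ico (0 : ℤ) p, s₁.rmat plan a j = ∑ a ∈ Finset.Ico (0 : ℤ) p, x a j :=
        Finset.sum_congr rfl fun a ha => by
          rw [Finset.mem_Ico] at ha
          exact h.fresh a j ha.1 ha.2 le_rfl hjq
      simp only [Store.setIReg_rreg, hacc]
      linarith
    · simp only [Store.setIReg_rreg, Store.setIReg_rmat, hacc]
      ring
  · rintro i s' hk hi0 hi hia ⟨h1, h2, h3, h4⟩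
    have f1 : s'.ireg b = j := (hk.ireg b rfl).trans e1
    simp only [WP_seq, WP_rset, WP_rvset, WP_rmset, RExp.eval_sub', RExp.eval_add', RExp.eval_min',
      RExp.eval_mat, RExp.eval_vec, RExp.eval_reg, IExp.eval_reg, f1, hia, Store.setRReg_ireg,
      Store.setRReg_rmat, Store.setRReg_rvec, Store.setRReg_rreg, Store.setRMat_rreg,
      Store.setRMat_rmat, Store.setRMat_rvec, Store.setRMat_ireg, Store.setRVec_rreg,
      Store.setRVec_rmat, Store.setRVec_rvec, Store.setIReg_rreg, Store.setIReg_rvec,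
      Store.setIReg_rmat, reduceCtorEq, if_true, if_false]
    have hr0 := h1.room_nonneg i hi0 hi
    have hm1 := min_le_left (s'.rvec room i) (s'.rreg acc)
    have hm2 := min_le_right (s'.rvec room i) (s'.rreg acc)
    refine ⟨by simp, h1.step hi0 hi hj0 hjq (le_min hr0 h2) hm1, by linarith, ?_, ?_⟩
    · rw [sum_col_update (by simp [hi0, hi]), if_pos rfl, ← h3]
      ring
    · rcases le_total (s'.rvec room i) (s'.rreg acc) with h | h
      · rcases h4 with h4 | h4
        · left
          rw [min_eq_left h]
          linarith
        · right
          intro a ha0 ha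
          rw [Function.update_apply]
          split_ifs with hai
          · rw [min_eq_left h, sub_self]
          · exact h4 a ha0 (by omega)
      · left
        rw [min_eq_right h, sub_self]
  · rintro s₂ t₂ hk₂ ⟨ht₂, h1, h2, h3, h4⟩
    have hacc₂ : s₂.rreg acc = 0 := by
      rcases h4 with h4 | h4
      · exact h4
      have h5 : ∑ a ∈ Finset.Ico (0 : ℤ) p, dm a =
          ∑ b ∈ Finset.Ico (0 : ℤ) q, ∑ a ∈ Finset.Ico (0 : ℤ) p, s₂.rmat plan a b := by
        rw [Finset.sum_comm]
        refine Finset.sum_congr rfl fun a ha => ?_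
        rw [Finset.mem_Ico] at ha
        rw [← h1.row a ha.1 ha.2, h4 a ha.1 ha.2, add_zero]
      have h6 : ∑ b ∈ Finset.Ico (0 : ℤ) q, ∑ a ∈ Finset.Ico (0 : ℤ) p, s₂.rmat plan a b ≤
          ∑ b ∈ Finset.Ico (0 : ℤ) q, (sp b - if b = j then s₂.rreg acc else 0) := by
        refine Finset.sum_le_sum fun b hb => ?_
        rw [Finset.mem_Ico] at hb
        rcases lt_trichotomy b j with hbj | rfl | hbj
        · rw [h1.col b hb.1 hbj, if_neg (by omega), sub_zero]
        · rw [if_pos rfl]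
          linarith
        · rw [if_neg (by omega), sub_zero]
          refine le_of_eq_of_le (Finset.sum_congr rfl fun a ha => ?_) (hcol b hb.1 hb.2)
          rw [Finset.mem_Ico] at ha
          exact h1.fresh a b ha.1 ha.2 (by omega) hb.2
      rw [Finset.sum_sub_distrib, Finset.sum_ite_eq', if_pos (by simp [hj0, hjq])] at h6
      linarith
    refine ⟨by simp at ht₁ ht₂ ⊢; omega, h1.le, h1.fresh, h1.room_nonneg, h1.row,
      fun b hb0 hb => ?_⟩
    rcases eq_or_ne b j with rfl | hbj
    · linarith
    · exact h1.col b hb0 (by omega)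

/-- Reduction does not increase the cost, and every unit sent afterwards costs at most `C`. The
amount sent is the total supply minus what survives the reduction, namely the minimum of demand and
row sum at each demand node. -/
theorem recoverPlan_spec {s : Store} {p q : ℕ} {x : ℤ → ℤ → ℝ} (hp : s.ireg nA = p)
    (hq : s.ireg nB = q) (hx : ∀ a b, x a b = s.imat flow a b / s.rreg alpha)
    (hx0 : ∀ a b : ℤ, 0 ≤ a → a < p → 0 ≤ b → b < q → 0 ≤ x a b)
    (hd : ∀ a : ℤ, 0 ≤ a → a < p → 0 ≤ s.rvec demand a)
    (hcol : ∀ b : ℤ, 0 ≤ b → b < q → ∑ a ∈ Finset.Ico (0 : ℤ) p, x a b ≤ s.rvec supply b)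
    (hsd : ∑ b ∈ Finset.Ico (0 : ℤ) q, s.rvec supply b ≤
      ∑ a ∈ Finset.Ico (0 : ℤ) p, s.rvec demand a) :
    WP recoverPlan s fun s' t => t ≤ 500 * (p + q + 1) ^ 2 ∧
      (∀ a b : ℤ, 0 ≤ a → a < p → 0 ≤ b → b < q → 0 ≤ s'.rmat plan a b) ∧
      (∀ a : ℤ, 0 ≤ a → a < p →
        ∑ b ∈ Finset.Ico (0 : ℤ) q, s'.rmat plan a b ≤ s.rvec demand a) ∧
      (∀ b : ℤ, 0 ≤ b → b < q →
        ∑ a ∈ Finset.Ico (0 : ℤ) p, s'.rmat plan a b = s.rvec supply b) ∧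
      ∀ (c : ℤ → ℤ → ℝ) (C : ℝ),
        (∀ a b : ℤ, 0 ≤ a → a < p → 0 ≤ b → b < q → 0 ≤ c a b ∧ c a b ≤ C) →
        ∑ a ∈ Finset.Ico (0 : ℤ) p, ∑ b ∈ Finset.Ico (0 : ℤ) q, s'.rmat plan a b * c a b ≤
          ∑ a ∈ Finset.Ico (0 : ℤ) p, ∑ b ∈ Finset.Ico (0 : ℤ) q, x a b * c a b +
            C * (∑ b ∈ Finset.Ico (0 : ℤ) q, s.rvec supply b - ∑ a ∈ Finset.Ico (0 : ℤ) p,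
              min (s.rvec demand a) (∑ b ∈ Finset.Ico (0 : ℤ) q, x a b)) := by
  unfold recoverPlan
  refine WP.seq (unscale_spec hp hq) ?_
  rintro s₁ t₁ hk₁ ⟨ht₁, hP₁⟩
  simp only [← hx] at hP₁
  have e1 : s₁.ireg nA = p := (hk₁.ireg nA rfl).trans hp
  have e2 : s₁.ireg nB = q := (hk₁.ireg nB rfl).trans hq
  have e3 : s₁.rvec demand = s.rvec demand := hk₁.rvec demand rfl
  have e4 : s₁.rvec supply = s.rvec supply := hk₁.rvec supply rfl
  refine WP.seq (WP_forTo p (80 * q + 60) (fun i s' => ∀ a : ℤ, 0 ≤ a → a < p →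
    (a < i → RowReduced q (s.rvec demand a) (x a) (s'.rmat plan a) (s'.rvec room a)) ∧
    (i ≤ a → ∀ b : ℤ, 0 ≤ b → b < q → s'.rmat plan a b = x a b)) rfl ?_ ?_ ?_) ?_
  · intro s' hk
    simp [hk.ireg nA rfl, e1]
  · exact fun a h0 h1 => ⟨fun h => by omega, fun _ b hb0 hb => hP₁ a b h0 h1 hb0 hb⟩
  · intro i s' hk hi0 hi hia hI
    have f1 : s'.rvec demand = s.rvec demand := (hk.rvec demand rfl).trans e3
    refine (reduceRow_spec (q := q) ((hk.ireg nB rfl).trans e2) hia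
      (fun b hb0 hb => hx0 i b hi0 hi hb0 hb) ((hI i hi0 hi).2 le_rfl)
      (by rw [f1]; exact hd i hi0 hi)).mono ?_
    rintro s'' t - ⟨ht, h1, h2, h3⟩
    rw [f1] at h1
    refine ⟨ht, fun a ha0 ha => ⟨fun hai => ?_, fun hai b hb0 hb => ?_⟩⟩
    · rcases eq_or_ne a i with rfl | h
      · exact h1
      · simp only [Store.setIReg_rmat, Store.setIReg_rvec, h2 a h, h3 a h]
        exact (hI a ha0 ha).1 (by omega)
    · simp only [Store.setIReg_rmat, h2 a (by omega)]
      exact (hI a ha0 ha).2 (by omega) b hb0 hb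
  rintro s₂ t₂ hk₂ ⟨ht₂, hI₂⟩
  have hR : ∀ a : ℤ, 0 ≤ a → a < p →
      RowReduced q (s.rvec demand a) (x a) (s₂.rmat plan a) (s₂.rvec room a) :=
    fun a h0 h1 => (hI₂ a h0 h1).1 h1
  have hcol₂ : ∀ b : ℤ, 0 ≤ b → b < q →
      ∑ a ∈ Finset.Ico (0 : ℤ) p, s₂.rmat plan a b ≤ s.rvec supply b := fun b hb0 hb =>
    (Finset.sum_le_sum fun a ha => by
      rw [Finset.mem_Ico] at ha
      exact (hR a ha.1 ha.2).le b hb0 hb).trans (hcol b hb0 hb)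
  refine (WP_forTo q (100 * p + 60) (fun j s' => FillInv p q (s.rvec demand) (s.rvec supply)
    (s₂.rmat plan) j j (s'.rmat plan) (s'.rvec room)) rfl ?_ ?_ ?_).mono ?_
  · intro s' hk
    simp [hk.ireg nB rfl, hk₂.ireg nB rfl, e2]
  · refine ⟨fun _ _ _ _ _ _ => le_rfl, fun _ _ _ _ _ _ => rfl, fun a ha0 ha => ?_,
      fun a ha0 ha => ?_, fun b hb0 hb => by omega⟩
    · simp only [Store.setIReg_rvec]
      rw [(hR a ha0 ha).room_eq, sub_nonneg]
      exact min_le_left _ _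
    · simp only [Store.setIReg_rvec, Store.setIReg_rmat]
      rw [(hR a ha0 ha).room_eq, (hR a ha0 ha).sum_eq]
      ring
  · intro j s' hk hj0 hj hjb hI
    refine (fillColumn_spec ((hk.ireg nA rfl).trans ((hk₂.ireg nA rfl).trans e1)) hjb hj0 hj
      ((hk.rvec supply rfl).trans ((hk₂.rvec supply rfl).trans e4)) hcol₂ hsd hI).mono ?_
    rintro s'' t - h
    exact h
  · rintro s₃ t₃ - ⟨ht₃, hI⟩
    have hPx : ∀ a b : ℤ, 0 ≤ a → a < p → 0 ≤ b → b < q → s₂.rmat plan a b ≤ s₃.rmat plan a b :=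
      hI.le
    refine ⟨?_, fun a b ha0 ha hb0 hb => ?_, fun a ha0 ha => ?_, fun b hb0 hb => hI.col b hb0 hb,
      fun c C hc => ?_⟩
    · simp at ht₁ ht₂ ht₃ ⊢
      nlinarith
    · exact ((hR a ha0 ha).nonneg b hb0 hb).trans (hPx a b ha0 ha hb0 hb)
    · have := hI.row a ha0 ha
      have := hI.room_nonneg a ha0 ha
      linarith
    · have h1 : ∑ a ∈ Finset.Ico (0 : ℤ) p, ∑ b ∈ Finset.Ico (0 : ℤ) q, s₃.rmat plan a b * c a b ≤
          ∑ a ∈ Finset.Ico (0 : ℤ) p, ∑ b ∈ Finset.Ico (0 : ℤ) q, (x a b * c a b +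
            C * (s₃.rmat plan a b - s₂.rmat plan a b)) := by
        refine Finset.sum_le_sum fun a ha => Finset.sum_le_sum fun b hb => ?_
        rw [Finset.mem_Ico] at ha hb
        have h2 := (hR a ha.1 ha.2).le b hb.1 hb.2
        have h3 := hPx a b ha.1 ha.2 hb.1 hb.2
        obtain ⟨h4, h5⟩ := hc a b ha.1 ha.2 hb.1 hb.2
        nlinarith [mul_le_mul_of_nonneg_right h2 h4,
          mul_le_mul_of_nonneg_right h5 (sub_nonneg.2 h3)]
      refine h1.trans_eq ?_
      simp only [Finset.sum_add_distrib, ← Finset.mul_sum, Finset.sum_sub_distrib]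
      have hc1 : ∀ b ∈ Finset.Ico (0 : ℤ) q,
          ∑ a ∈ Finset.Ico (0 : ℤ) p, s₃.rmat plan a b = s.rvec supply b := fun b hb => by
        rw [Finset.mem_Ico] at hb
        exact hI.col b hb.1 hb.2
      have hr1 : ∀ a ∈ Finset.Ico (0 : ℤ) p, ∑ b ∈ Finset.Ico (0 : ℤ) q, s₂.rmat plan a b =
          min (s.rvec demand a) (∑ b ∈ Finset.Ico (0 : ℤ) q, x a b) := fun a ha => by
        rw [Finset.mem_Ico] at ha
        exact (hR a ha.1 ha.2).sum_eq
      rw [Finset.sum_comm (f := fun a b => s₃.rmat plan a b), Finset.sum_congr rfl hc1,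
        Finset.sum_congr rfl hr1]

/-! ### The cost of the computed plan -/

section

variable {p q : ℕ} {db sb : ℤ → ℤ} {cb fl : ℤ → ℤ → ℤ} {rc us y : ℤ → ℤ}

/-- Complementary slackness at one entry. If τ exceeds the plan, the forward edge is residual and
y(a) + y(b) ≤ c̄ + 1, at a loss of at most τ. If the plan is positive and at least τ, the backward
edge is residual and y(a) + y(b) ≥ c̄. -/
theorem Feasible.slack_mul_le (h : Feasible p q db sb cb fl rc us y) {a b : ℤ} (ha0 : 0 ≤ a)
    (ha : a < p) (hb0 : 0 ≤ b) (hb : b < q) {τ : ℝ} (hτ0 : 0 ≤ τ) (hτd : τ ≤ db a)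
    (hτs : τ ≤ sb b) :
    (τ - fl a b) * (y a + y (p + b)) ≤ (τ - fl a b) * cb a b + τ := by
  have hf0 := h.flow_nonneg a b ha0 ha hb0 hb
  have hfr : (0 : ℝ) ≤ fl a b := by exact_mod_cast hf0
  rcases lt_or_ge (fl a b : ℝ) τ with hlt | hge
  · have hcap : (0 : ℤ) < min (db a) (sb b) - fl a b := by
      have h1 : fl a b < db a := by exact_mod_cast hlt.trans_le hτd
      have h2 : fl a b < sb b := by exact_mod_cast hlt.trans_le hτs
      omega
    have hsl := h.slack_nonneg (p + b) a (by omega) (by omega) ha0 (by omega)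
      (Or.inr ⟨by omega, ha, by simpa using hcap⟩)
    rw [Slk, if_neg (by omega), add_sub_cancel_left] at hsl
    have : (y a : ℝ) + y (p + b) ≤ cb a b + 1 := by
      have : y a + y (p + b) ≤ cb a b + 1 := by omega
      exact_mod_cast this
    nlinarith [mul_le_mul_of_nonneg_left this (sub_pos.2 hlt).le]
  · rcases hf0.eq_or_lt with hf | hf
    · rw [← hf] at hge ⊢
      have : τ = 0 := le_antisymm (by simpa using hge) hτ0
      simp [this]
    · have hsl := h.slack_nonneg a (p + b) ha0 (by omega) (by omega) (by omega)
        (Or.inl ⟨ha, by omega, by simpa using hf⟩)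
      rw [Slk, if_pos ha, add_sub_cancel_left] at hsl
      have : (cb a b : ℝ) ≤ y a + y (p + b) := by
        have : cb a b ≤ y a + y (p + b) := by omega
        exact_mod_cast this
      nlinarith [mul_le_mul_of_nonneg_left this (sub_nonneg.2 hge)]

/-- A plan with feasible dual weights that exhausts the supplies costs at most one unit per unit of
supply more than any other such plan. -/
theorem Feasible.flowCost_le (h : Feasible p q db sb cb fl rc us y)
    (hus : ∀ b : ℤ, 0 ≤ b → b < q → us b = sb b) {τ : ℤ → ℤ → ℝ}
    (hτ0 : ∀ a b : ℤ, 0 ≤ a → a < p → 0 ≤ b → b < q → 0 ≤ τ a b)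
    (hτd : ∀ a : ℤ, 0 ≤ a → a < p → ∑ b ∈ Finset.Ico (0 : ℤ) q, τ a b ≤ db a)
    (hτs : ∀ b : ℤ, 0 ≤ b → b < q → ∑ a ∈ Finset.Ico (0 : ℤ) p, τ a b = sb b) :
    ∑ a ∈ Finset.Ico (0 : ℤ) p, ∑ b ∈ Finset.Ico (0 : ℤ) q, (fl a b : ℝ) * cb a b ≤
      ∑ a ∈ Finset.Ico (0 : ℤ) p, ∑ b ∈ Finset.Ico (0 : ℤ) q, τ a b * cb a b +
        ∑ b ∈ Finset.Ico (0 : ℤ) q, (sb b : ℝ) := by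
  have h1 : ∑ a ∈ Finset.Ico (0 : ℤ) p, ∑ b ∈ Finset.Ico (0 : ℤ) q,
        ((τ a b - fl a b) * y a + (τ a b - fl a b) * y (p + b)) ≤
      ∑ a ∈ Finset.Ico (0 : ℤ) p, ∑ b ∈ Finset.Ico (0 : ℤ) q,
        (τ a b * cb a b - fl a b * cb a b + τ a b) := by
    refine Finset.sum_le_sum fun a ha => Finset.sum_le_sum fun b hb => ?_
    have ha' := Finset.mem_Ico.1 ha
    have hb' := Finset.mem_Ico.1 hb
    have h2 : τ a b ≤ db a := (Finset.single_le_sum (fun b' hb' => by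
      rw [Finset.mem_Ico] at hb'
      exact hτ0 a b' ha'.1 ha'.2 hb'.1 hb'.2) hb).trans (hτd a ha'.1 ha'.2)
    have h3 : τ a b ≤ sb b := (Finset.single_le_sum (f := fun a => τ a b) (fun a' ha' => by
      rw [Finset.mem_Ico] at ha'
      exact hτ0 a' b ha'.1 ha'.2 hb'.1 hb'.2) ha).trans_eq (hτs b hb'.1 hb'.2)
    linarith [h.slack_mul_le ha'.1 ha'.2 hb'.1 hb'.2 (hτ0 a b ha'.1 ha'.2 hb'.1 hb'.2) h2 h3]
  simp only [Finset.sum_add_distrib, Finset.sum_sub_distrib, ← Finset.sum_mul] at h1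
  have h2 : ∑ a ∈ Finset.Ico (0 : ℤ) p, ∑ b ∈ Finset.Ico (0 : ℤ) q, τ a b =
      ∑ b ∈ Finset.Ico (0 : ℤ) q, (sb b : ℝ) := by
    rw [Finset.sum_comm]
    exact Finset.sum_congr rfl fun b hb => hτs b (Finset.mem_Ico.1 hb).1 (Finset.mem_Ico.1 hb).2
  -- Both plans exhaust the scaled supplies, so the weights of the supply nodes cancel.
  have h3 : ∑ a ∈ Finset.Ico (0 : ℤ) p, ∑ b ∈ Finset.Ico (0 : ℤ) q,
      (τ a b - fl a b) * y (p + b) = 0 := by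
    rw [Finset.sum_comm]
    refine Finset.sum_eq_zero fun b hb => ?_
    rw [Finset.mem_Ico] at hb
    rw [← Finset.sum_mul, Finset.sum_sub_distrib, hτs b hb.1 hb.2, ← hus b hb.1 hb.2,
      h.used_eq b hb.1 hb.2]
    simp
  -- At a demand node that is not saturated the weight is 0. At a saturated one the competitor
  -- receives no more and the weight is nonpositive.
  have h4 : 0 ≤ ∑ a ∈ Finset.Ico (0 : ℤ) p, (∑ b ∈ Finset.Ico (0 : ℤ) q, τ a b -
      ∑ b ∈ Finset.Ico (0 : ℤ) q, (fl a b : ℝ)) * y a := by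
    refine Finset.sum_nonneg fun a ha => ?_
    rw [Finset.mem_Ico] at ha
    have h5 := hτd a ha.1 ha.2
    have h6 : ((rc a : ℤ) : ℝ) = ∑ b ∈ Finset.Ico (0 : ℤ) q, (fl a b : ℝ) := by
      rw [h.recv_eq a ha.1 ha.2]
      push_cast
      rfl
    rw [← h6]
    rcases (h.recv_le a ha.1 ha.2).lt_or_eq with h7 | h7
    · rw [h.dual_free a ha.1 ha.2 h7]
      simp
    · have h8 : (y a : ℝ) ≤ 0 := by exact_mod_cast h.dual_demand a ha.1 ha.2
      rw [h7]
      exact mul_nonneg_of_nonpos_of_nonpos (by linarith) h8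
  linarith

variable {D S : ℤ → ℝ} {c T : ℤ → ℤ → ℝ} {α θ C : ℝ}

/-- The plan for the scaled instance, scaled back, compared to any maximum plan `T`. -/
theorem Feasible.unscaled_cost_le (h : Feasible p q db sb cb fl rc us y)
    (hus : ∀ b : ℤ, 0 ≤ b → b < q → us b = sb b) (hα : 0 < α) (hθ : 0 < θ)
    (hdb : ∀ a : ℤ, 0 ≤ a → a < p → db a = ⌈D a * α⌉)
    (hsb : ∀ b : ℤ, 0 ≤ b → b < q → sb b = ⌊S b * α⌋)
    (hcb : ∀ a b : ℤ, 0 ≤ a → a < p → 0 ≤ b → b < q → cb a b = ⌊2 * c a b / θ⌋)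
    (hS : ∀ b : ℤ, 0 ≤ b → b < q → 0 ≤ S b)
    (hc : ∀ a b : ℤ, 0 ≤ a → a < p → 0 ≤ b → b < q → 0 ≤ c a b)
    (hT0 : ∀ a b : ℤ, 0 ≤ a → a < p → 0 ≤ b → b < q → 0 ≤ T a b)
    (hTd : ∀ a : ℤ, 0 ≤ a → a < p → ∑ b ∈ Finset.Ico (0 : ℤ) q, T a b ≤ D a)
    (hTs : ∀ b : ℤ, 0 ≤ b → b < q → ∑ a ∈ Finset.Ico (0 : ℤ) p, T a b = S b) :
    ∑ a ∈ Finset.Ico (0 : ℤ) p, ∑ b ∈ Finset.Ico (0 : ℤ) q, (fl a b : ℝ) / α * c a b ≤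
      ∑ a ∈ Finset.Ico (0 : ℤ) p, ∑ b ∈ Finset.Ico (0 : ℤ) q, T a b * c a b +
        θ * ∑ b ∈ Finset.Ico (0 : ℤ) q, S b := by
  have hsb0 : ∀ b : ℤ, 0 ≤ b → b < q → (0 : ℝ) ≤ sb b := fun b hb0 hb => by
    rw [hsb b hb0 hb]
    exact_mod_cast Int.floor_nonneg.2 (mul_nonneg (hS b hb0 hb) hα.le)
  have hsbS : ∀ b : ℤ, 0 ≤ b → b < q → (sb b : ℝ) ≤ S b * α := fun b hb0 hb => by
    rw [hsb b hb0 hb]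
    exact Int.floor_le _
  have hρ0 : ∀ b : ℤ, 0 ≤ b → b < q → 0 ≤ (sb b : ℝ) / S b := fun b hb0 hb =>
    div_nonneg (hsb0 b hb0 hb) (hS b hb0 hb)
  have hρ : ∀ b : ℤ, 0 ≤ b → b < q → (sb b : ℝ) / S b ≤ α := fun b hb0 hb =>
    div_le_of_le_mul₀ (hS b hb0 hb) hα.le (by linarith [hsbS b hb0 hb])
  -- The competitor scales column `b` of `T` by `sb b / S b`, so that it meets the rounded supplies
  -- exactly. As this factor is at most α, the scaled demands are respected. A column with `S b = 0`
  -- has `sb b = 0`, which agrees with the convention x/0 = 0.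
  have h1 := h.flowCost_le hus (τ := fun a b => T a b * (sb b / S b))
    (fun a b ha0 ha hb0 hb => mul_nonneg (hT0 a b ha0 ha hb0 hb) (hρ0 b hb0 hb))
    (fun a ha0 ha => by
      rw [hdb a ha0 ha]
      refine le_trans ?_ (Int.le_ceil _)
      refine le_trans ?_ (mul_le_mul_of_nonneg_right (hTd a ha0 ha) hα.le)
      rw [Finset.sum_mul]
      refine Finset.sum_le_sum fun b hb => ?_
      rw [Finset.mem_Ico] at hb
      exact mul_le_mul_of_nonneg_left (hρ b hb.1 hb.2) (hT0 a b ha0 ha hb.1 hb.2))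
    (fun b hb0 hb => by
      rw [← Finset.sum_mul, hTs b hb0 hb]
      rcases eq_or_ne (S b) 0 with h0 | h0
      · simp [h0, hsb b hb0 hb]
      · rw [mul_div_cancel₀ _ h0])
  -- Rounding down loses less than one unit θ/2 of cost per unit of flow. Together with the unit
  -- lost in `flowCost_le` this gives θ.
  have h2 : ∑ a ∈ Finset.Ico (0 : ℤ) p, ∑ b ∈ Finset.Ico (0 : ℤ) q, (fl a b : ℝ) * c a b ≤
      ∑ a ∈ Finset.Ico (0 : ℤ) p, ∑ b ∈ Finset.Ico (0 : ℤ) q,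
        (θ / 2 * (fl a b * cb a b) + θ / 2 * fl a b) := by
    refine Finset.sum_le_sum fun a ha => Finset.sum_le_sum fun b hb => ?_
    rw [Finset.mem_Ico] at ha hb
    have h3 : (0 : ℝ) ≤ fl a b := by exact_mod_cast h.flow_nonneg a b ha.1 ha.2 hb.1 hb.2
    have h4 : 2 * c a b / θ < cb a b + 1 := by
      rw [hcb a b ha.1 ha.2 hb.1 hb.2]
      exact Int.lt_floor_add_one _
    rw [div_lt_iff₀ hθ] at h4
    nlinarith [mul_le_mul_of_nonneg_left h4.le h3]
  have h3 : θ / 2 * ∑ a ∈ Finset.Ico (0 : ℤ) p, ∑ b ∈ Finset.Ico (0 : ℤ) q,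
      T a b * (sb b / S b) * cb a b ≤
      ∑ a ∈ Finset.Ico (0 : ℤ) p, ∑ b ∈ Finset.Ico (0 : ℤ) q, α * (T a b * c a b) := by
    simp only [Finset.mul_sum]
    refine Finset.sum_le_sum fun a ha => Finset.sum_le_sum fun b hb => ?_
    rw [Finset.mem_Ico] at ha hb
    have h4 : (cb a b : ℝ) ≤ 2 * c a b / θ := by
      rw [hcb a b ha.1 ha.2 hb.1 hb.2]
      exact Int.floor_le _
    rw [le_div_iff₀ hθ] at h4
    have h5 := hT0 a b ha.1 ha.2 hb.1 hb.2
    have h6 := hc a b ha.1 ha.2 hb.1 hb.2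
    have h7 := hρ0 b hb.1 hb.2
    calc θ / 2 * (T a b * (sb b / S b) * cb a b) = T a b * (sb b / S b) * (cb a b * θ / 2) := by
          ring
      _ ≤ T a b * (sb b / S b) * c a b :=
          mul_le_mul_of_nonneg_left (by linarith) (mul_nonneg h5 h7)
      _ ≤ T a b * α * c a b :=
          mul_le_mul_of_nonneg_right (mul_le_mul_of_nonneg_left (hρ b hb.1 hb.2) h5) h6
      _ = α * (T a b * c a b) := by ring
  have h4 : ∑ a ∈ Finset.Ico (0 : ℤ) p, ∑ b ∈ Finset.Ico (0 : ℤ) q, (fl a b : ℝ) =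
      ∑ b ∈ Finset.Ico (0 : ℤ) q, (sb b : ℝ) := by
    rw [Finset.sum_comm]
    refine Finset.sum_congr rfl fun b hb => ?_
    rw [Finset.mem_Ico] at hb
    rw [← hus b hb.1 hb.2, h.used_eq b hb.1 hb.2]
    push_cast
    rfl
  have h5 : ∑ b ∈ Finset.Ico (0 : ℤ) q, (sb b : ℝ) ≤ (∑ b ∈ Finset.Ico (0 : ℤ) q, S b) * α := by
    rw [Finset.sum_mul]
    refine Finset.sum_le_sum fun b hb => ?_
    rw [Finset.mem_Ico] at hb
    exact hsbS b hb.1 hb.2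
  simp only [Finset.sum_add_distrib, ← Finset.mul_sum] at h2 h3
  rw [h4] at h2
  have h6 := mul_le_mul_of_nonneg_left h1 (half_pos hθ).le
  have h7 := mul_le_mul_of_nonneg_left h5 hθ.le
  have h8 : ∑ a ∈ Finset.Ico (0 : ℤ) p, ∑ b ∈ Finset.Ico (0 : ℤ) q, (fl a b : ℝ) / α * c a b =
      (∑ a ∈ Finset.Ico (0 : ℤ) p, ∑ b ∈ Finset.Ico (0 : ℤ) q, (fl a b : ℝ) * c a b) / α := by
    simp only [Finset.sum_div, div_mul_eq_mul_div]
  rw [h8, div_le_iff₀ hα]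
  linarith

/-- The amount of supply that is left after the reduction of the plan at the demand nodes. -/
theorem Feasible.remaining_supply_le (h : Feasible p q db sb cb fl rc us y)
    (hus : ∀ b : ℤ, 0 ≤ b → b < q → us b = sb b) (hα : 0 < α)
    (hdb : ∀ a : ℤ, 0 ≤ a → a < p → db a = ⌈D a * α⌉)
    (hsb : ∀ b : ℤ, 0 ≤ b → b < q → sb b = ⌊S b * α⌋) :
    ∑ b ∈ Finset.Ico (0 : ℤ) q, S b - ∑ a ∈ Finset.Ico (0 : ℤ) p,
      min (D a) (∑ b ∈ Finset.Ico (0 : ℤ) q, (fl a b : ℝ) / α) ≤ (p + q) / α := by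
  -- The plan exceeds a demand by less than 1/α, the effect of rounding it up.
  have h1 : ∑ a ∈ Finset.Ico (0 : ℤ) p, (∑ b ∈ Finset.Ico (0 : ℤ) q, (fl a b : ℝ) / α - 1 / α) ≤
      ∑ a ∈ Finset.Ico (0 : ℤ) p, min (D a) (∑ b ∈ Finset.Ico (0 : ℤ) q, (fl a b : ℝ) / α) := by
    refine Finset.sum_le_sum fun a ha => ?_
    rw [Finset.mem_Ico] at ha
    refine le_min ?_ (sub_le_self _ (by positivity))
    have h2 : ((rc a : ℤ) : ℝ) = ∑ b ∈ Finset.Ico (0 : ℤ) q, (fl a b : ℝ) := by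
      rw [h.recv_eq a ha.1 ha.2]
      push_cast
      rfl
    have h3 : ((rc a : ℤ) : ℝ) ≤ db a := by exact_mod_cast h.recv_le a ha.1 ha.2
    have h4 := Int.ceil_lt_add_one (D a * α)
    rw [← hdb a ha.1 ha.2] at h4
    rw [← Finset.sum_div, ← h2, ← sub_div, div_le_iff₀ hα]
    linarith
  -- A supply exceeds what the plan takes from it by less than 1/α, the effect of rounding it down.
  have h2 : ∑ b ∈ Finset.Ico (0 : ℤ) q, (S b - 1 / α) ≤
      ∑ b ∈ Finset.Ico (0 : ℤ) q, ∑ a ∈ Finset.Ico (0 : ℤ) p, (fl a b : ℝ) / α := by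
    refine Finset.sum_le_sum fun b hb => ?_
    rw [Finset.mem_Ico] at hb
    have h2 : ((sb b : ℤ) : ℝ) = ∑ a ∈ Finset.Ico (0 : ℤ) p, (fl a b : ℝ) := by
      rw [← hus b hb.1 hb.2, h.used_eq b hb.1 hb.2]
      push_cast
      rfl
    have h3 := Int.lt_floor_add_one (S b * α)
    rw [← hsb b hb.1 hb.2] at h3
    rw [← Finset.sum_div, ← h2, le_div_iff₀ hα, sub_mul, one_div_mul_cancel hα.ne']
    linarith
  rw [Finset.sum_comm] at h2
  simp only [Finset.sum_sub_distrib, Finset.sum_const, Int.card_Ico, sub_zero, Int.toNat_natCast,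
    nsmul_eq_mul, mul_one_div] at h1 h2
  rw [add_div]
  linarith

/-- The bound on the cost of the recovered plan, for the scaling factor
`α = 2 (p + q) C / (ε U δ)`. -/
theorem Feasible.recovered_cost_le (h : Feasible p q db sb cb fl rc us y) {ε δ U : ℝ}
    (hus : ∀ b : ℤ, 0 ≤ b → b < q → us b = sb b) (hpq : 0 < p + q) (hC : 0 ≤ C)
    (hε0 : 0 < ε) (hε1 : ε < 1) (hδ : 0 < δ) (hU : U = ∑ b ∈ Finset.Ico (0 : ℤ) q, S b)
    (hα : α = 2 * (p + q) * C / (ε * U * δ))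
    (hdb : ∀ a : ℤ, 0 ≤ a → a < p → db a = ⌈D a * α⌉)
    (hsb : ∀ b : ℤ, 0 ≤ b → b < q → sb b = ⌊S b * α⌋)
    (hcb : ∀ a b : ℤ, 0 ≤ a → a < p → 0 ≤ b → b < q → cb a b = ⌊2 * c a b / ((1 - ε) * δ)⌋)
    (hD : ∀ a : ℤ, 0 ≤ a → a < p → 0 ≤ D a) (hS : ∀ b : ℤ, 0 ≤ b → b < q → 0 ≤ S b)
    (hc : ∀ a b : ℤ, 0 ≤ a → a < p → 0 ≤ b → b < q → 0 ≤ c a b)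
    (hT0 : ∀ a b : ℤ, 0 ≤ a → a < p → 0 ≤ b → b < q → 0 ≤ T a b)
    (hTd : ∀ a : ℤ, 0 ≤ a → a < p → ∑ b ∈ Finset.Ico (0 : ℤ) q, T a b ≤ D a)
    (hTs : ∀ b : ℤ, 0 ≤ b → b < q → ∑ a ∈ Finset.Ico (0 : ℤ) p, T a b = S b) :
    ∑ a ∈ Finset.Ico (0 : ℤ) p, ∑ b ∈ Finset.Ico (0 : ℤ) q, (fl a b : ℝ) / α * c a b +
        C * (∑ b ∈ Finset.Ico (0 : ℤ) q, S b - ∑ a ∈ Finset.Ico (0 : ℤ) p,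
          min (D a) (∑ b ∈ Finset.Ico (0 : ℤ) q, (fl a b : ℝ) / α)) ≤
      ∑ a ∈ Finset.Ico (0 : ℤ) p, ∑ b ∈ Finset.Ico (0 : ℤ) q, T a b * c a b + U * δ := by
  have hn : (0 : ℝ) < p + q := by exact_mod_cast hpq
  have hU0 : 0 ≤ U := hU ▸ Finset.sum_nonneg fun b hb => by
    rw [Finset.mem_Ico] at hb
    exact hS b hb.1 hb.2
  -- In the degenerate cases `C = 0` and `U = 0` the scaling factor is 0. Division by it then turns
  -- the plan into zero, and sending everything greedily costs at most `C * U = 0`.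
  have hpos : 0 < C ∧ 0 < U ∨ C * U = 0 ∧ α = 0 := by
    rcases hC.eq_or_lt with h1 | h1
    · exact Or.inr (by simp [hα, ← h1])
    rcases hU0.eq_or_lt with h2 | h2
    · exact Or.inr (by simp [hα, ← h2])
    · exact Or.inl ⟨h1, h2⟩
  rcases hpos with ⟨hC, hU1⟩ | ⟨hCU, hα0⟩
  · have hα1 : 0 < α := by
      rw [hα]
      positivity
    have h1 := h.unscaled_cost_le hus hα1 (mul_pos (sub_pos.2 hε1) hδ) hdb hsb hcb hS hc hT0 hTd hTs
    have h2 := mul_le_mul_of_nonneg_left (h.remaining_supply_le hus hα1 hdb hsb) hC.le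
    have h3 : C * ((p + q) / α) = ε * U * δ / 2 := by
      rw [hα]
      field_simp
    rw [← hU] at h1
    have h4 : 0 < ε * U * δ := by positivity
    linarith
  · have h1 : 0 ≤ ∑ a ∈ Finset.Ico (0 : ℤ) p, ∑ b ∈ Finset.Ico (0 : ℤ) q, T a b * c a b := by
      refine Finset.sum_nonneg fun a ha => Finset.sum_nonneg fun b hb => ?_
      rw [Finset.mem_Ico] at ha hb
      exact mul_nonneg (hT0 a b ha.1 ha.2 hb.1 hb.2) (hc a b ha.1 ha.2 hb.1 hb.2)
    have h2 : ∑ a ∈ Finset.Ico (0 : ℤ) p, min (D a) 0 = 0 := by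
      refine Finset.sum_eq_zero fun a ha => ?_
      rw [Finset.mem_Ico] at ha
      exact min_eq_right (hD a ha.1 ha.2)
    simp only [hα0, div_zero, zero_mul, Finset.sum_const_zero, h2, ← hU, sub_zero, hCU]
    have := mul_nonneg hU0 hδ.le
    linarith

end

/-! ### Optimal plans -/

theorem sum_Ico_eq_sum_fin {M : Type*} [AddCommMonoid M] (n : ℕ) (f : ℤ → M) :
    ∑ i ∈ Finset.Ico (0 : ℤ) n, f i = ∑ i : Fin n, f (i : ℕ) := by
  induction n with
  | zero => simp
  | succ n ih =>
    rw [Fin.sum_univ_castSucc, Nat.cast_succ, sum_Ico_succ _ (Int.natCast_nonneg n), ih]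
    simp

/-- The maximum plans form a closed subset of a box, hence a compact set, on which the continuous
cost attains its minimum. -/
theorem exists_optimalPlan {p q : ℕ} (I : TransportInstance p q) {τ : Fin p → Fin q → ℝ}
    (hτ : I.IsMaxPlan τ) : ∃ σ, I.IsOptimalPlan σ := by
  have hcl : IsClosed {σ | I.IsMaxPlan σ} := by
    simp only [TransportInstance.IsMaxPlan, TransportInstance.IsPlan, Set.ofPred_and,
      Set.ofPred_forall]
    refine .inter (.inter ?_ (.inter ?_ ?_)) ?_
    · exact isClosed_iInter fun a => isClosed_iInter fun b => isClosed_le (by fun_prop) (by fun_prop)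
    · exact isClosed_iInter fun a => isClosed_le (by fun_prop) (by fun_prop)
    · exact isClosed_iInter fun b => isClosed_le (by fun_prop) (by fun_prop)
    · exact isClosed_iInter fun b => isClosed_eq (by fun_prop) (by fun_prop)
  have hsub : {σ | I.IsMaxPlan σ} ⊆ Set.Icc 0 (fun _ b => I.supply b) := fun σ hσ =>
    ⟨fun a b => hσ.1.1 a b, fun a b =>
      (Finset.single_le_sum (f := fun a => σ a b) (fun a _ => hσ.1.1 a b)
        (Finset.mem_univ a)).trans (hσ.1.2.2 b)⟩
  obtain ⟨σ, hσ, hmin⟩ := (isCompact_Icc.of_isClosed_subset hcl hsub).exists_isMinOn ⟨τ, hτ⟩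
    (f := I.planCost) (Continuous.continuousOn (by unfold TransportInstance.planCost; fun_prop))
  exact ⟨σ, hσ, fun τ hτ => hmin hτ⟩

/-! ### The whole algorithm -/

/-- The properties of a store `s` that holds an instance, with integer indices. -/
structure InputBounds (p q : ℕ) (s : Store) (C : ℝ) : Prop where
  nA_eq : s.ireg nA = p
  nB_eq : s.ireg nB = q
  demand_nonneg : ∀ a : ℤ, 0 ≤ a → a < p → 0 ≤ s.rvec demand a
  supply_nonneg : ∀ b : ℤ, 0 ≤ b → b < q → 0 ≤ s.rvec supply b
  cost_nonneg : ∀ a b : ℤ, 0 ≤ a → a < p → 0 ≤ b → b < q → 0 ≤ s.rmat cost a b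
  cost_le : ∀ a b : ℤ, 0 ≤ a → a < p → 0 ≤ b → b < q → s.rmat cost a b ≤ C
  cost_eq : ∃ a b : ℤ, 0 ≤ a ∧ a < p ∧ 0 ≤ b ∧ b < q ∧ s.rmat cost a b = C
  supply_le : ∑ b ∈ Finset.Ico (0 : ℤ) q, s.rvec supply b ≤
    ∑ a ∈ Finset.Ico (0 : ℤ) p, s.rvec demand a

theorem InputBounds.maxCost_nonneg {p q : ℕ} {s : Store} {C : ℝ} (h : InputBounds p q s C) :
    0 ≤ C := by
  obtain ⟨a, b, ha0, ha, hb0, hb, rfl⟩ := h.cost_eq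
  exact h.cost_nonneg a b ha0 ha hb0 hb

theorem exists_fin_eq {n : ℕ} {i : ℤ} (h0 : 0 ≤ i) (h : i < n) : ∃ j : Fin n, i = (j : ℕ) :=
  ⟨⟨i.toNat, by omega⟩, (Int.toNat_of_nonneg h0).symm⟩

theorem Store.HoldsInput.inputBounds {p q : ℕ} {I : TransportInstance p q} {C ε δ : ℝ} {s : Store}
    (h : s.HoldsInput I ε δ) (hC : I.IsMaxCost C) : InputBounds p q s C where
  nA_eq := h.nA_eq
  nB_eq := h.nB_eq
  demand_nonneg a ha0 ha := by
    obtain ⟨a, rfl⟩ := exists_fin_eq ha0 ha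
    rw [h.demand_eq]
    exact I.demand_nonneg a
  supply_nonneg b hb0 hb := by
    obtain ⟨b, rfl⟩ := exists_fin_eq hb0 hb
    rw [h.supply_eq]
    exact I.supply_nonneg b
  cost_nonneg a b ha0 ha hb0 hb := by
    obtain ⟨a, rfl⟩ := exists_fin_eq ha0 ha
    obtain ⟨b, rfl⟩ := exists_fin_eq hb0 hb
    rw [h.cost_eq]
    exact I.cost_nonneg a b
  cost_le a b ha0 ha hb0 hb := by
    obtain ⟨a, rfl⟩ := exists_fin_eq ha0 ha
    obtain ⟨b, rfl⟩ := exists_fin_eq hb0 hb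
    rw [h.cost_eq]
    exact hC.2 ⟨a, b, rfl⟩
  cost_eq := by
    obtain ⟨a, b, rfl⟩ := hC.1
    exact ⟨(a : ℕ), (b : ℕ), by omega, by omega, by omega, by omega, h.cost_eq a b⟩
  supply_le := by
    simp only [sum_Ico_eq_sum_fin, h.demand_eq, h.supply_eq]
    exact I.supply_le_demand

/-- In the time bound, `W` is the total scaled supply. The initial `augWork` is 2(N+1)W since the
zero plan costs nothing, which with the factor 500 gives the coefficient 1000. The coefficient 800
collects scaling, initialization and recovery. -/
theorem gabowTarjan_spec {s : Store} {p q : ℕ} {C U : ℝ} (h : InputBounds p q s C)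
    (hε0 : 0 < s.rreg eps) (hε1 : s.rreg eps < 1) (hδ : 0 < s.rreg delta)
    (hU : U = ∑ b ∈ Finset.Ico (0 : ℤ) q, s.rvec supply b) :
    WP gabowTarjan s fun s' t =>
      (∃ W N : ℤ, (W : ℝ) ≤ 2 * (p + q) * C / (s.rreg eps * s.rreg delta) ∧
        N = ⌊2 * C / ((1 - s.rreg eps) * s.rreg delta)⌋ ∧ s'.ireg phases ≤ N + 1 ∧
        (t : ℤ) ≤ 1000 * ((N + 1) * W) + 868 * (p + q + 1) ^ 2 * (N + 1) +
          800 * (p + q + 1) ^ 2 + 4) ∧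
      (∀ a b : ℤ, 0 ≤ a → a < p → 0 ≤ b → b < q → 0 ≤ s'.rmat plan a b) ∧
      (∀ a : ℤ, 0 ≤ a → a < p →
        ∑ b ∈ Finset.Ico (0 : ℤ) q, s'.rmat plan a b ≤ s.rvec demand a) ∧
      (∀ b : ℤ, 0 ≤ b → b < q →
        ∑ a ∈ Finset.Ico (0 : ℤ) p, s'.rmat plan a b = s.rvec supply b) ∧
      ∀ T : ℤ → ℤ → ℝ, (∀ a b : ℤ, 0 ≤ a → a < p → 0 ≤ b → b < q → 0 ≤ T a b) →
        (∀ a : ℤ, 0 ≤ a → a < p → ∑ b ∈ Finset.Ico (0 : ℤ) q, T a b ≤ s.rvec demand a) →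
        (∀ b : ℤ, 0 ≤ b → b < q → ∑ a ∈ Finset.Ico (0 : ℤ) p, T a b = s.rvec supply b) →
        ∑ a ∈ Finset.Ico (0 : ℤ) p, ∑ b ∈ Finset.Ico (0 : ℤ) q,
            s'.rmat plan a b * s.rmat cost a b ≤
          ∑ a ∈ Finset.Ico (0 : ℤ) p, ∑ b ∈ Finset.Ico (0 : ℤ) q, T a b * s.rmat cost a b +
            U * s.rreg delta := by
  have hC := h.maxCost_nonneg
  have hU0 : 0 ≤ U := hU ▸ Finset.sum_nonneg fun b hb => by
    rw [Finset.mem_Ico] at hb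
    exact h.supply_nonneg b hb.1 hb.2
  have hθ : 0 < (1 - s.rreg eps) * s.rreg delta := mul_pos (sub_pos.2 hε1) hδ
  obtain ⟨α, hα⟩ : ∃ α, α = 2 * (p + q) * C / (s.rreg eps * U * s.rreg delta) := ⟨_, rfl⟩
  have hα0 : 0 ≤ α := by
    rw [hα]
    positivity
  unfold gabowTarjan
  refine WP.seq (scaleInstance_spec h.nA_eq h.nB_eq hC h.cost_le h.cost_eq (hU ▸ hα)) ?_
  rintro s₁ t₁ hk₁ ⟨ht₁, hα₁, hdb, hsb, hcb⟩
  have hcb0 : ∀ a b : ℤ, 0 ≤ a → a < p → 0 ≤ b → b < q → 0 ≤ s₁.imat cbar a b :=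
    fun a b ha0 ha hb0 hb => by
      rw [hcb a b ha0 ha hb0 hb, Int.floor_nonneg]
      exact div_nonneg (mul_nonneg two_pos.le (h.cost_nonneg a b ha0 ha hb0 hb)) hθ.le
  have hcN : ∀ a b : ℤ, 0 ≤ a → a < p → 0 ≤ b → b < q →
      s₁.imat cbar a b ≤ ⌊2 * C / ((1 - s.rreg eps) * s.rreg delta)⌋ :=
    fun a b ha0 ha hb0 hb => by
      rw [hcb a b ha0 ha hb0 hb]
      gcongr
      exact h.cost_le a b ha0 ha hb0 hb
  have hdb0 : ∀ a : ℤ, 0 ≤ a → a < p → 0 ≤ s₁.ivec dbar a := fun a ha0 ha => by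
    rw [hdb a ha0 ha]
    exact Int.ceil_nonneg (mul_nonneg (h.demand_nonneg a ha0 ha) hα0)
  have hsb0 : ∀ b : ℤ, 0 ≤ b → b < q → 0 ≤ s₁.ivec sbar b := fun b hb0 hb => by
    rw [hsb b hb0 hb, Int.floor_nonneg]
    exact mul_nonneg (h.supply_nonneg b hb0 hb) hα0
  have hsbU : ((∑ b ∈ Finset.Ico (0 : ℤ) q, s₁.ivec sbar b : ℤ) : ℝ) ≤ U * α := by
    rw [hU, Finset.sum_mul]
    push_cast
    refine Finset.sum_le_sum fun b hb => ?_
    rw [Finset.mem_Ico] at hb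
    rw [hsb b hb.1 hb.2]
    exact Int.floor_le _
  have hsd : ∑ b ∈ Finset.Ico (0 : ℤ) q, s₁.ivec sbar b ≤
      ∑ a ∈ Finset.Ico (0 : ℤ) p, s₁.ivec dbar a := by
    have h1 : (∑ a ∈ Finset.Ico (0 : ℤ) p, s.rvec demand a) * α ≤
        ((∑ a ∈ Finset.Ico (0 : ℤ) p, s₁.ivec dbar a : ℤ) : ℝ) := by
      rw [Finset.sum_mul]
      push_cast
      refine Finset.sum_le_sum fun a ha => ?_
      rw [Finset.mem_Ico] at ha
      rw [hdb a ha.1 ha.2]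
      exact Int.le_ceil _
    exact_mod_cast hsbU.trans
      ((mul_le_mul_of_nonneg_right (hU ▸ h.supply_le) hα0).trans h1)
  refine WP.seq (initPlan_spec (p := p) (q := q) ((hk₁.ireg nA rfl).trans h.nA_eq)
    ((hk₁.ireg nB rfl).trans h.nB_eq) hcb0 hdb0 hsb0) ?_
  rintro s₂ t₂ hk₂ ⟨ht₂, hI₂, hbl₂, hfc, hlft, hph⟩
  refine WP.seq (phases_spec hI₂ hbl₂ hcb0
    (Int.floor_nonneg.2 (div_nonneg (mul_nonneg two_pos.le hC) hθ.le)) hcN hsd hph) ?_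
  rintro s₃ t₃ hk₃ ⟨ht₃, hI₃, hl₃, hph₃⟩
  have e1 : s₃.rvec demand = s.rvec demand :=
    (hk₃.rvec demand rfl).trans ((hk₂.rvec demand rfl).trans (hk₁.rvec demand rfl))
  have e2 : s₃.rvec supply = s.rvec supply :=
    (hk₃.rvec supply rfl).trans ((hk₂.rvec supply rfl).trans (hk₁.rvec supply rfl))
  have e3 : s₃.rreg alpha = α :=
    (hk₃.rreg alpha rfl).trans ((hk₂.rreg alpha rfl).trans hα₁)
  have hF := hI₃.feasible
  -- No supply is left in total and no node is overused, so every scaled supply is used up exactly.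
  have hus : ∀ b : ℤ, 0 ≤ b → b < q → s₃.ivec used b = s₁.ivec sbar b := fun b hb0 hb =>
    (Finset.sum_eq_sum_iff_of_le fun b hb => by
      rw [Finset.mem_Ico] at hb
      exact hF.used_le b hb.1 hb.2).1 (by linarith [hI₃.left_eq]) b (Finset.mem_Ico.2 ⟨hb0, hb⟩)
  have hx0 : ∀ a b : ℤ, 0 ≤ a → a < p → 0 ≤ b → b < q → 0 ≤ (s₃.imat flow a b : ℝ) / α :=
    fun a b ha0 ha hb0 hb => by
      have : (0 : ℝ) ≤ s₃.imat flow a b := by exact_mod_cast hF.flow_nonneg a b ha0 ha hb0 hb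
      positivity
  have hcol : ∀ b : ℤ, 0 ≤ b → b < q →
      ∑ a ∈ Finset.Ico (0 : ℤ) p, (s₃.imat flow a b : ℝ) / α ≤ s₃.rvec supply b :=
    fun b hb0 hb => by
      have h1 : ((s₁.ivec sbar b : ℤ) : ℝ) = ∑ a ∈ Finset.Ico (0 : ℤ) p, (s₃.imat flow a b : ℝ) := by
        rw [← hus b hb0 hb, hF.used_eq b hb0 hb]
        push_cast
        rfl
      have h2 := h.supply_nonneg b hb0 hb
      rw [← Finset.sum_div, ← h1, e2]
      refine div_le_of_le_mul₀ hα0 h2 ?_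
      rw [hsb b hb0 hb]
      exact Int.floor_le _
  refine (recoverPlan_spec (x := fun a b => (s₃.imat flow a b : ℝ) / α) hI₃.nA_eq hI₃.nB_eq
    (fun a b => by rw [e3]) hx0 (by rw [e1]; exact h.demand_nonneg) hcol
    (by rw [e1, e2]; exact h.supply_le)).mono ?_
  rw [e1, e2]
  rintro s₄ t₄ hk₄ ⟨ht₄, h1, h2, h3, h4⟩
  refine ⟨⟨_, _, hsbU.trans ?_, rfl, (hk₄.ireg phases rfl).trans_le hph₃, ?_⟩, h1, h2, h3,
    fun T hT0 hTd hTs => ?_⟩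
  -- For positive `U` the factor cancels in `U * α`. For `U = 0` the bound only has to be
  -- nonnegative.
  · rcases hU0.eq_or_lt with h0 | h0
    · rw [← h0, zero_mul]
      positivity
    · rw [hα]
      refine le_of_eq ?_
      field_simp
  · rw [augWork, hfc, hlft] at ht₃
    have : ((t₁ + (t₂ + (t₃ + t₄)) : ℕ) : ℤ) = t₁ + (t₂ + (t₃ + t₄)) := by push_cast; rfl
    zify at ht₁ ht₂ ht₄
    rw [this]
    linarith
  · obtain ⟨a, b, ha0, ha, hb0, hb, -⟩ := h.cost_eq
    exact (h4 (s.rmat cost) C fun a b ha0 ha hb0 hb => ⟨h.cost_nonneg a b ha0 ha hb0 hb,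
      h.cost_le a b ha0 ha hb0 hb⟩).trans (hF.recovered_cost_le hus (by omega) hC hε0 hε1 hδ hU hα
        hdb hsb hcb h.demand_nonneg h.supply_nonneg h.cost_nonneg hT0 hTd hTs)

/-- With X = C/((1-ε)δ), the assumption δ ≤ C gives X ≥ 1, so N + 1 ≤ 3X and the lower-order terms
are absorbed in n²X. The constants add up to 6000 for the second summand and to 10416 + 3200 + 4 for
the first. -/
theorem running_time_le {n t : ℕ} {W N : ℤ} {C ε δ : ℝ} (hn : 1 ≤ n) (hε0 : 0 < ε) (hε1 : ε < 1)
    (hδ : 0 < δ) (hδC : δ ≤ C) (hW : (W : ℝ) ≤ 2 * n * C / (ε * δ))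
    (hN : N = ⌊2 * C / ((1 - ε) * δ)⌋)
    (ht : (t : ℤ) ≤ 1000 * ((N + 1) * W) + 868 * (n + 1) ^ 2 * (N + 1) + 800 * (n + 1) ^ 2 + 4) :
    (t : ℝ) ≤ 20000 * ((n : ℝ) ^ 2 * C / ((1 - ε) * δ) + n * C ^ 2 / (ε * (1 - ε) * δ ^ 2)) := by
  have hε : 0 < 1 - ε := sub_pos.2 hε1
  have hθ : 0 < (1 - ε) * δ := mul_pos hε hδ
  have hC : 0 < C := hδ.trans_le hδC
  obtain ⟨X, hX⟩ : ∃ X, X = C / ((1 - ε) * δ) := ⟨_, rfl⟩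
  have hX1 : 1 ≤ X := by
    rw [hX, one_le_div hθ]
    nlinarith
  have hN0 : 0 ≤ N := by
    rw [hN, Int.floor_nonneg]
    positivity
  have hN1 : (0 : ℝ) ≤ N + 1 := by exact_mod_cast (by omega : 0 ≤ N + 1)
  have hN2 : (N : ℝ) + 1 ≤ 3 * X := by
    have := Int.floor_le (2 * C / ((1 - ε) * δ))
    rw [← hN, mul_div_assoc, ← hX] at this
    linarith
  have ht' : (t : ℝ) ≤ 1000 * ((N + 1) * W) + 868 * (n + 1) ^ 2 * (N + 1) + 800 * (n + 1) ^ 2 + 4 := by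
    exact_mod_cast ht
  have hn1 : (1 : ℝ) ≤ n := by exact_mod_cast hn
  have hn2 : ((n : ℝ) + 1) ^ 2 ≤ 4 * n ^ 2 := by nlinarith
  have h0 : 0 ≤ 2 * n * C / (ε * δ) := by positivity
  have h1 : ((N : ℝ) + 1) * W ≤ 3 * X * (2 * n * C / (ε * δ)) :=
    (mul_le_mul_of_nonneg_left hW hN1).trans (mul_le_mul_of_nonneg_right hN2 h0)
  have h2 : ((n : ℝ) + 1) ^ 2 * (N + 1) ≤ 4 * n ^ 2 * (3 * X) :=
    mul_le_mul hn2 hN2 hN1 (by positivity)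
  have h3 : (n : ℝ) ^ 2 ≤ n ^ 2 * X := le_mul_of_one_le_right (by positivity) hX1
  have h4 : (1 : ℝ) ≤ n ^ 2 := one_le_pow₀ hn1
  have h5 : (n : ℝ) ^ 2 * C / ((1 - ε) * δ) = n ^ 2 * X := by rw [hX, mul_div_assoc]
  have h6 : (n : ℝ) * C ^ 2 / (ε * (1 - ε) * δ ^ 2) = X * (2 * n * C / (ε * δ)) / 2 := by
    rw [hX]
    field_simp
  have h7 : 0 ≤ X * (2 * n * C / (ε * δ)) := by positivity
  rw [h5, h6]
  linarith

end RealRAM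

/-! ### From the specification of the program to the theorem. -/

theorem mainTheorem1 :
    ∃ K : ℝ, 0 < K ∧
      ∀ (p q : ℕ) (I : TransportInstance p q) (C ε δ : ℝ),
        I.IsMaxCost C → 0 < ε → ε < 1 → 0 < δ →
        ∀ s : RealRAM.Store, s.HoldsInput I ε δ →
          ∃ (s' : RealRAM.Store) (t : ℕ),
            RealRAM.Exec RealRAM.gabowTarjan s s' t ∧
            (∀ (s'' : RealRAM.Store) (t' : ℕ),
              RealRAM.Exec RealRAM.gabowTarjan s s'' t' → s'' = s' ∧ t' = t) ∧
            I.IsClosePlan δ (s'.outputPlan p q) ∧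
            s'.phaseCount ≤ ⌊2 * C / ((1 - ε) * δ)⌋ + 1 ∧
            (δ ≤ C →
              (t : ℝ) ≤ K * (((p + q : ℕ) : ℝ) ^ 2 * C / ((1 - ε) * δ) +
                ((p + q : ℕ) : ℝ) * C ^ 2 / (ε * (1 - ε) * δ ^ 2))) := by
  refine ⟨20000, by norm_num, fun p q I C ε δ hC hε0 hε1 hδ s hs => ?_⟩
  have hB := hs.inputBounds hC
  have hεs := hs.eps_eq
  have hδs := hs.delta_eq
  have hdem := hs.demand_eq
  have hsup := hs.supply_eq
  have hcost := hs.cost_eq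
  subst hεs hδs
  obtain ⟨s', t, hex, ⟨W, N, hW, hN, hph, ht⟩, h0, hd, hsp, hT⟩ :=
    RealRAM.gabowTarjan_spec hB hε0 hε1 hδ rfl
  simp only [RealRAM.sum_Ico_eq_sum_fin] at hd hsp hT
  have hmax : I.IsMaxPlan (s'.outputPlan p q) := by
    have hsp' : ∀ b, ∑ a, s'.outputPlan p q a b = I.supply b := fun b =>
      (hsp (b : ℕ) (by omega) (by omega)).trans (hsup b)
    exact ⟨⟨fun a b => h0 _ _ (by omega) (by omega) (by omega) (by omega),
      fun a => (hd (a : ℕ) (by omega) (by omega)).trans_eq (hdem a), fun b => (hsp' b).le⟩, hsp'⟩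
  -- The computed plan itself shows that maximum plans exist.
  obtain ⟨τ, hτ⟩ := RealRAM.exists_optimalPlan I hmax
  refine ⟨s', t, hex, fun s'' t' h => hex.deterministic h, ⟨hmax, τ, hτ, ?_⟩, hN ▸ hph, fun hδC => ?_⟩
  -- The optimal plan is extended by zero to integer indices, so that it can be compared with the
  -- output array.
  · obtain ⟨T, hTτ⟩ : ∃ T : ℤ → ℤ → ℝ, ∀ (a : Fin p) (b : Fin q), T (a : ℕ) (b : ℕ) = τ a b :=
      ⟨fun i j => if h : i.toNat < p ∧ j.toNat < q then τ ⟨_, h.1⟩ ⟨_, h.2⟩ else 0, by simp⟩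
    have := hT T (fun a b ha0 ha hb0 hb => by
        obtain ⟨a, rfl⟩ := RealRAM.exists_fin_eq ha0 ha
        obtain ⟨b, rfl⟩ := RealRAM.exists_fin_eq hb0 hb
        rw [hTτ]
        exact hτ.1.1.1 a b)
      (fun a ha0 ha => by
        obtain ⟨a, rfl⟩ := RealRAM.exists_fin_eq ha0 ha
        simp only [hTτ, hdem]
        exact hτ.1.1.2.1 a)
      (fun b hb0 hb => by
        obtain ⟨b, rfl⟩ := RealRAM.exists_fin_eq hb0 hb
        simp only [hTτ, hsup]
        exact hτ.1.2 b)
    simp only [hTτ, hcost, hsup] at this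
    exact this
  · obtain ⟨a, b, -⟩ := hC.1
    -- There is an edge, so n ≥ 1.
    have := a.pos
    refine RealRAM.running_time_le (W := W) (by omega) hε0 hε1 hδ hδC ?_ hN ?_
    · push_cast
      exact hW
    · push_cast
      exact ht
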